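/- **Setting.** Let $d\ge 1$. Let $\Omega$ be the set of measurable maps $\mathbf a$ from $\mathbb R^d$ into the symmetric positive definite $d\times d$ matrices such that $\sup_{x\in U}|\mathbf a(x)|+\sup_{x\in U}|\mathbf a(x)^{-1}|<\infty$ for every bounded domain $U\subset\mathbb R^d$, where $|\cdot|$ is the Euclidean operator norm. For a Borel set $U\subseteq\mathbb R^d$ let $\mathcal F_U$ be the $\sigma$-algebra on $\Omega$ generated by the maps $\mathbf a\mapsto\int_{\mathbb R^d} e_i\cdot\mathbf a(x)e_j\,\varphi(x)\,dx$ with $1\le i,j\le d$ and $\varphi\in C_c^\infty(U)$, and let $\mathcal F=\mathcal F_{\mathbb R^d}$. Let $r\in(0,1)$ and let $\mathbb P$ be a probability measure on $(\Omega,\mathcal F)$, with expectation $\mathbb E$, such that: * (stationarity) $\mathbb P[T_zA]=\mathbb P[A]$ for all $z\in\mathbb Z^d$ and $A\in\mathcal F$, where $(T_z\mathbf a)(x)=\mathbf a(x+z)$ and $T_zA=\{T_z\mathbf a:\mathbf a\in A\}$; * (mixing) for all Borel sets $U,V\subset\mathbb R^d$ at $\ell^\infty$-distance at least $1$, the maximal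 correlation of $\mathcal F_U$ and $\mathcal F_V$ is at most $r$, that is, $\operatorname{Cov}[f,g]\le r\operatorname{Var}[f]^{1/2}\operatorname{Var}[g]^{1/2}$ for all square-integrable $f,g$ that are respectively $\mathcal F_U$- and $\mathcal F_V$-measurable. For $n\in\mathbb N=\{0,1,2,\dots\}$ let $\square_n=(-\tfrac12 3^n,\tfrac12 3^n)^d$. For bounded Lipschitz domains $U$ put $$\Lambda(U)=\operatorname*{ess\,sup}_{x\in U}\sup_{|\xi|=1}\xi\cdot\mathbf a(x)\xi,\qquad \lambda(U)=\operatorname*{ess\,inf}_{x\in U}\inf_{|\xi|=1}\xi\cdot\mathbf a(x)\xi,$$ $$\mu(U,p)=\inf_{w\in H^1_0(U)}\frac1{|U|}\int_U\tfrac12(p+\nabla w)\cdot\mathbf a(p+\nabla w)\qquad(p\in\mathbb R^d).$$ The coarse-grained matrix $\mathbf a(U)$ is the symmetric matrix with $\mu(U,p)=\tfrac12\,p\cdot\mathbf a(U)p$ for all $p\in\mathbb R^d$, and the homogenized matrix $\bar{\mathbf a}$ is the symmetric matrix with $$\tfrac12\,p\cdot\bar{\mathbf a}p=\lim_{m\to\infty}\mathbb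 E[\mu(\square_m,p)]=\inf_{m\in\mathbb N}\mathbb E[\mu(\square_m,p)]\qquad(p\in\mathbb R^d).$$ Fix $L<\infty$. A pair of positive real sequences $(\{\delta_n\}_{n\in\mathbb N},\{M_n\}_{n\in\mathbb N})$ is called *suppressive* if $\{\delta_n\}$ is nonincreasing, $\{M_n\}$ is nondecreasing, $\delta_0=M_0=1$, and for every $n\in\mathbb N$ $$\mathbb E\Big[\big(\lambda(\square_n)^{-3}+\Lambda(\square_n)^3\big)\,\mathbf 1_{\{\lambda(\square_n)\le\delta_n\}\cup\{\Lambda(\square_n)\ge M_n\}}\Big]\le L\,e^{-n}.$$ **Theorem.** Let $d\ge1$, $r\in(0,1)$, $\alpha\in(0,\tfrac13)$ and $L<\infty$. There exist constants $c>0$ and $C<\infty$, depending only on $d,r,\alpha,L$, such that the following holds for every $\mathbb P$ as above. If there exists a suppressive pair $(\{\delta_n\},\{M_n\})$ with $M_n/\delta_n\le(n+1)^\alpha$ for every $n\in\mathbb N$, then the matrices $\mathbf a(\square_n)$ and $\bar{\mathbf a}$ are well defined (the functions $p\mapsto\mu(\square_n,p)$ and $p\mapsto\inf_m\mathbb E[\mu(\square_m,p)]$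 are quadratic forms, and $\mu(\square_m,p)$ is integrable with $\mathbb E[\mu(\square_m,p)]$ converging to its infimum), and for every $n\in\mathbb N$ $$\mathbb E\big[\,|\bar{\mathbf a}-\mathbf a(\square_n)|^2\,\big]\le C\exp\!\big(-c\,n^{1-3\alpha}\big),$$ where $|\bar{\mathbf a}-\mathbf a(\square_n)|^2$ is integrable. -/

import Mathlib

open MeasureTheory ProbabilityTheory Filter Topology
open scoped Matrix ContDiff

noncomputable section

namespace UnboundedHomogenization

/-- Points and vectors of `ℝ^d`. The norm which this type carries in Mathlib is the
`l^∞` norm; Euclidean quantities are always written through the dot product `⬝ᵥ`. -/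
abbrev Vec (d : ℕ) : Type := Fin d → ℝ

/-- Real `d × d` matrices. -/
abbrev Mat (d : ℕ) : Type := Matrix (Fin d) (Fin d) ℝ

/-- The operator norm of a matrix with respect to the Euclidean norm. -/
def opNorm {d : ℕ} (A : Mat d) : ℝ := ‖Matrix.toEuclideanCLM (𝕜 := ℝ) (n := Fin d) A‖

/-- The triadic cube `(-3^n/2, 3^n/2)^d`. -/
def cube (d n : ℕ) : Set (Vec d) :=
  {x | ∀ i, -((1 / 2 : ℝ) * 3 ^ n) < x i ∧ x i < (1 / 2 : ℝ) * 3 ^ n}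

/-! ### Coefficient fields -/

/-- The set `Ω` of coefficient fields: measurable maps from `ℝ^d` to the (symmetric) positive
definite matrices such that the field and its inverse are bounded on bounded sets. -/
structure CoeffField (d : ℕ) where
  toFun : Vec d → Mat d
  measurable_entry : ∀ i j, Measurable fun x => toFun x i j
  posDef : ∀ x, (toFun x).PosDef
  locallyBounded : ∀ U : Set (Vec d), Bornology.IsBounded U →
    ∃ K : ℝ, ∀ x ∈ U, opNorm (toFun x) ≤ K ∧ opNorm (toFun x)⁻¹ ≤ K

/-- `φ ∈ C_c^∞(U)`, as a function on the whole of `ℝ^d`. -/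
def IsTestFunction {d : ℕ} (U : Set (Vec d)) (φ : Vec d → ℝ) : Prop :=
  ContDiff ℝ ∞ φ ∧ HasCompactSupport φ ∧ tsupport φ ⊆ U

/-- The σ-algebra `F_U`, generated by the maps `a ↦ ∫ a_{ij}(x) φ(x) dx` with
`φ ∈ C_c^∞(U)`. -/
@[reducible] def sigmaField {d : ℕ} (U : Set (Vec d)) : MeasurableSpace (CoeffField d) :=
  ⨆ (i : Fin d) (j : Fin d) (φ : Vec d → ℝ) (_ : IsTestFunction U φ),
    MeasurableSpace.comap (fun a : CoeffField d => ∫ x, a.toFun x i j * φ x) (borel ℝ)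

/-- `Ω` carries the σ-algebra `F = F_{ℝ^d}`. -/
instance instMeasurableSpaceCoeffField (d : ℕ) : MeasurableSpace (CoeffField d) :=
  sigmaField Set.univ

/-- The shift `(T_y a)(x) = a(x + y)`. -/
def shift {d : ℕ} (y : Vec d) (a : CoeffField d) : CoeffField d where
  toFun x := a.toFun (x + y)
  measurable_entry i j := (a.measurable_entry i j).comp (measurable_id.add_const y)
  posDef x := a.posDef (x + y)
  locallyBounded U hU := by
    obtain ⟨K, hK⟩ := a.locallyBounded ((fun x => x + y) '' U)
      (by
        have h : LipschitzWith 1 (fun x : Vec d => x + y) :=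
          LipschitzWith.of_dist_le_mul fun u v => by simp
        exact h.isBounded_image hU)
    exact ⟨K, fun x hx => hK _ ⟨x, hx, rfl⟩⟩

/-- Stationarity with respect to translations by integer vectors. -/
def IsStationary {d : ℕ} (P : Measure (CoeffField d)) : Prop :=
  ∀ (z : Fin d → ℤ) (A : Set (CoeffField d)), MeasurableSet A →
    P (shift (fun i => (z i : ℝ)) '' A) = P A

/-- The maximal correlation of the σ-algebras `𝒜` and `ℬ` is at most `r`. (If one of the
variances vanishes, so does the covariance.) -/
def MaximalCorrelationLE {Ω : Type*} [MeasurableSpace Ω] (P : Measure Ω)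
    (𝒜 ℬ : MeasurableSpace Ω) (r : ℝ) : Prop :=
  ∀ f g : Ω → ℝ, Measurable[𝒜] f → MemLp f 2 P → Measurable[ℬ] g → MemLp g 2 P →
    covariance f g P ≤ r * (Real.sqrt (variance f P) * Real.sqrt (variance g P))

/-- The mixing condition: Borel sets at `l^∞`-distance at least one have maximal correlation
at most `r`. -/
def IsMixing {d : ℕ} (P : Measure (CoeffField d)) (r : ℝ) : Prop :=
  ∀ U V : Set (Vec d), MeasurableSet U → MeasurableSet V →
    (∀ u ∈ U, ∀ v ∈ V, 1 ≤ dist u v) →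
      MaximalCorrelationLE P (sigmaField U) (sigmaField V) r

/-! ### Extremal ellipticity constants in a domain -/

/-- `Λ(U) = ess sup_{x ∈ U} sup_{|ξ| = 1} ξ · a(x) ξ`. -/
def upperEll {d : ℕ} (a : CoeffField d) (U : Set (Vec d)) : ℝ :=
  essSup (fun x => ⨆ ξ : {ξ : Vec d // ξ ⬝ᵥ ξ = 1}, ξ.1 ⬝ᵥ (a.toFun x *ᵥ ξ.1))
    (volume.restrict U)

/-- `λ(U) = ess inf_{x ∈ U} inf_{|ξ| = 1} ξ · a(x) ξ`. -/
def lowerEll {d : ℕ} (a : CoeffField d) (U : Set (Vec d)) : ℝ :=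
  essInf (fun x => ⨅ ξ : {ξ : Vec d // ξ ⬝ᵥ ξ = 1}, ξ.1 ⬝ᵥ (a.toFun x *ᵥ ξ.1))
    (volume.restrict U)

/-- Suppressive pairs of sequences, with constant `L`. -/
structure IsSuppressive {d : ℕ} (P : Measure (CoeffField d)) (L : ℝ) (δ M : ℕ → ℝ) : Prop where
  δ_pos : ∀ n, 0 < δ n
  M_pos : ∀ n, 0 < M n
  δ_antitone : Antitone δ
  M_monotone : Monotone M
  δ_zero : δ 0 = 1
  M_zero : M 0 = 1
  tail : ∀ n : ℕ,
    ∫⁻ a in {a | lowerEll a (cube d n) ≤ δ n} ∪ {a | M n ≤ upperEll a (cube d n)},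
        ENNReal.ofReal ((lowerEll a (cube d n))⁻¹ ^ 3 + upperEll a (cube d n) ^ 3) ∂P
      ≤ ENNReal.ofReal (L * Real.exp (-(n : ℝ)))

/-! ### Sobolev spaces -/

/-- The partial derivative `∂_i φ`. -/
def partialDeriv {d : ℕ} (i : Fin d) (φ : Vec d → ℝ) (x : Vec d) : ℝ :=
  fderiv ℝ φ x (Pi.single i 1)

/-- `g` is the weak gradient of `u` in `U`. -/
def IsWeakGradient {d : ℕ} (U : Set (Vec d)) (u : Vec d → ℝ) (g : Vec d → Vec d) : Prop :=
  ∀ (i : Fin d) (φ : Vec d → ℝ), IsTestFunction U φ →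
    ∫ x in U, u x * partialDeriv i φ x = -∫ x in U, g x i * φ x

/-- `u ∈ H^1(U)` with weak gradient `g`. -/
structure MemH1 {d : ℕ} (U : Set (Vec d)) (u : Vec d → ℝ) (g : Vec d → Vec d) : Prop where
  memLp : MemLp u 2 (volume.restrict U)
  memLp_grad : ∀ i, MemLp (fun x => g x i) 2 (volume.restrict U)
  weakGradient : IsWeakGradient U u g

/-- `u ∈ H_0^1(U)` with weak gradient `g`: a limit in `H^1(U)` of functions in
`C_c^∞(U)`. -/
structure MemH10 {d : ℕ} (U : Set (Vec d)) (u : Vec d → ℝ) (g : Vec d → Vec d) : Prop where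
  memH1 : MemH1 U u g
  approx : ∃ φ : ℕ → Vec d → ℝ, (∀ k, IsTestFunction U (φ k)) ∧
    Tendsto (fun k => eLpNorm (fun x => u x - φ k x) 2 (volume.restrict U)) atTop (𝓝 0) ∧
    ∀ i, Tendsto (fun k => eLpNorm (fun x => g x i - partialDeriv i (φ k) x) 2
      (volume.restrict U)) atTop (𝓝 0)

/-! ### Coarse-grained and homogenized coefficients -/

/-- `μ(U, p)`: the infimum over `w ∈ H_0^1(U)` of the average over `U` of
`(1/2) (p + ∇w) · a (p + ∇w)`. -/
def mu {d : ℕ} (a : CoeffField d) (U : Set (Vec d)) (p : Vec d) : ℝ :=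
  ⨅ w : {w : (Vec d → ℝ) × (Vec d → Vec d) // MemH10 U w.1 w.2},
    ⨍ x in U, (1 / 2 : ℝ) * ((p + w.1.2 x) ⬝ᵥ (a.toFun x *ᵥ (p + w.1.2 x)))

/-- The symmetric matrix `A` represents the quadratic form `m`, i.e. `m(p) = (1/2) p · A p`. -/
def Represents {d : ℕ} (A : Mat d) (m : Vec d → ℝ) : Prop :=
  A.IsSymm ∧ ∀ p, m p = (1 / 2 : ℝ) * (p ⬝ᵥ (A *ᵥ p))

/-- The symmetric matrix which represents a given quadratic form, by polarization. -/
def polarMatrix {d : ℕ} (m : Vec d → ℝ) : Mat d :=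
  Matrix.of fun i j => m (Pi.single i 1 + Pi.single j 1) - m (Pi.single i 1) - m (Pi.single j 1)

/-- `polarMatrix m` is the only matrix that can represent `m`. -/
theorem Represents.eq_polarMatrix {d : ℕ} {A : Mat d} {m : Vec d → ℝ} (h : Represents A m) :
    A = polarMatrix m := by
  obtain ⟨hs, hm⟩ := h
  ext i j
  have hij : A j i = A i j := hs.apply i j
  simp only [polarMatrix, Matrix.of_apply, hm, Matrix.mulVec_add, add_dotProduct, dotProduct_add,
    Matrix.mulVec_single_one, single_one_dotProduct, Matrix.col_apply, hij]
  ring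

/-- The coarse-grained matrix `a(U)`: the symmetric matrix with `μ(U, p) = (1/2) p · a(U) p`. -/
def coarseMatrix {d : ℕ} (a : CoeffField d) (U : Set (Vec d)) : Mat d :=
  polarMatrix (mu a U)

/-- `inf_m E[μ(□_m, p)]`, which is also the limit as `m → ∞` since the sequence is
nonincreasing. -/
def homogenizedMu {d : ℕ} (P : Measure (CoeffField d)) (p : Vec d) : ℝ :=
  ⨅ m : ℕ, ∫ a, mu a (cube d m) p ∂P

/-- The homogenized matrix `ā`: the symmetric matrix such that `(1/2) p · ā p` is the limit of
`E[μ(□_m, p)]`. -/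
def homogenizedMatrix {d : ℕ} (P : Measure (CoeffField d)) : Mat d :=
  polarMatrix (homogenizedMu P)

end UnboundedHomogenization

end

open UnboundedHomogenization

open MeasureTheory ProbabilityTheory Filter Topology
open scoped Matrix ContDiff

namespace UnboundedHomogenization

variable {d : ℕ}

/-! ### Quadratic forms of matrices -/

/-! Let `D_n = a(□_n)` be the matrix of the Dirichlet problem in `□_n` and `N_n` that of the Neumann
problem, in which the flux `q` is prescribed instead of the slope `p`. Both are subadditive over
subdivisions into subcubes, so by stationarity the quadratic forms of their expectations decrease in
`n`. The response `J(U,p,q) = ½ p·Dp + ½ q·Nq - p·q` is half the mean energy of the difference `w`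
between the Neumann field for `q` and the Dirichlet field for `p`. It is therefore nonnegative, and
its defect of additivity controls the distance in energy between `w` on a cube and the corresponding
fields on the subcubes. Two numbers are followed across scales: `T_n = tr E[D_n] + tr E[N_n]`
(`traceSum`) and the total variance `V_n` of the entries of `D_n` (`varD`).

The deterministic core is a div-curl argument (`pairing_cutoff_responseField_le`,
`exists_response_le`). The field `w` is a limit of gradients `∇u` and its flux is divergence free.
Testing with `η(u - mean u)`, for a cutoff `η`, expresses the energy of `w` near the centre through
`∫ (u - mean u)∇η · a w`. The field `(u - mean u)∇η` varies on the scale of the large cube, so on a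
subcube of side `3^m` it is nearly constant, and what remains is the average flux of `w` there. Up
to the defect of additivity this average is `q - Dp`, with `D` the Dirichlet matrix of the subcube.
For `q = E[D_m]p` it is a fluctuation with second moment at most `V_m |p|²`. In expectation, with `Θ
= M_n/δ_n`, this gives `E J_n ≤ CΘ(E J_m - E J_n) + CΘ V_m |p|² + C e^{-n}`, where `C` also depends
on `|p|` and `|q|` (`exists_meanResponse_le`). Since `E J_N ≥ 0` for `N ≥ n`, smallness of `E J_n`
bounds `T_n - T_N`, which yields a recursion for `T` (`exists_traceSum_sub_le`).

The ellipticity enters these estimates only on the event `{λ(□_n) > δ_n, Λ(□_n) < M_n}`. The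
complement contributes a multiple of `e^{-n}` by the tail hypothesis (`IsSuppressive.integral_le`).

The recursion for the variance (`varD_le`) writes `D_{m+k}` as the average of the Dirichlet matrices
of the subcubes minus a nonnegative matrix `Δ`. The mixing condition makes the variance of the
average small by a factor `3^{-dk}`. The entries of `Δ` are bounded by its trace, so their variance
costs at most `dM_n E[tr Δ]` plus a tail, and `E[tr Δ]` is a drop of `tr E[D]`.

A weighted sum of `T_n - T_N` and `V_n` thus contracts by `1 - c/Θ²` whenever the scale increases by
`l ≈ CΘ` levels (`recursion_step`). About `n/Θ` such steps fit between `n/2` and `n`, which gives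
`exp(-c n/Θ³)`; the bound `Θ ≤ (n+1)^α` turns this into the stated rate (`exists_recursion_decay`).
Finally `E|ā - D_n|²` is at most `V_n` plus the squared entries of `ā - E[D_n]`, and each of those
entries is at most the limit of `T_n - T_N` as `N → ∞`. -/

theorem quad_symm {A : Mat d} (hA : A.IsSymm) (x y : Vec d) : x ⬝ᵥ (A *ᵥ y) = y ⬝ᵥ (A *ᵥ x) := by
  rw [Matrix.dotProduct_mulVec, ← Matrix.mulVec_transpose, hA.eq, dotProduct_comm]

theorem sq_le_mul_of_quadratic_nonneg {a b c : ℝ} (h : ∀ t : ℝ, 0 ≤ a + 2 * t * b + t ^ 2 * c) :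
    b ^ 2 ≤ a * c := by
  have := discrim_le_zero (a := c) (b := 2 * b) (c := a) (fun t => by linarith [h t])
  unfold discrim at this
  linarith

theorem quad_cauchy_schwarz {A : Mat d} (hs : A.IsSymm) (hA : ∀ x, 0 ≤ x ⬝ᵥ (A *ᵥ x))
    (x y : Vec d) :
    (x ⬝ᵥ (A *ᵥ y)) ^ 2 ≤ (x ⬝ᵥ (A *ᵥ x)) * (y ⬝ᵥ (A *ᵥ y)) := by
  refine sq_le_mul_of_quadratic_nonneg fun t => ?_
  have h := hA (x + t • y)
  have hxy := quad_symm hs y x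
  simp only [Matrix.mulVec_add, Matrix.mulVec_smul, add_dotProduct, dotProduct_add,
    smul_dotProduct, dotProduct_smul, smul_eq_mul] at h
  rw [hxy] at h
  linarith

theorem dot_self_nonneg (x : Vec d) : 0 ≤ x ⬝ᵥ x :=
  Finset.sum_nonneg fun i _ => mul_self_nonneg (x i)

theorem dot_self_pos {x : Vec d} (hx : x ≠ 0) : 0 < x ⬝ᵥ x :=
  lt_of_le_of_ne (dot_self_nonneg x) fun h => hx (dotProduct_self_eq_zero.mp h.symm)

/-- Cauchy–Schwarz for the form `A`, applied to `Ax` and `x`, gives `|Ax|⁴ ≤ (Ax · A(Ax)) (x · Ax)`,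
and one factor `|Ax|²` cancels. Fluxes are thereby bounded by the energy at the price of a single
factor `Λ`. -/
theorem mulVec_dot_self_le {A : Mat d} (hs : A.IsSymm) (hA : ∀ x, 0 ≤ x ⬝ᵥ (A *ᵥ x)) {K : ℝ}
    (hK : ∀ x, x ⬝ᵥ (A *ᵥ x) ≤ K * (x ⬝ᵥ x)) (x : Vec d) :
    (A *ᵥ x) ⬝ᵥ (A *ᵥ x) ≤ K * (x ⬝ᵥ (A *ᵥ x)) := by
  have h1 := quad_cauchy_schwarz hs hA (A *ᵥ x) x
  rcases eq_or_ne (A *ᵥ x) 0 with h0 | h0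
  · simp [h0]
  have hpos := dot_self_pos h0
  have h2 := hK (A *ᵥ x)
  have h3 := hA x
  have : ((A *ᵥ x) ⬝ᵥ (A *ᵥ x)) * ((A *ᵥ x) ⬝ᵥ (A *ᵥ x)) ≤
      (K * (x ⬝ᵥ (A *ᵥ x))) * ((A *ᵥ x) ⬝ᵥ (A *ᵥ x)) := by nlinarith
  exact le_of_mul_le_mul_right this hpos

theorem CoeffField.isSymm (a : CoeffField d) (x : Vec d) : (a.toFun x).IsSymm := by
  have h := (a.posDef x).isHermitian
  rwa [Matrix.IsHermitian, Matrix.conjTranspose_eq_transpose_of_trivial] at h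

theorem CoeffField.quad_nonneg (a : CoeffField d) (x ξ : Vec d) : 0 ≤ ξ ⬝ᵥ (a.toFun x *ᵥ ξ) := by
  simpa using (a.posDef x).posSemidef.dotProduct_mulVec_nonneg ξ

theorem dot_sq_le (x y : Vec d) : (x ⬝ᵥ y) ^ 2 ≤ (x ⬝ᵥ x) * (y ⬝ᵥ y) := by
  have := quad_cauchy_schwarz (A := (1 : Mat d)) Matrix.isSymm_one
    (fun x => by simpa using dot_self_nonneg x) x y
  simpa using this

theorem norm_toLp_sq (x : Vec d) : ‖WithLp.toLp 2 x‖ ^ 2 = x ⬝ᵥ x := by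
  rw [EuclideanSpace.real_norm_sq_eq]
  simp [dotProduct, sq]

theorem quad_le_opNorm (A : Mat d) (x : Vec d) : |x ⬝ᵥ (A *ᵥ x)| ≤ opNorm A * (x ⬝ᵥ x) := by
  have h := (Matrix.toEuclideanCLM (𝕜 := ℝ) (n := Fin d) A).le_opNorm (WithLp.toLp 2 x)
  have h1 : ‖WithLp.toLp 2 (A *ᵥ x)‖ ≤ opNorm A * ‖WithLp.toLp 2 x‖ := by
    simpa [opNorm] using h
  have h2 := dot_sq_le x (A *ᵥ x)
  rw [← norm_toLp_sq x, ← norm_toLp_sq (A *ᵥ x), ← mul_pow] at h2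
  have h3 := abs_le_of_sq_le_sq' h2 (by positivity)
  rw [abs_le, ← norm_toLp_sq x]
  have := norm_nonneg (WithLp.toLp 2 x)
  constructor <;> nlinarith

theorem opNorm_nonneg (A : Mat d) : 0 ≤ opNorm A := norm_nonneg _

theorem abs_entry_le_opNorm (A : Mat d) (i j : Fin d) : |A i j| ≤ opNorm A := by
  have h := (Matrix.toEuclideanCLM (𝕜 := ℝ) (n := Fin d) A).le_opNorm
    (WithLp.toLp 2 (Pi.single j 1))
  have h1 : ‖WithLp.toLp 2 (A *ᵥ Pi.single j 1)‖ ≤ opNorm A := by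
    have h2 : ‖WithLp.toLp 2 (Pi.single j 1 : Vec d)‖ = 1 := by simp
    rw [h2, mul_one, Matrix.toEuclideanCLM_toLp] at h
    exact h
  refine le_trans ?_ h1
  have := PiLp.norm_apply_le (WithLp.toLp 2 (A *ᵥ Pi.single j 1) : EuclideanSpace ℝ (Fin d)) i
  simpa using this

theorem opNorm_sq_le (A : Mat d) : opNorm A ^ 2 ≤ ∑ i, ∑ j, A i j ^ 2 := by
  have h0 : 0 ≤ ∑ i, ∑ j, A i j ^ 2 :=
    Finset.sum_nonneg fun i _ => Finset.sum_nonneg fun j _ => sq_nonneg _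
  have h : opNorm A ≤ Real.sqrt (∑ i, ∑ j, A i j ^ 2) := by
    refine ContinuousLinearMap.opNorm_le_bound _ (Real.sqrt_nonneg _) fun x => ?_
    refine abs_le_of_sq_le_sq' ?_ (by positivity) |>.2
    rw [mul_pow, Real.sq_sqrt h0, EuclideanSpace.real_norm_sq_eq, EuclideanSpace.real_norm_sq_eq,
      Finset.sum_mul]
    refine Finset.sum_le_sum fun i _ => ?_
    have := Finset.sum_mul_sq_le_sq_mul_sq Finset.univ (fun j => A i j) (fun j => x j)
    simpa [Matrix.mulVec, dotProduct] using this
  calc opNorm A ^ 2 ≤ Real.sqrt (∑ i, ∑ j, A i j ^ 2) ^ 2 := by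
        gcongr; exact opNorm_nonneg A
    _ = _ := Real.sq_sqrt h0

theorem CoeffField.exists_entry_bound (a : CoeffField d) {U : Set (Vec d)}
    (hU : Bornology.IsBounded U) : ∃ K : ℝ, 0 < K ∧ ∀ x ∈ U, ∀ i j, |a.toFun x i j| ≤ K := by
  obtain ⟨K, hK⟩ := a.locallyBounded U hU
  exact ⟨max K 1, by positivity, fun x hx i j =>
    (abs_entry_le_opNorm _ i j).trans ((hK x hx).1.trans (le_max_left _ _))⟩

theorem CoeffField.exists_quad_bounds (a : CoeffField d) {U : Set (Vec d)}
    (hU : Bornology.IsBounded U) : ∃ K : ℝ, 0 < K ∧ ∀ x ∈ U, ∀ ξ : Vec d,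
      ξ ⬝ᵥ (a.toFun x *ᵥ ξ) ≤ K * (ξ ⬝ᵥ ξ) ∧ ξ ⬝ᵥ ξ ≤ K * (ξ ⬝ᵥ (a.toFun x *ᵥ ξ)) := by
  obtain ⟨K, hK⟩ := a.locallyBounded U hU
  refine ⟨max K 1, by positivity, fun x hx ξ => ⟨?_, ?_⟩⟩
  · refine (le_abs_self _).trans ((quad_le_opNorm _ ξ).trans ?_)
    exact mul_le_mul_of_nonneg_right ((hK x hx).1.trans (le_max_left _ _)) (dot_self_nonneg ξ)
  · set A := a.toFun x
    set η := A⁻¹ *ᵥ ξ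
    have hη : A *ᵥ η = ξ := by
      rw [Matrix.mulVec_mulVec, Matrix.mul_nonsing_inv _ ((a.posDef x).isUnit.map Matrix.detMonoidHom),
        Matrix.one_mulVec]
    -- With `η = A⁻¹ξ` this reads `|ξ|⁴ ≤ (ξ·Aξ)(ξ·A⁻¹ξ)`, so the upper bound on `A⁻¹` becomes a
    -- lower bound on `A`.
    have h1 := quad_cauchy_schwarz (a.isSymm x) (a.quad_nonneg x) ξ η
    change (ξ ⬝ᵥ (A *ᵥ η)) ^ 2 ≤ (ξ ⬝ᵥ (A *ᵥ ξ)) * (η ⬝ᵥ (A *ᵥ η)) at h1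
    rw [hη] at h1
    have h2 : η ⬝ᵥ ξ ≤ max K 1 * (ξ ⬝ᵥ ξ) := by
      rw [dotProduct_comm]
      refine (le_abs_self _).trans ((quad_le_opNorm _ ξ).trans ?_)
      exact mul_le_mul_of_nonneg_right ((hK x hx).2.trans (le_max_left _ _)) (dot_self_nonneg ξ)
    rcases eq_or_ne ξ 0 with h0 | h0
    · simp [h0]
    have hp := dot_self_pos h0
    have h3 : 0 ≤ ξ ⬝ᵥ (A *ᵥ ξ) := a.quad_nonneg x ξ
    refine le_of_mul_le_mul_right (?_ : _ ≤ _ * (ξ ⬝ᵥ ξ)) hp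
    nlinarith

/-! ### Square-integrable vector fields -/

/-- Square-integrable vector fields on `U`. -/
def MemL2 (U : Set (Vec d)) (f : Vec d → Vec d) : Prop :=
  ∀ i, MemLp (fun x => f x i) 2 (volume.restrict U)

/-- Convergence of vector fields in `L^2(U)`. -/
def TendstoL2 (U : Set (Vec d)) (F : ℕ → Vec d → Vec d) (f : Vec d → Vec d) : Prop :=
  ∀ i, Tendsto (fun k => eLpNorm (fun x => f x i - F k x i) 2 (volume.restrict U)) atTop (𝓝 0)

/-- The `L^2(U)` inner product of vector fields. -/
noncomputable def pairing (U : Set (Vec d)) (f g : Vec d → Vec d) : ℝ := ∫ x in U, f x ⬝ᵥ g x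

/-- The flux `a g` of the field `g`. -/
def CoeffField.flux (a : CoeffField d) (g : Vec d → Vec d) : Vec d → Vec d :=
  fun x => a.toFun x *ᵥ g x

/-- The bilinear form `∫_U f · a g`. -/
noncomputable def energy (a : CoeffField d) (U : Set (Vec d)) (f g : Vec d → Vec d) : ℝ :=
  pairing U f (a.flux g)

variable {U V : Set (Vec d)} {f g h : Vec d → Vec d}

theorem MemL2.add (hf : MemL2 U f) (hg : MemL2 U g) : MemL2 U (f + g) :=
  fun i => (hf i).add (hg i)

theorem MemL2.sub (hf : MemL2 U f) (hg : MemL2 U g) : MemL2 U (f - g) :=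
  fun i => (hf i).sub (hg i)

theorem MemL2.smul (c : ℝ) (hf : MemL2 U f) : MemL2 U (c • f) :=
  fun i => (hf i).const_mul c

theorem MemL2.mono (h : V ⊆ U) (hf : MemL2 U f) : MemL2 V f :=
  fun i => (hf i).mono_measure (Measure.restrict_mono h le_rfl)

theorem isFiniteMeasure_restrict_of_isBounded (hU : Bornology.IsBounded U) :
    IsFiniteMeasure (volume.restrict U) :=
  ⟨by simpa using hU.measure_lt_top⟩

theorem memL2_const (hU : Bornology.IsBounded U) (p : Vec d) : MemL2 U (fun _ => p) := by
  have := isFiniteMeasure_restrict_of_isBounded hU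
  exact fun i => memLp_const _

theorem MemL2.integrable_dot (hf : MemL2 U f) (hg : MemL2 U g) :
    Integrable (fun x => f x ⬝ᵥ g x) (volume.restrict U) :=
  integrable_finsetSum (f := fun i x => f x i * g x i) Finset.univ
    fun i _ => (hf i).integrable_mul (hg i)

theorem MemL2.flux (a : CoeffField d) (hU : Bornology.IsBounded U) (hUm : MeasurableSet U)
    (hf : MemL2 U f) : MemL2 U (a.flux f) := by
  obtain ⟨K, hK0, hK⟩ := a.exists_entry_bound hU
  intro i
  refine memLp_finsetSum (f := fun j x => a.toFun x i j * f x j) Finset.univ fun j _ => ?_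
  refine MemLp.of_le_mul (c := K) (hf j)
    ((a.measurable_entry i j).aestronglyMeasurable.mul (hf j).1) ?_
  filter_upwards [ae_restrict_mem hUm] with x hx
  rw [norm_mul]
  exact mul_le_mul_of_nonneg_right (by simpa using hK x hx i j) (norm_nonneg _)

theorem pairing_comm (f g : Vec d → Vec d) : pairing U f g = pairing U g f := by
  simp only [pairing, dotProduct_comm]

theorem pairing_add_left (hf : MemL2 U f) (hg : MemL2 U g) (hh : MemL2 U h) :
    pairing U (f + g) h = pairing U f h + pairing U g h := by
  simp only [pairing, Pi.add_apply, add_dotProduct]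
  exact integral_add (hf.integrable_dot hh) (hg.integrable_dot hh)

theorem pairing_sub_left (hf : MemL2 U f) (hg : MemL2 U g) (hh : MemL2 U h) :
    pairing U (f - g) h = pairing U f h - pairing U g h := by
  simp only [pairing, Pi.sub_apply, sub_dotProduct]
  exact integral_sub (hf.integrable_dot hh) (hg.integrable_dot hh)

theorem pairing_smul_left (c : ℝ) (f g : Vec d → Vec d) :
    pairing U (c • f) g = c * pairing U f g := by
  simp only [pairing, Pi.smul_apply, smul_dotProduct, smul_eq_mul]
  exact integral_const_mul _ _

theorem CoeffField.flux_sub (a : CoeffField d) (f g : Vec d → Vec d) :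
    a.flux (f - g) = a.flux f - a.flux g := by
  ext x i; simp [CoeffField.flux, Matrix.mulVec_sub]

theorem energy_comm (a : CoeffField d) (f g : Vec d → Vec d) : energy a U f g = energy a U g f := by
  simp only [energy, pairing, CoeffField.flux, quad_symm (a.isSymm _) (f _)]

theorem energy_self_nonneg (a : CoeffField d) (f : Vec d → Vec d) : 0 ≤ energy a U f f :=
  integral_nonneg fun x => a.quad_nonneg x (f x)

section Bilinear
variable (a : CoeffField d) (hU : Bornology.IsBounded U) (hUm : MeasurableSet U)

theorem energy_smul_left (c : ℝ) (f g : Vec d → Vec d) :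
    energy a U (c • f) g = c * energy a U f g := pairing_smul_left c f _

theorem energy_smul_right (c : ℝ) (f g : Vec d → Vec d) :
    energy a U f (c • g) = c * energy a U f g := by
  rw [energy_comm, energy_smul_left, energy_comm]

include hU hUm

theorem energy_add_left (hf : MemL2 U f) (hg : MemL2 U g) (hh : MemL2 U h) :
    energy a U (f + g) h = energy a U f h + energy a U g h :=
  pairing_add_left hf hg (hh.flux a hU hUm)

theorem energy_add_right (hf : MemL2 U f) (hg : MemL2 U g) (hh : MemL2 U h) :
    energy a U h (f + g) = energy a U h f + energy a U h g := by
  rw [energy_comm, energy_add_left a hU hUm hf hg hh, energy_comm a f, energy_comm a g]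

theorem energy_sub_left (hf : MemL2 U f) (hg : MemL2 U g) (hh : MemL2 U h) :
    energy a U (f - g) h = energy a U f h - energy a U g h :=
  pairing_sub_left hf hg (hh.flux a hU hUm)

theorem energy_sub_right (hf : MemL2 U f) (hg : MemL2 U g) (hh : MemL2 U h) :
    energy a U h (f - g) = energy a U h f - energy a U h g := by
  rw [energy_comm, energy_sub_left a hU hUm hf hg hh, energy_comm a f, energy_comm a g]

theorem energy_add_self (hf : MemL2 U f) (hg : MemL2 U g) :
    energy a U (f + g) (f + g) = energy a U f f + 2 * energy a U f g + energy a U g g := by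
  rw [energy_add_left a hU hUm hf hg (hf.add hg), energy_add_right a hU hUm hf hg hf,
    energy_add_right a hU hUm hf hg hg, energy_comm a g f]
  ring

theorem energy_sub_self (hf : MemL2 U f) (hg : MemL2 U g) :
    energy a U (f - g) (f - g) = energy a U f f - 2 * energy a U f g + energy a U g g := by
  rw [energy_sub_left a hU hUm hf hg (hf.sub hg), energy_sub_right a hU hUm hf hg hf,
    energy_sub_right a hU hUm hf hg hg, energy_comm a g f]
  ring

end Bilinear

theorem pairing_sq_le (hf : MemL2 U f) (hg : MemL2 U g) :
    pairing U f g ^ 2 ≤ pairing U f f * pairing U g g := by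
  refine sq_le_mul_of_quadratic_nonneg fun t => ?_
  have h0 : 0 ≤ pairing U (f + t • g) (f + t • g) := integral_nonneg fun x => dot_self_nonneg _
  rw [pairing_add_left hf (hg.smul t) (hf.add (hg.smul t)), pairing_comm f, pairing_smul_left,
    pairing_comm g, pairing_add_left hf (hg.smul t) hf, pairing_add_left hf (hg.smul t) hg,
    pairing_smul_left, pairing_smul_left, pairing_comm g f] at h0
  linarith

/-! ### Convergence -/

theorem tendsto_integral_mul_of_tendsto_eLpNorm {Ω : Type*} [MeasurableSpace Ω] {μ : Measure Ω}
    {F G : ℕ → Ω → ℝ} {f g : Ω → ℝ} (hF : ∀ k, MemLp (F k) 2 μ) (hf : MemLp f 2 μ)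
    (hG : ∀ k, MemLp (G k) 2 μ) (hg : MemLp g 2 μ)
    (hFf : Tendsto (fun k => eLpNorm (fun x => f x - F k x) 2 μ) atTop (𝓝 0))
    (hGg : Tendsto (fun k => eLpNorm (fun x => g x - G k x) 2 μ) atTop (𝓝 0)) :
    Tendsto (fun k => ∫ x, F k x * G k x ∂μ) atTop (𝓝 (∫ x, f x * g x ∂μ)) := by
  have key : ∀ {u v : Ω → ℝ} (hu : MemLp u 2 μ) (hv : MemLp v 2 μ),
      ∫ x, u x * v x ∂μ = inner ℝ (hu.toLp u) (hv.toLp v) := by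
    intro u v hu hv
    rw [L2.inner_def]
    refine integral_congr_ae ?_
    filter_upwards [hu.coeFn_toLp, hv.coeFn_toLp] with x h1 h2
    simp [h1, h2, mul_comm]
  have conv : ∀ {H : ℕ → Ω → ℝ} {h : Ω → ℝ} (hH : ∀ k, MemLp (H k) 2 μ) (hh : MemLp h 2 μ),
      Tendsto (fun k => eLpNorm (fun x => h x - H k x) 2 μ) atTop (𝓝 0) →
      Tendsto (fun k => (hH k).toLp (H k)) atTop (𝓝 (hh.toLp h)) := by
    intro H h hH hh hlim
    rw [Lp.tendsto_Lp_iff_tendsto_eLpNorm'']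
    refine hlim.congr fun k => ?_
    rw [← eLpNorm_neg]
    congr 1
    ext x
    simp
  simp_rw [key (hF _) (hG _), key hf hg]
  exact (conv hF hf hFf).inner (conv hG hg hGg)

theorem TendstoL2.pairing {F G : ℕ → Vec d → Vec d} (hF : ∀ k, MemL2 U (F k)) (hf : MemL2 U f)
    (hG : ∀ k, MemL2 U (G k)) (hg : MemL2 U g) (hFf : TendstoL2 U F f) (hGg : TendstoL2 U G g) :
    Tendsto (fun k => pairing U (F k) (G k)) atTop (𝓝 (pairing U f g)) := by
  have key : ∀ {u v : Vec d → Vec d}, MemL2 U u → MemL2 U v →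
      UnboundedHomogenization.pairing U u v = ∑ i, ∫ x in U, u x i * v x i := fun hu hv =>
    integral_finsetSum _ fun i _ => (hu i).integrable_mul (hv i)
  simp_rw [key (hF _) (hG _), key hf hg]
  exact tendsto_finsetSum _ fun i _ => tendsto_integral_mul_of_tendsto_eLpNorm
    (fun k => hF k i) (hf i) (fun k => hG k i) (hg i) (hFf i) (hGg i)

theorem tendstoL2_const (f : Vec d → Vec d) : TendstoL2 U (fun _ => f) f := by
  intro i
  simp

theorem TendstoL2.flux (a : CoeffField d) (hU : Bornology.IsBounded U) (hUm : MeasurableSet U)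
    {F : ℕ → Vec d → Vec d} (hF : ∀ k, MemL2 U (F k)) (hf : MemL2 U f) (hFf : TendstoL2 U F f) :
    TendstoL2 U (fun k => a.flux (F k)) (a.flux f) := by
  obtain ⟨K, hK0, hK⟩ := a.exists_entry_bound hU
  intro i
  have hbound : ∀ k, eLpNorm (fun x => a.flux f x i - a.flux (F k) x i) 2 (volume.restrict U) ≤
      ∑ j, ENNReal.ofReal K * eLpNorm (fun x => f x j - F k x j) 2 (volume.restrict U) := by
    intro k
    have h1 : (fun x => a.flux f x i - a.flux (F k) x i) =
        ∑ j, fun x => a.toFun x i j * (f x j - F k x j) := by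
      ext x
      simp [CoeffField.flux, Matrix.mulVec, dotProduct, Finset.sum_apply, mul_sub]
    rw [h1]
    refine (eLpNorm_sum_le (fun j _ => (a.measurable_entry i j).aestronglyMeasurable.mul
      ((hf j).sub (hF k j)).1) (by norm_num)).trans (Finset.sum_le_sum fun j _ => ?_)
    refine eLpNorm_le_mul_eLpNorm_of_ae_le_mul ?_ 2
    filter_upwards [ae_restrict_mem hUm] with x hx
    change ‖a.toFun x i j * (f x j - F k x j)‖ ≤ _
    rw [norm_mul]
    exact mul_le_mul_of_nonneg_right (by simpa using hK x hx i j) (norm_nonneg _)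
  refine tendsto_of_tendsto_of_tendsto_of_le_of_le tendsto_const_nhds ?_ (fun _ => zero_le) hbound
  have : Tendsto (fun k => ∑ j, ENNReal.ofReal K *
      eLpNorm (fun x => f x j - F k x j) 2 (volume.restrict U)) atTop
      (𝓝 (∑ _j : Fin d, ENNReal.ofReal K * 0)) :=
    tendsto_finsetSum _ fun j _ => ENNReal.Tendsto.const_mul (hFf j) (Or.inr ENNReal.ofReal_ne_top)
  simpa using this

theorem TendstoL2.add {F G : ℕ → Vec d → Vec d} (hF : ∀ k, MemL2 U (F k)) (hf : MemL2 U f)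
    (hG : ∀ k, MemL2 U (G k)) (hg : MemL2 U g) (hFf : TendstoL2 U F f) (hGg : TendstoL2 U G g) :
    TendstoL2 U (fun k => F k + G k) (f + g) := by
  intro i
  refine tendsto_of_tendsto_of_tendsto_of_le_of_le tendsto_const_nhds
    (by simpa using (hFf i).add (hGg i)) (fun _ => zero_le) fun k => ?_
  have h1 : (fun x => (f + g) x i - (F k + G k) x i) =
      (fun x => f x i - F k x i) + fun x => g x i - G k x i := by
    ext x; simp; ring
  rw [h1]
  exact eLpNorm_add_le ((hf i).sub (hF k i)).1 ((hg i).sub (hG k i)).1 (by norm_num)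

theorem TendstoL2.smul (c : ℝ) {F : ℕ → Vec d → Vec d} (hFf : TendstoL2 U F f) :
    TendstoL2 U (fun k => c • F k) (c • f) := by
  intro i
  have h1 : ∀ k, (fun x => (c • f) x i - (c • F k) x i) = c • fun x => f x i - F k x i := by
    intro k; ext x; simp [mul_sub]
  simp_rw [h1, eLpNorm_const_smul]
  simpa using ENNReal.Tendsto.const_mul (hFf i) (Or.inr (by simp))

theorem TendstoL2.mono (h : V ⊆ U) {F : ℕ → Vec d → Vec d} (hFf : TendstoL2 U F f) :
    TendstoL2 V F f := fun i =>
  tendsto_of_tendsto_of_tendsto_of_le_of_le tendsto_const_nhds (hFf i) (fun _ => zero_le)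
    fun _ => eLpNorm_mono_measure _ (Measure.restrict_mono h le_rfl)

/-! ### Test functions -/

/-- The gradient of a function. -/
noncomputable def grad (φ : Vec d → ℝ) : Vec d → Vec d := fun x i => partialDeriv i φ x

variable {U V W : Set (Vec d)} {φ ψ : Vec d → ℝ}

theorem IsTestFunction.mono (h : U ⊆ V) (hφ : IsTestFunction U φ) : IsTestFunction V φ :=
  ⟨hφ.1, hφ.2.1, hφ.2.2.trans h⟩

theorem IsTestFunction.add (hφ : IsTestFunction U φ) (hψ : IsTestFunction U ψ) :
    IsTestFunction U (φ + ψ) :=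
  ⟨hφ.1.add hψ.1, hφ.2.1.add hψ.2.1, (tsupport_add φ ψ).trans (Set.union_subset hφ.2.2 hψ.2.2)⟩

theorem IsTestFunction.mul_right (hφ : IsTestFunction U φ) (hψ : ContDiff ℝ ∞ ψ) :
    IsTestFunction U (φ * ψ) :=
  ⟨hφ.1.mul hψ, hφ.2.1.mul_right, tsupport_mul_subset_left.trans hφ.2.2⟩

theorem IsTestFunction.smul (c : ℝ) (hφ : IsTestFunction U φ) : IsTestFunction U (c • φ) := by
  have h := hφ.mul_right (ψ := fun _ => c) contDiff_const
  have : φ * (fun _ => c) = c • φ := by ext x; simp [mul_comm]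
  rwa [this] at h

theorem isTestFunction_zero : IsTestFunction U (0 : Vec d → ℝ) :=
  ⟨contDiff_const, HasCompactSupport.zero, by simp [tsupport]⟩

theorem grad_add (hφ : Differentiable ℝ φ) (hψ : Differentiable ℝ ψ) :
    grad (φ + ψ) = grad φ + grad ψ := by
  ext x i
  simp [grad, partialDeriv, fderiv_add (hφ x) (hψ x)]

theorem grad_smul (c : ℝ) (hφ : Differentiable ℝ φ) : grad (c • φ) = c • grad φ := by
  ext x i
  simp [grad, partialDeriv, fderiv_const_smul (hφ x)]

theorem partialDeriv_mul (hφ : Differentiable ℝ φ) (hψ : Differentiable ℝ ψ) (i : Fin d)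
    (x : Vec d) :
    partialDeriv i (φ * ψ) x = φ x * partialDeriv i ψ x + ψ x * partialDeriv i φ x := by
  simp [partialDeriv, fderiv_mul (hφ x) (hψ x)]

theorem contDiff_partialDeriv (hφ : ContDiff ℝ ∞ φ) (i : Fin d) :
    ContDiff ℝ ∞ (partialDeriv i φ) := by
  have h : ContDiff ℝ ∞ (fderiv ℝ φ) := hφ.fderiv_right (by simp)
  exact h.clm_apply contDiff_const

theorem IsTestFunction.pderiv (hφ : IsTestFunction U φ) (i : Fin d) :
    IsTestFunction U (partialDeriv i φ) := by
  refine ⟨contDiff_partialDeriv hφ.1 i, hφ.2.1.fderiv_apply (𝕜 := ℝ) _, ?_⟩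
  exact (tsupport_fderiv_apply_subset ℝ _).trans hφ.2.2

theorem IsTestFunction.differentiable (hφ : IsTestFunction U φ) : Differentiable ℝ φ :=
  hφ.1.differentiable (by simp)

theorem IsTestFunction.eq_zero_of_notMem (hφ : IsTestFunction U φ) {x : Vec d} (hx : x ∉ U) :
    φ x = 0 := image_eq_zero_of_notMem_tsupport fun h => hx (hφ.2.2 h)

theorem IsTestFunction.memLp (hφ : IsTestFunction U φ) (p : ENNReal) (μ : Measure (Vec d))
    [IsFiniteMeasureOnCompacts μ] : MemLp φ p μ :=
  hφ.1.continuous.memLp_of_hasCompactSupport hφ.2.1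

theorem IsTestFunction.memL2_grad (hφ : IsTestFunction U φ) : MemL2 V (grad φ) := fun i =>
  ((hφ.pderiv i).memLp 2 volume).mono_measure Measure.restrict_le_self

theorem IsTestFunction.setIntegral_mul (hφ : IsTestFunction U φ) (u : Vec d → ℝ) :
    ∫ x in U, φ x * u x = ∫ x, φ x * u x :=
  setIntegral_eq_integral_of_forall_compl_eq_zero fun x hx => by
    simp [hφ.eq_zero_of_notMem hx]

theorem integral_mul_partialDeriv (hφ : IsTestFunction U φ) (hψ : IsTestFunction V ψ)
    (i : Fin d) :
    ∫ x, φ x * partialDeriv i ψ x = -∫ x, partialDeriv i φ x * ψ x := by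
  refine integral_mul_fderiv_eq_neg_fderiv_mul_of_integrable ?_ ?_ ?_
    (fun x _ => hφ.differentiable x) (fun x _ => hψ.differentiable x)
  · exact ((hφ.pderiv i).memLp 2 volume).integrable_mul (hψ.memLp 2 volume)
  · exact (hφ.memLp 2 volume).integrable_mul ((hψ.pderiv i).memLp 2 volume)
  · exact (hφ.memLp 2 volume).integrable_mul (hψ.memLp 2 volume)

theorem integral_partialDeriv (hφ : IsTestFunction U φ) (i : Fin d) :
    ∫ x in U, partialDeriv i φ x = 0 := by
  have h1 := (hφ.pderiv i).setIntegral_mul (fun _ => 1)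
  have h0 : Integrable (partialDeriv i φ) :=
    memLp_one_iff_integrable.mp ((hφ.pderiv i).memLp 1 volume)
  have h2 : ∫ x, (fun _ => (1 : ℝ)) x * fderiv ℝ φ x (Pi.single i 1)
      = - ∫ x, fderiv ℝ (fun _ => (1 : ℝ)) x (Pi.single i 1) * φ x := by
    refine integral_mul_fderiv_eq_neg_fderiv_mul_of_integrable (by simp) ?_ ?_
      (fun x _ => by fun_prop) (fun x _ => hφ.differentiable x)
    · simp only [one_mul]
      exact h0
    · simpa using memLp_one_iff_integrable.mp (hφ.memLp 1 volume)
  simp only [mul_one] at h1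
  rw [h1]
  simpa [partialDeriv] using h2

theorem IsTestFunction.memH10 (hφ : IsTestFunction U φ) : MemH10 U φ (grad φ) where
  memH1 :=
    { memLp := (hφ.memLp 2 volume).mono_measure Measure.restrict_le_self
      memLp_grad := hφ.memL2_grad
      weakGradient := fun i ψ hψ => by
        rw [hφ.setIntegral_mul, show ∫ x in U, grad φ x i * ψ x = ∫ x, partialDeriv i φ x * ψ x from
          (hφ.pderiv i).setIntegral_mul ψ]
        exact integral_mul_partialDeriv hφ hψ i }
  approx := ⟨fun _ => φ, fun _ => hφ, by simp, fun i => by simp [grad]⟩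

/-! ### Limits of gradients -/

/-- `f` is the limit in `L^2(U)` of gradients of functions in `C_c^∞(W)`. -/
structure GradLim (U W : Set (Vec d)) (f : Vec d → Vec d) : Prop where
  memL2 : MemL2 U f
  approx : ∃ φ : ℕ → Vec d → ℝ, (∀ k, IsTestFunction W (φ k)) ∧ TendstoL2 U (fun k => grad (φ k)) f

variable {f g : Vec d → Vec d}

theorem IsTestFunction.gradLim (hφ : IsTestFunction W φ) : GradLim U W (grad φ) :=
  ⟨hφ.memL2_grad, fun _ => φ, fun _ => hφ, tendstoL2_const _⟩

theorem GradLim.add (hf : GradLim U W f) (hg : GradLim U W g) : GradLim U W (f + g) := by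
  obtain ⟨φ, hφ, hφf⟩ := hf.approx
  obtain ⟨ψ, hψ, hψg⟩ := hg.approx
  refine ⟨hf.memL2.add hg.memL2, fun k => φ k + ψ k, fun k => (hφ k).add (hψ k), ?_⟩
  simp_rw [grad_add (hφ _).differentiable (hψ _).differentiable]
  exact TendstoL2.add (fun k => (hφ k).memL2_grad) hf.memL2 (fun k => (hψ k).memL2_grad) hg.memL2
    hφf hψg

theorem GradLim.smul (c : ℝ) (hf : GradLim U W f) : GradLim U W (c • f) := by
  obtain ⟨φ, hφ, hφf⟩ := hf.approx
  refine ⟨hf.memL2.smul c, fun k => c • φ k, fun k => (hφ k).smul c, ?_⟩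
  simp_rw [grad_smul c (hφ _).differentiable]
  exact hφf.smul c

theorem GradLim.neg_add (hf : GradLim U W f) (hg : GradLim U W g) : GradLim U W (f - g) := by
  have := hf.add (hg.smul (-1))
  rwa [neg_one_smul, ← sub_eq_add_neg] at this

theorem gradLim_zero : GradLim U W (0 : Vec d → Vec d) := by
  have h := isTestFunction_zero (U := W).gradLim (U := U)
  have : grad (0 : Vec d → ℝ) = 0 := by ext x i; simp [grad, partialDeriv]
  rwa [this] at h

theorem GradLim.mono (hU : U ⊆ V) {W'} (hW : W ⊆ W') (hf : GradLim V W f) : GradLim U W' f := by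
  obtain ⟨φ, hφ, hφf⟩ := hf.approx
  exact ⟨hf.memL2.mono hU, φ, fun k => (hφ k).mono hW, hφf.mono hU⟩

theorem gradLim_sum {ι : Type*} (s : Finset ι) {f : ι → Vec d → Vec d}
    (h : ∀ j ∈ s, GradLim U W (f j)) : GradLim U W (∑ j ∈ s, f j) := by
  classical
  induction s using Finset.induction_on with
  | empty => simpa using gradLim_zero
  | insert j s hj ih =>
    rw [Finset.sum_insert hj]
    exact (h j (Finset.mem_insert_self _ _)).add
      (ih fun k hk => h k (Finset.mem_insert_of_mem hk))

/-- An identity `∫_U ∇φ · F = ∫_U ∇φ · G` for test functions extends to limits of gradients. -/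
theorem GradLim.pairing_eq {F G : Vec d → Vec d} (hF : MemL2 U F) (hG : MemL2 U G)
    (h : ∀ φ, IsTestFunction W φ → pairing U (grad φ) F = pairing U (grad φ) G)
    (hf : GradLim U W f) : pairing U f F = pairing U f G := by
  obtain ⟨φ, hφ, hφf⟩ := hf.approx
  have h1 := TendstoL2.pairing (fun k => (hφ k).memL2_grad) hf.memL2 (fun _ => hF) hF hφf
    (tendstoL2_const F)
  have h2 := TendstoL2.pairing (fun k => (hφ k).memL2_grad) hf.memL2 (fun _ => hG) hG hφf
    (tendstoL2_const G)
  simp_rw [fun k => h _ (hφ k)] at h1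
  exact tendsto_nhds_unique h1 h2

/-- Mean values of limits of gradients of functions in `C_c^∞(U)` vanish. -/
theorem GradLim.pairing_const (hU : Bornology.IsBounded U) (hf : GradLim U U f) (q : Vec d) :
    pairing U f (fun _ => q) = 0 := by
  rw [hf.pairing_eq (memL2_const hU q) (memL2_const hU 0) fun φ hφ => ?_]
  · simp [pairing]
  · simp only [pairing, dotProduct_zero, integral_zero]
    simp only [dotProduct, grad]
    rw [integral_finsetSum _ fun i _ =>
      (((hφ.pderiv i).memLp 1 volume).mono_measure Measure.restrict_le_self
        |> memLp_one_iff_integrable.mp).mul_const _]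
    refine Finset.sum_eq_zero fun i _ => ?_
    rw [integral_mul_const]
    rw [integral_partialDeriv hφ i, zero_mul]

/-! ### Solvability of the variational problems -/

section Hilbert
variable (U : Set (Vec d))

/-- The Hilbert space of square-integrable vector fields on `U`. -/
abbrev FieldSpace : Type := PiLp 2 fun _ : Fin d => Lp ℝ 2 (volume.restrict U)

variable {U}

/-- The class of a square-integrable vector field. -/
noncomputable def MemL2.cls {f : Vec d → Vec d} (hf : MemL2 U f) : FieldSpace U :=
  WithLp.toLp 2 fun i => (hf i).toLp fun x => f x i

/-- A representative of a class of vector fields. -/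
noncomputable def fieldRep (f : FieldSpace U) : Vec d → Vec d := fun x i => (f i : Vec d → ℝ) x

theorem memL2_fieldRep (f : FieldSpace U) : MemL2 U (fieldRep f) := fun i => Lp.memLp (f i)

theorem inner_fieldSpace (f g : FieldSpace U) :
    inner ℝ f g = pairing U (fieldRep f) (fieldRep g) := by
  have e : pairing U (fieldRep f) (fieldRep g) = ∑ i, ∫ x in U, fieldRep f x i * fieldRep g x i :=
    integral_finsetSum _ fun i _ => (memL2_fieldRep f i).integrable_mul (memL2_fieldRep g i)
  rw [PiLp.inner_apply, e]
  refine Finset.sum_congr rfl fun i _ => ?_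
  rw [L2.inner_def]
  refine integral_congr_ae (ae_of_all _ fun x => ?_)
  simp [fieldRep, mul_comm]

theorem MemL2.fieldRep_cls {f : Vec d → Vec d} (hf : MemL2 U f) :
    fieldRep hf.cls =ᵐ[volume.restrict U] f := by
  have : ∀ i, ∀ᵐ x ∂volume.restrict U, fieldRep hf.cls x i = f x i := fun i =>
    (hf i).coeFn_toLp
  filter_upwards [ae_all_iff.mpr this] with x hx
  exact funext hx

theorem pairing_congr_ae {f f' g g' : Vec d → Vec d} (hf : f =ᵐ[volume.restrict U] f')
    (hg : g =ᵐ[volume.restrict U] g') : pairing U f g = pairing U f' g' := by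
  refine integral_congr_ae ?_
  filter_upwards [hf, hg] with x h1 h2
  rw [h1, h2]

variable (U) in
/-- Multiplication by the coefficient field, as a linear map on the space of vector fields. -/
noncomputable def fluxLinear (a : CoeffField d) (hU : Bornology.IsBounded U)
    (hUm : MeasurableSet U) : FieldSpace U →ₗ[ℝ] FieldSpace U where
  toFun f := ((memL2_fieldRep f).flux a hU hUm).cls
  map_add' f g := by
    ext1 i
    refine Lp.ext ?_
    have h1 := ((memL2_fieldRep (f + g)).flux a hU hUm).fieldRep_cls
    have h2 := ((memL2_fieldRep f).flux a hU hUm).fieldRep_cls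
    have h3 := ((memL2_fieldRep g).flux a hU hUm).fieldRep_cls
    have h4 : ∀ j, ∀ᵐ x ∂volume.restrict U,
        fieldRep (f + g) x j = fieldRep f x j + fieldRep g x j := fun j => Lp.coeFn_add (f j) (g j)
    refine EventuallyEq.trans ?_ (Lp.coeFn_add _ _).symm
    filter_upwards [h1, h2, h3, ae_all_iff.mpr h4] with x h1 h2 h3 h4
    have h4' : fieldRep (f + g) x = fieldRep f x + fieldRep g x := funext h4
    have e1 := congrFun h1 i
    have e2 := congrFun h2 i
    have e3 := congrFun h3 i
    simp only [CoeffField.flux, h4', Matrix.mulVec_add, Pi.add_apply] at e1 e2 e3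
    exact e1.trans (congrArg₂ (· + ·) e2 e3).symm
  map_smul' c f := by
    ext1 i
    refine Lp.ext ?_
    have h1 := ((memL2_fieldRep (c • f)).flux a hU hUm).fieldRep_cls
    have h2 := ((memL2_fieldRep f).flux a hU hUm).fieldRep_cls
    have h4 : ∀ j, ∀ᵐ x ∂volume.restrict U, fieldRep (c • f) x j = c * fieldRep f x j :=
      fun j => Lp.coeFn_smul c (f j)
    refine EventuallyEq.trans ?_ (Lp.coeFn_smul _ _).symm
    filter_upwards [h1, h2, ae_all_iff.mpr h4] with x h1 h2 h4
    have h4' : fieldRep (c • f) x = c • fieldRep f x := funext h4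
    have e1 := congrFun h1 i
    have e2 := congrFun h2 i
    simp only [CoeffField.flux, h4', Matrix.mulVec_smul, Pi.smul_apply] at e1 e2
    exact e1.trans (congrArg (c • ·) e2).symm

theorem inner_fluxLinear (a : CoeffField d) (hU : Bornology.IsBounded U) (hUm : MeasurableSet U)
    (f g : FieldSpace U) :
    inner ℝ f (fluxLinear U a hU hUm g) = energy a U (fieldRep f) (fieldRep g) := by
  rw [inner_fieldSpace]
  exact pairing_congr_ae (ae_eq_refl _) ((memL2_fieldRep g).flux a hU hUm).fieldRep_cls

theorem energy_le (a : CoeffField d) {f : Vec d → Vec d} (hU : Bornology.IsBounded U)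
    (hUm : MeasurableSet U) {Λ : ℝ}
    (hΛ : ∀ᵐ x ∂volume.restrict U, ∀ ξ : Vec d, ξ ⬝ᵥ (a.toFun x *ᵥ ξ) ≤ Λ * (ξ ⬝ᵥ ξ))
    (hf : MemL2 U f) : energy a U f f ≤ Λ * pairing U f f := by
  rw [energy, pairing, pairing, ← integral_const_mul]
  refine integral_mono_ae (hf.integrable_dot (hf.flux a hU hUm))
    ((hf.integrable_dot hf).const_mul Λ) ?_
  filter_upwards [hΛ] with x hx
  exact hx (f x)

theorem le_energy (a : CoeffField d) {f : Vec d → Vec d} (hU : Bornology.IsBounded U)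
    (hUm : MeasurableSet U) {l : ℝ}
    (hl : ∀ᵐ x ∂volume.restrict U, ∀ ξ : Vec d, l * (ξ ⬝ᵥ ξ) ≤ ξ ⬝ᵥ (a.toFun x *ᵥ ξ))
    (hf : MemL2 U f) : l * pairing U f f ≤ energy a U f f := by
  rw [energy, pairing, pairing, ← integral_const_mul]
  refine integral_mono_ae ((hf.integrable_dot hf).const_mul l)
    (hf.integrable_dot (hf.flux a hU hUm)) ?_
  filter_upwards [hl] with x hx
  exact hx (f x)

theorem flux_pairing_le (a : CoeffField d) {f : Vec d → Vec d} (hU : Bornology.IsBounded U)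
    (hUm : MeasurableSet U) {Λ : ℝ}
    (hΛ : ∀ᵐ x ∂volume.restrict U, ∀ ξ : Vec d, ξ ⬝ᵥ (a.toFun x *ᵥ ξ) ≤ Λ * (ξ ⬝ᵥ ξ))
    (hf : MemL2 U f) : pairing U (a.flux f) (a.flux f) ≤ Λ * energy a U f f := by
  have hff := hf.flux a hU hUm
  rw [energy, pairing, pairing, ← integral_const_mul]
  refine integral_mono_ae (hff.integrable_dot hff) ((hf.integrable_dot hff).const_mul Λ) ?_
  filter_upwards [hΛ] with x hx
  exact mulVec_dot_self_le (a.isSymm x) (a.quad_nonneg x) hx (f x)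

theorem norm_fluxLinear_le (a : CoeffField d) (hU : Bornology.IsBounded U) (hUm : MeasurableSet U) :
    ∃ K : ℝ, 0 < K ∧ (∀ f, ‖fluxLinear U a hU hUm f‖ ≤ K * ‖f‖) ∧
      ∀ f : FieldSpace U, ‖f‖ * ‖f‖ ≤ K * inner ℝ f (fluxLinear U a hU hUm f) := by
  obtain ⟨K, hK0, hK⟩ := a.exists_quad_bounds hU
  have h1 : ∀ᵐ x ∂volume.restrict U, ∀ ξ : Vec d, ξ ⬝ᵥ (a.toFun x *ᵥ ξ) ≤ K * (ξ ⬝ᵥ ξ) := by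
    filter_upwards [ae_restrict_mem hUm] with x hx ξ using (hK x hx ξ).1
  have h2 : ∀ᵐ x ∂volume.restrict U, ∀ ξ : Vec d, K⁻¹ * (ξ ⬝ᵥ ξ) ≤ ξ ⬝ᵥ (a.toFun x *ᵥ ξ) := by
    filter_upwards [ae_restrict_mem hUm] with x hx ξ
    rw [inv_mul_le_iff₀ hK0]
    exact (hK x hx ξ).2
  refine ⟨K, hK0, fun f => ?_, fun f => ?_⟩
  · have hm := memL2_fieldRep f
    have e0 : pairing U (fieldRep (fluxLinear U a hU hUm f)) (fieldRep (fluxLinear U a hU hUm f)) =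
        pairing U (a.flux (fieldRep f)) (a.flux (fieldRep f)) :=
      pairing_congr_ae (hm.flux a hU hUm).fieldRep_cls (hm.flux a hU hUm).fieldRep_cls
    refine abs_le_of_sq_le_sq' ?_ (by positivity) |>.2
    rw [mul_pow, ← real_inner_self_eq_norm_sq, ← real_inner_self_eq_norm_sq, inner_fieldSpace,
      inner_fieldSpace, e0]
    have e1 := flux_pairing_le a hU hUm h1 hm
    have e2 := energy_le a hU hUm h1 hm
    nlinarith
  · rw [inner_fluxLinear, ← real_inner_self_eq_norm_mul_norm, inner_fieldSpace,
      ← inv_mul_le_iff₀ hK0]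
    exact le_energy a hU hUm h2 (memL2_fieldRep f)

variable (U) in
/-- The classes of gradients of functions in `C_c^∞(W)`. -/
noncomputable def gradSubmodule (W : Set (Vec d)) : Submodule ℝ (FieldSpace U) where
  carrier := {f | ∃ φ, ∃ h : IsTestFunction W φ, f = (h.memL2_grad (V := U)).cls}
  add_mem' := by
    rintro _ _ ⟨φ, hφ, rfl⟩ ⟨ψ, hψ, rfl⟩
    refine ⟨φ + ψ, hφ.add hψ, ?_⟩
    ext1 i
    refine (MemLp.toLp_add (hφ.memL2_grad (V := U) i) (hψ.memL2_grad (V := U) i)).symm.trans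
      (MemLp.toLp_congr _ ((hφ.add hψ).memL2_grad (V := U) i) (ae_of_all _ fun x => ?_))
    simp [grad_add hφ.differentiable hψ.differentiable]
  zero_mem' := by
    refine ⟨0, isTestFunction_zero, ?_⟩
    ext1 i
    refine ((MemLp.toLp_congr ((isTestFunction_zero (U := W)).memL2_grad (V := U) i) MemLp.zero
      (ae_of_all _ fun x => ?_)).trans (MemLp.toLp_zero _)).symm
    simp [grad, partialDeriv]
  smul_mem' := by
    rintro c _ ⟨φ, hφ, rfl⟩
    refine ⟨c • φ, hφ.smul c, ?_⟩
    ext1 i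
    refine (MemLp.toLp_const_smul c (hφ.memL2_grad (V := U) i)).symm.trans
      (MemLp.toLp_congr _ ((hφ.smul c).memL2_grad (V := U) i) (ae_of_all _ fun x => ?_))
    simp [grad_smul c hφ.differentiable]

theorem gradLim_fieldRep {W : Set (Vec d)} {f : FieldSpace U}
    (hf : f ∈ (gradSubmodule U W).topologicalClosure) : GradLim U W (fieldRep f) := by
  obtain ⟨F, hF, hFf⟩ := mem_closure_iff_seq_limit.mp hf
  choose φ hφ hφF using hF
  refine ⟨memL2_fieldRep f, φ, hφ, fun i => ?_⟩
  have h1 : Tendsto (fun k => F k i) atTop (𝓝 (f i)) :=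
    ((PiLp.continuous_apply 2 _ i).tendsto f).comp hFf
  rw [Lp.tendsto_Lp_iff_tendsto_eLpNorm'] at h1
  refine h1.congr fun k => ?_
  rw [← eLpNorm_neg]
  refine eLpNorm_congr_ae ?_
  have h2 := ((hφ k).memL2_grad (V := U)).fieldRep_cls
  rw [← hφF k] at h2
  filter_upwards [h2] with x hx
  have := congrFun hx i
  simp only [fieldRep] at this
  simp [fieldRep, this]

theorem GradLim.cls_mem {W : Set (Vec d)} {f : Vec d → Vec d} (hf : GradLim U W f) :
    hf.memL2.cls ∈ (gradSubmodule U W).topologicalClosure := by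
  obtain ⟨φ, hφ, hφf⟩ := hf.approx
  refine mem_closure_of_tendsto (b := atTop) (f := fun k => ((hφ k).memL2_grad (V := U)).cls) ?_
    (Eventually.of_forall fun k => ⟨φ k, hφ k, rfl⟩)
  have : Tendsto (fun k => (fun i => ((hφ k).memL2_grad (V := U) i).toLp)) atTop
      (𝓝 fun i => (hf.memL2 i).toLp) := by
    refine tendsto_pi_nhds.mpr fun i => ?_
    rw [Lp.tendsto_Lp_iff_tendsto_eLpNorm'']
    refine (hφf i).congr fun k => ?_
    rw [← eLpNorm_neg]
    congr 1
    ext x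
    simp
  exact ((PiLp.continuous_toLp 2 _).tendsto _).comp this

end Hilbert

variable {U W : Set (Vec d)}

/-- The Lax-Milgram theorem in the space of limits of gradients. -/
theorem exists_corrector (a : CoeffField d) (hU : Bornology.IsBounded U) (hUm : MeasurableSet U)
    (W : Set (Vec d)) {b : Vec d → Vec d} (hb : MemL2 U b) :
    ∃ h, GradLim U W h ∧ ∀ f, GradLim U W f → energy a U f h = pairing U f b := by
  obtain ⟨K, hK0, hK1, hK2⟩ := norm_fluxLinear_le a hU hUm
  let S := (gradSubmodule U W).topologicalClosure
  have : CompleteSpace S := (Submodule.isClosed_topologicalClosure _).completeSpace_coe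
  let T := fluxLinear U a hU hUm
  let B : S →L[ℝ] S →L[ℝ] ℝ := LinearMap.mkContinuous₂
    (LinearMap.mk₂ ℝ (fun u v : S => (inner ℝ (v : FieldSpace U) (T u) : ℝ))
      (by intros; simp [inner_add_right]) (by intros; simp [inner_smul_right])
      (by intros; simp [inner_add_left]) (by intros; simp [inner_smul_left])) K
    (fun u v => by
      simp only [LinearMap.mk₂_apply]
      refine (norm_inner_le_norm _ _).trans ?_
      have := hK1 u
      rw [mul_comm]
      exact mul_le_mul_of_nonneg_right (by simpa using this) (norm_nonneg _))
  have hB : ∀ u v : S, B u v = inner ℝ (v : FieldSpace U) (T u) := fun u v => rfl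
  -- The unknown is the gradient itself, so the pointwise lower bound on the coefficients is already
  -- coercivity; no Poincaré inequality is needed.
  have hcoer : IsCoercive B := by
    refine ⟨K⁻¹, by positivity, fun u => ?_⟩
    rw [hB, mul_assoc, inv_mul_le_iff₀ hK0]
    exact hK2 u
  -- Only the pairings of `b` with elements of `S` matter, so `b` may be replaced by its projection
  -- onto `S`.
  let r : S := S.orthogonalProjectionOnto hb.cls
  let h : S := hcoer.continuousLinearEquivOfBilin.symm r
  refine ⟨fieldRep h, gradLim_fieldRep h.2, fun f hf => ?_⟩
  have h1 := hcoer.continuousLinearEquivOfBilin_apply h ⟨hf.memL2.cls, hf.cls_mem⟩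
  simp only [h, ContinuousLinearEquiv.apply_symm_apply, hB] at h1
  rw [inner_fluxLinear] at h1
  have h2 : (inner ℝ r (⟨hf.memL2.cls, hf.cls_mem⟩ : S) : ℝ) = inner ℝ hb.cls hf.memL2.cls :=
    Submodule.inner_orthogonalProjectionOnto_eq_of_mem_right _ _
  rw [h2, inner_fieldSpace, pairing_congr_ae hb.fieldRep_cls hf.memL2.fieldRep_cls] at h1
  rw [pairing_comm, h1]
  exact pairing_congr_ae hf.memL2.fieldRep_cls.symm (ae_eq_refl _)

/-! ### Dirichlet and Neumann fields and their matrices -/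

/-- Nonempty bounded open sets. -/
structure BddOpen (U : Set (Vec d)) : Prop where
  bdd : Bornology.IsBounded U
  isOpen : IsOpen U
  nonempty : U.Nonempty

variable {U V : Set (Vec d)}

theorem BddOpen.meas (hU : BddOpen U) : MeasurableSet U := hU.isOpen.measurableSet

theorem BddOpen.volume_pos (hU : BddOpen U) : 0 < volume.real U :=
  ENNReal.toReal_pos (hU.isOpen.measure_pos _ hU.nonempty).ne' hU.bdd.measure_lt_top.ne

/-- A smooth compactly supported function equal to one on a neighborhood of a bounded set. -/
theorem exists_cutoff_eq_one (hU : Bornology.IsBounded U) :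
    ∃ χ : Vec d → ℝ, IsTestFunction Set.univ χ ∧ ∀ x ∈ U, χ =ᶠ[𝓝 x] fun _ => 1 := by
  obtain ⟨R, hR⟩ := hU.subset_ball 0
  have hR0 : 0 < max R 1 := by positivity
  let χ : ContDiffBump (0 : Vec d) := ⟨max R 1, max R 1 + 1, hR0, by linarith⟩
  refine ⟨χ, ⟨χ.contDiff, χ.hasCompactSupport, Set.subset_univ _⟩, fun x hx => ?_⟩
  have hx' : x ∈ Metric.ball (0 : Vec d) (max R 1) :=
    Metric.ball_subset_ball (le_max_left _ _) (hR hx)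
  filter_upwards [Metric.isOpen_ball.mem_nhds hx'] with y hy
  exact χ.one_of_mem_closedBall (Metric.ball_subset_closedBall hy)

theorem partialDeriv_dot (p : Vec d) (i : Fin d) (x : Vec d) :
    partialDeriv i (fun x => p ⬝ᵥ x) x = p i := by
  have h : (fun x : Vec d => p ⬝ᵥ x) =
      (∑ j, p j • ContinuousLinearMap.proj (R := ℝ) (φ := fun _ : Fin d => ℝ) j : Vec d →L[ℝ] ℝ) := by
    ext x
    simp [dotProduct]
  rw [partialDeriv, h, ContinuousLinearMap.fderiv]
  simp [Pi.single_apply]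

theorem contDiff_dot (p : Vec d) : ContDiff ℝ ∞ fun x : Vec d => p ⬝ᵥ x := by
  simp only [dotProduct]
  fun_prop

theorem gradLim_congr_ae {W : Set (Vec d)} {f g : Vec d → Vec d} (hf : GradLim U W f)
    (h : f =ᵐ[volume.restrict U] g) : GradLim U W g := by
  obtain ⟨φ, hφ, hφf⟩ := hf.approx
  have hi : ∀ i, (fun x => f x i) =ᵐ[volume.restrict U] fun x => g x i := fun i =>
    h.mono fun x hx => by simp only [hx]
  refine ⟨fun i => (memLp_congr_ae (hi i)).mp (hf.memL2 i), φ, hφ, fun i => ?_⟩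
  refine (hφf i).congr fun k => eLpNorm_congr_ae ?_
  exact (hi i).mono fun x hx => by simp only [hx]

/-- On `U` the constant `p` is the gradient of `χ(x) p·x`, where `χ = 1` near every point of `U`.
Neumann fields can therefore be tested against constants. -/
theorem gradLim_const (hU : BddOpen U) (p : Vec d) : GradLim U Set.univ fun _ => p := by
  obtain ⟨χ, hχ, hχ1⟩ := exists_cutoff_eq_one hU.bdd
  refine gradLim_congr_ae (hχ.mul_right (contDiff_dot p)).gradLim ?_
  filter_upwards [ae_restrict_mem hU.meas] with x hx
  ext i
  rw [← partialDeriv_dot p i x]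
  simp only [grad, partialDeriv]
  congr 1
  apply Filter.EventuallyEq.fderiv_eq
  filter_upwards [hχ1 x hx] with y hy
  simp [hy]

theorem exists_dirichlet (hU : BddOpen U) (a : CoeffField d) (p : Vec d) :
    ∃ v : Vec d → Vec d, GradLim U U (v - fun _ => p) ∧
      ∀ f, GradLim U U f → energy a U f v = 0 := by
  have hp := memL2_const hU.bdd p
  obtain ⟨h, h1, h2⟩ := exists_corrector a hU.bdd hU.meas U
    ((hp.flux a hU.bdd hU.meas).smul (-1))
  refine ⟨(fun _ => p) + h, by simpa using h1, fun f hf => ?_⟩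
  rw [energy_add_right a hU.bdd hU.meas hp h1.memL2 hf.memL2, h2 f hf, pairing_comm f,
    pairing_smul_left, pairing_comm]
  simp [energy]

theorem exists_neumann (hU : BddOpen U) (a : CoeffField d) (q : Vec d) :
    ∃ h : Vec d → Vec d, GradLim U Set.univ h ∧
      ∀ f, GradLim U Set.univ f → energy a U f h = pairing U f fun _ => q :=
  exists_corrector a hU.bdd hU.meas Set.univ (memL2_const hU.bdd q)

/-- The minimizer of the energy among gradient fields with affine boundary values `p · x`. -/
noncomputable def dirichlet (hU : BddOpen U) (a : CoeffField d) (p : Vec d) : Vec d → Vec d :=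
  -- Solutions are chosen for the basis vectors only and extended linearly, so that linearity in `p`
  -- requires no uniqueness argument.
  ∑ i, p i • (exists_dirichlet hU a (Pi.single i 1)).choose

/-- The gradient field with normal flux `q`. -/
noncomputable def neumann (hU : BddOpen U) (a : CoeffField d) (q : Vec d) : Vec d → Vec d :=
  ∑ i, q i • (exists_neumann hU a (Pi.single i 1)).choose

variable (hU : BddOpen U) (a : CoeffField d)

theorem const_eq_sum (p : Vec d) : (fun _ : Vec d => p) =
    ∑ i, p i • (fun _ : Vec d => (Pi.single i 1 : Vec d)) := by
  ext x j
  simp [Finset.sum_apply, Pi.single_apply]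

theorem gradLim_dirichlet (p : Vec d) : GradLim U U (dirichlet hU a p - fun _ => p) := by
  rw [const_eq_sum p, dirichlet, ← Finset.sum_sub_distrib]
  refine gradLim_sum _ fun i _ => ?_
  rw [← smul_sub]
  exact (exists_dirichlet hU a (Pi.single i 1)).choose_spec.1.smul _

theorem memL2_dirichlet (p : Vec d) : MemL2 U (dirichlet hU a p) := by
  have := (gradLim_dirichlet hU a p).memL2.add (memL2_const hU.bdd p)
  simpa using this

theorem gradLim_univ_dirichlet (p : Vec d) : GradLim U Set.univ (dirichlet hU a p) := by
  have := ((gradLim_dirichlet hU a p).mono subset_rfl (Set.subset_univ U)).add (gradLim_const hU p)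
  simpa using this

include hU in
theorem energy_sum_smul_right {f : Vec d → Vec d} (hf : MemL2 U f) (p : Vec d)
    {F : Fin d → Vec d → Vec d} (hF : ∀ i, MemL2 U (F i)) :
    energy a U f (∑ i, p i • F i) = ∑ i, p i * energy a U f (F i) := by
  have : ∀ s : Finset (Fin d), MemL2 U (∑ i ∈ s, p i • F i) ∧
      energy a U f (∑ i ∈ s, p i • F i) = ∑ i ∈ s, p i * energy a U f (F i) := by
    intro s
    classical
    induction s using Finset.induction_on with
    | empty =>
      simp only [Finset.sum_empty]
      exact ⟨fun i => MemLp.zero, by simp [energy, pairing, CoeffField.flux]⟩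
    | insert j s hj ih =>
      rw [Finset.sum_insert hj, Finset.sum_insert hj]
      refine ⟨((hF j).smul _).add ih.1, ?_⟩
      rw [energy_add_right a hU.bdd hU.meas ((hF j).smul _) ih.1 hf, ih.2, energy_smul_right]
  exact (this Finset.univ).2

theorem energy_dirichlet_of_gradLim (p : Vec d) {f : Vec d → Vec d} (hf : GradLim U U f) :
    energy a U f (dirichlet hU a p) = 0 := by
  rw [dirichlet, energy_sum_smul_right hU a hf.memL2 p]
  · exact Finset.sum_eq_zero fun i _ => by
      rw [(exists_dirichlet hU a (Pi.single i 1)).choose_spec.2 f hf, mul_zero]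
  · intro i
    have := (exists_dirichlet hU a (Pi.single i 1)).choose_spec.1.memL2.add
      (memL2_const hU.bdd (Pi.single i 1))
    simpa using this

theorem gradLim_neumann (q : Vec d) : GradLim U Set.univ (neumann hU a q) :=
  gradLim_sum _ fun i _ => (exists_neumann hU a (Pi.single i 1)).choose_spec.1.smul _

include hU in
theorem pairing_const_eq {f : Vec d → Vec d} (hf : MemL2 U f) (q : Vec d) :
    pairing U f (fun _ => q) = ∑ i, q i * pairing U f fun _ => Pi.single i 1 := by
  have := isFiniteMeasure_restrict_of_isBounded hU.bdd
  simp only [pairing]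
  simp_rw [← integral_const_mul]
  rw [← integral_finsetSum _ fun i _ => (hf.integrable_dot
    (memL2_const hU.bdd (Pi.single i 1))).const_mul (q i)]
  refine integral_congr_ae (ae_of_all _ fun x => ?_)
  simp only [dotProduct_single, mul_one]
  exact dotProduct_comm _ _

theorem energy_neumann_of_gradLim (q : Vec d) {f : Vec d → Vec d} (hf : GradLim U Set.univ f) :
    energy a U f (neumann hU a q) = pairing U f fun _ => q := by
  rw [neumann, energy_sum_smul_right hU a hf.memL2 q
    fun i => (exists_neumann hU a (Pi.single i 1)).choose_spec.1.memL2,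
    pairing_const_eq hU hf.memL2]
  exact Finset.sum_congr rfl fun i _ => by
    rw [(exists_neumann hU a (Pi.single i 1)).choose_spec.2 f hf]

/-- The matrix of the Dirichlet problem in `U`. -/
noncomputable def dirichletMatrix : Mat d := Matrix.of fun i j =>
  (volume.real U)⁻¹ * energy a U (dirichlet hU a (Pi.single i 1)) (dirichlet hU a (Pi.single j 1))

/-- The matrix of the Neumann problem in `U`. -/
noncomputable def neumannMatrix : Mat d := Matrix.of fun i j =>
  (volume.real U)⁻¹ * energy a U (neumann hU a (Pi.single i 1)) (neumann hU a (Pi.single j 1))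

theorem dirichlet_eq_sum (p : Vec d) :
    dirichlet hU a p = ∑ i, p i • dirichlet hU a (Pi.single i 1) := by
  simp [dirichlet, Pi.single_apply]

theorem neumann_eq_sum (p : Vec d) :
    neumann hU a p = ∑ i, p i • neumann hU a (Pi.single i 1) := by
  simp [neumann, Pi.single_apply]

include hU in
theorem energy_eq_of_linear {F : Vec d → Vec d → Vec d}
    (hF : ∀ p, F p = ∑ i, p i • F (Pi.single i 1)) (hm : ∀ p, MemL2 U (F p)) (p q : Vec d) :
    energy a U (F p) (F q) = volume.real U * (p ⬝ᵥ (Matrix.of (fun i j =>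
      (volume.real U)⁻¹ * energy a U (F (Pi.single i 1)) (F (Pi.single j 1))) *ᵥ q)) := by
  have h1 : ∀ f, MemL2 U f → energy a U f (F q) = ∑ j, q j * energy a U f (F (Pi.single j 1)) := by
    intro f hf
    rw [hF q, energy_sum_smul_right hU a hf q fun i => hm _]
  have h2 : ∀ f, MemL2 U f → energy a U (F p) f = ∑ j, p j * energy a U (F (Pi.single j 1)) f := by
    intro f hf
    rw [energy_comm, hF p, energy_sum_smul_right hU a hf p fun i => hm _]
    simp_rw [energy_comm a f]
  rw [h2 _ (hm q)]
  simp_rw [h1 _ (hm _)]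
  have hv := hU.volume_pos.ne'
  simp only [dotProduct, Matrix.mulVec, Matrix.of_apply, Finset.mul_sum]
  refine Finset.sum_congr rfl fun i _ => Finset.sum_congr rfl fun j _ => ?_
  field_simp

theorem energy_dirichlet (p q : Vec d) :
    energy a U (dirichlet hU a p) (dirichlet hU a q) =
      volume.real U * (p ⬝ᵥ (dirichletMatrix hU a *ᵥ q)) :=
  energy_eq_of_linear hU a (dirichlet_eq_sum hU a) (memL2_dirichlet hU a) p q

theorem energy_neumann (p q : Vec d) :
    energy a U (neumann hU a p) (neumann hU a q) =
      volume.real U * (p ⬝ᵥ (neumannMatrix hU a *ᵥ q)) :=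
  energy_eq_of_linear hU a (neumann_eq_sum hU a) (fun q => (gradLim_neumann hU a q).memL2) p q

theorem dirichletMatrix_isSymm : (dirichletMatrix hU a).IsSymm := by
  ext i j
  simp [dirichletMatrix, energy_comm a (dirichlet hU a (Pi.single i 1))]

theorem neumannMatrix_isSymm : (neumannMatrix hU a).IsSymm := by
  ext i j
  simp [neumannMatrix, energy_comm a (neumann hU a (Pi.single i 1))]

theorem dirichletMatrix_nonneg (p : Vec d) : 0 ≤ p ⬝ᵥ (dirichletMatrix hU a *ᵥ p) := by
  have h := energy_dirichlet hU a p p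
  have h1 := energy_self_nonneg (U := U) a (dirichlet hU a p)
  rw [h] at h1
  exact nonneg_of_mul_nonneg_right h1 hU.volume_pos

theorem neumannMatrix_nonneg (p : Vec d) : 0 ≤ p ⬝ᵥ (neumannMatrix hU a *ᵥ p) := by
  have h := energy_neumann hU a p p
  have h1 := energy_self_nonneg (U := U) a (neumann hU a p)
  rw [h] at h1
  exact nonneg_of_mul_nonneg_right h1 hU.volume_pos

theorem pairing_const_const (p q : Vec d) :
    pairing U (fun _ => p) (fun _ => q) = volume.real U * (p ⬝ᵥ q) := by
  simp [pairing, Measure.real]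

theorem pairing_dirichlet_const (p q : Vec d) :
    pairing U (dirichlet hU a p) (fun _ => q) = volume.real U * (p ⬝ᵥ q) := by
  have h := (gradLim_dirichlet hU a p).pairing_const hU.bdd q
  rw [pairing_sub_left (memL2_dirichlet hU a p) (memL2_const hU.bdd p) (memL2_const hU.bdd q),
    pairing_const_const] at h
  linarith

/-- The Dirichlet field is an admissible test field in the Neumann problem, and its mean is `p`
because it differs from `p` by a limit of compactly supported gradients. -/
theorem energy_dirichlet_neumann (p q : Vec d) :
    energy a U (dirichlet hU a p) (neumann hU a q) = volume.real U * (p ⬝ᵥ q) := by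
  rw [energy_neumann_of_gradLim hU a q (gradLim_univ_dirichlet hU a p), pairing_dirichlet_const]

/-- The Dirichlet field of slope `e` minus `e` is admissible in the equation for slope `p`. Hence
the mean flux of the Dirichlet field is the matrix applied to the slope. -/
theorem pairing_const_flux_dirichlet (e p : Vec d) :
    pairing U (fun _ => e) (a.flux (dirichlet hU a p)) =
      volume.real U * (e ⬝ᵥ (dirichletMatrix hU a *ᵥ p)) := by
  have h := energy_dirichlet_of_gradLim hU a p (gradLim_dirichlet hU a e)
  rw [energy_sub_left a hU.bdd hU.meas (memL2_dirichlet hU a e) (memL2_const hU.bdd e)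
    (memL2_dirichlet hU a p), energy_dirichlet] at h
  change energy a U _ _ = _
  linarith

theorem pairing_const_flux_neumann (e q : Vec d) :
    pairing U (fun _ => e) (a.flux (neumann hU a q)) = volume.real U * (e ⬝ᵥ q) := by
  change energy a U _ _ = _
  rw [energy_neumann_of_gradLim hU a q (gradLim_const hU e), pairing_const_const]

/-- The difference of the Neumann and the Dirichlet field. -/
noncomputable def responseField (p q : Vec d) : Vec d → Vec d := neumann hU a q - dirichlet hU a p

/-- The response functional `J(U, p, q)`. -/
noncomputable def response (p q : Vec d) : ℝ :=
  (1 / 2 : ℝ) * (p ⬝ᵥ (dirichletMatrix hU a *ᵥ p)) + (1 / 2 : ℝ) * (q ⬝ᵥ (neumannMatrix hU a *ᵥ q))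
    - p ⬝ᵥ q

theorem gradLim_responseField (p q : Vec d) : GradLim U Set.univ (responseField hU a p q) :=
  (gradLim_neumann hU a q).neg_add (gradLim_univ_dirichlet hU a p)

/-- The cross term in the expanded square is `-2|U| p·q`. This identifies the algebraic quantity
`response` with an energy and makes it nonnegative. -/
theorem energy_responseField (p q : Vec d) :
    energy a U (responseField hU a p q) (responseField hU a p q) =
      2 * volume.real U * response hU a p q := by
  rw [responseField, energy_sub_self a hU.bdd hU.meas (gradLim_neumann hU a q).memL2
    (memL2_dirichlet hU a p), energy_comm a (neumann hU a q) (dirichlet hU a p), energy_dirichlet_neumann,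
    energy_dirichlet, energy_neumann, response]
  ring

theorem response_nonneg (p q : Vec d) : 0 ≤ response hU a p q := by
  have h := energy_self_nonneg (U := U) a (responseField hU a p q)
  rw [energy_responseField] at h
  have := hU.volume_pos
  exact nonneg_of_mul_nonneg_right h (by positivity)

/-- The flux of the response field is divergence free: the Neumann part contributes `∫ f·q`, which
vanishes for fields `f` with zero boundary values. -/
theorem energy_responseField_of_gradLim (p q : Vec d) {f : Vec d → Vec d} (hf : GradLim U U f) :
    energy a U f (responseField hU a p q) = 0 := by
  rw [responseField, energy_sub_right a hU.bdd hU.meas (gradLim_neumann hU a q).memL2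
    (memL2_dirichlet hU a p) hf.memL2, energy_dirichlet_of_gradLim hU a p hf,
    energy_neumann_of_gradLim hU a q (hf.mono subset_rfl (Set.subset_univ U)),
    hf.pairing_const hU.bdd, sub_zero]

/-- The mean flux is `q - Dp`, which is small when `q` is the expected value of `Dp` and `D`
fluctuates little. This is what makes the choice `q = E[D]p` effective. -/
theorem pairing_const_flux_responseField (e p q : Vec d) :
    pairing U (fun _ => e) (a.flux (responseField hU a p q)) =
      volume.real U * (e ⬝ᵥ (q - dirichletMatrix hU a *ᵥ p)) := by
  change energy a U _ _ = _
  rw [responseField, energy_sub_right a hU.bdd hU.meas (gradLim_neumann hU a q).memL2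
    (memL2_dirichlet hU a p) (memL2_const hU.bdd e)]
  have h1 := pairing_const_flux_dirichlet hU a e p
  have h2 := pairing_const_flux_neumann hU a e q
  simp only [energy, h1, h2, dotProduct_sub]
  ring

/-! ### Variational characterizations -/

theorem dirichlet_le_energy (p : Vec d) {g : Vec d → Vec d} (hg : GradLim U U g) :
    volume.real U * (p ⬝ᵥ (dirichletMatrix hU a *ᵥ p)) ≤
      energy a U ((fun _ => p) + g) ((fun _ => p) + g) := by
  let v := dirichlet hU a p
  have hk : GradLim U U (g - (v - fun _ => p)) := hg.neg_add (gradLim_dirichlet hU a p)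
  have e : (fun _ => p) + g = v + (g - (v - fun _ => p)) := by abel
  rw [e, energy_add_self a hU.bdd hU.meas (memL2_dirichlet hU a p) hk.memL2,
    energy_dirichlet]
  have hc := energy_dirichlet_of_gradLim hU a p hk
  rw [energy_comm] at hc
  linarith [energy_self_nonneg (U := U) a (g - (v - fun _ => p))]

/-- The minimum is approached along genuine test functions. This serves to identify it with `mu`, to
reduce to countably many competitors for measurability, and to translate competitors. -/
theorem exists_energy_dirichlet_lt (p : Vec d) {ε : ℝ} (hε : 0 < ε) :
    ∃ φ, IsTestFunction U φ ∧ energy a U ((fun _ => p) + grad φ) ((fun _ => p) + grad φ) <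
      volume.real U * (p ⬝ᵥ (dirichletMatrix hU a *ᵥ p)) + ε := by
  have h := gradLim_dirichlet hU a p
  obtain ⟨φ, hφ, hφf⟩ := h.approx
  have hp := memL2_const hU.bdd p
  have hm : ∀ k, MemL2 U ((fun _ => p) + grad (φ k)) := fun k => hp.add (hφ k).memL2_grad
  have h1 : TendstoL2 U (fun k => (fun _ => p) + grad (φ k)) (dirichlet hU a p) := by
    have := TendstoL2.add (fun _ => hp) hp (fun k => (hφ k).memL2_grad) h.memL2
      (tendstoL2_const _) hφf
    simpa using this
  have h2 := TendstoL2.pairing hm (memL2_dirichlet hU a p)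
    (fun k => (hm k).flux a hU.bdd hU.meas) ((memL2_dirichlet hU a p).flux a hU.bdd hU.meas) h1
    (TendstoL2.flux a hU.bdd hU.meas hm (memL2_dirichlet hU a p) h1)
  have h3 : pairing U (dirichlet hU a p) (a.flux (dirichlet hU a p)) <
      volume.real U * (p ⬝ᵥ (dirichletMatrix hU a *ᵥ p)) + ε := by
    have := energy_dirichlet hU a p p
    rw [energy] at this
    linarith
  obtain ⟨k, hk⟩ := (h2.eventually (gt_mem_nhds h3)).exists
  exact ⟨φ k, hφ k, hk⟩

theorem le_neumann (q : Vec d) {g : Vec d → Vec d} (hg : GradLim U Set.univ g) :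
    2 * pairing U g (fun _ => q) - energy a U g g ≤
      volume.real U * (q ⬝ᵥ (neumannMatrix hU a *ᵥ q)) := by
  have hn := (gradLim_neumann hU a q).memL2
  have h := energy_self_nonneg (U := U) a (g - neumann hU a q)
  rw [energy_sub_self a hU.bdd hU.meas hg.memL2 hn, energy_neumann_of_gradLim hU a q hg,
    energy_neumann] at h
  linarith

theorem exists_lt_neumann (q : Vec d) {ε : ℝ} (hε : 0 < ε) :
    ∃ φ, IsTestFunction Set.univ φ ∧ volume.real U * (q ⬝ᵥ (neumannMatrix hU a *ᵥ q)) - ε <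
      2 * pairing U (grad φ) (fun _ => q) - energy a U (grad φ) (grad φ) := by
  have h := gradLim_neumann hU a q
  obtain ⟨φ, hφ, hφf⟩ := h.approx
  have hq := memL2_const hU.bdd q
  have hm : ∀ k, MemL2 U (grad (φ k)) := fun k => (hφ k).memL2_grad
  have h2 := TendstoL2.pairing hm h.memL2
    (fun k => (hm k).flux a hU.bdd hU.meas) (h.memL2.flux a hU.bdd hU.meas) hφf
    (TendstoL2.flux a hU.bdd hU.meas hm h.memL2 hφf)
  have h4 := TendstoL2.pairing hm h.memL2 (fun _ => hq) hq hφf (tendstoL2_const _)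
  have h3 : volume.real U * (q ⬝ᵥ (neumannMatrix hU a *ᵥ q)) - ε <
      2 * pairing U (neumann hU a q) (fun _ => q) -
        pairing U (neumann hU a q) (a.flux (neumann hU a q)) := by
    have e1 := energy_neumann hU a q q
    have e2 := energy_neumann_of_gradLim hU a q h
    rw [← e2]
    rw [energy] at e1 ⊢
    linarith
  obtain ⟨k, hk⟩ := (((h4.const_mul 2).sub h2).eventually (lt_mem_nhds h3)).exists
  exact ⟨φ k, hφ k, hk⟩

theorem MemH10.gradLim {w : Vec d → ℝ} {g : Vec d → Vec d} (h : MemH10 U w g) : GradLim U U g :=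
  ⟨h.memH1.memLp_grad, by
    obtain ⟨φ, h1, _, h3⟩ := h.approx
    exact ⟨φ, h1, h3⟩⟩

theorem setAverage_eq_energy (f : Vec d → Vec d) :
    ⨍ x in U, (1 / 2 : ℝ) * (f x ⬝ᵥ (a.toFun x *ᵥ f x)) =
      (volume.real U)⁻¹ * ((1 / 2 : ℝ) * energy a U f f) := by
  rw [setAverage_eq, integral_const_mul]
  rfl

theorem mu_eq (p : Vec d) : mu a U p = (1 / 2 : ℝ) * (p ⬝ᵥ (dirichletMatrix hU a *ᵥ p)) := by
  have hv := hU.volume_pos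
  have hlow : ∀ w : {w : (Vec d → ℝ) × (Vec d → Vec d) // MemH10 U w.1 w.2},
      (1 / 2 : ℝ) * (p ⬝ᵥ (dirichletMatrix hU a *ᵥ p)) ≤
      ⨍ x in U, (1 / 2 : ℝ) * ((p + w.1.2 x) ⬝ᵥ (a.toFun x *ᵥ (p + w.1.2 x))) := by
    intro w
    have h1 := setAverage_eq_energy (U := U) a ((fun _ => p) + w.1.2)
    have h2 := dirichlet_le_energy hU a p w.2.gradLim
    simp only [Pi.add_apply] at h1
    rw [h1, le_inv_mul_iff₀ hv]
    linarith
  have hne : Nonempty {w : (Vec d → ℝ) × (Vec d → Vec d) // MemH10 U w.1 w.2} :=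
    ⟨⟨(0, grad 0), isTestFunction_zero.memH10⟩⟩
  refine le_antisymm (le_of_forall_pos_lt_add fun ε hε => ?_) (le_ciInf hlow)
  obtain ⟨φ, hφ, h1⟩ := exists_energy_dirichlet_lt hU a p (ε := 2 * volume.real U * ε)
    (by positivity)
  refine lt_of_le_of_lt (ciInf_le ⟨_, Set.forall_mem_range.mpr hlow⟩ ⟨(φ, grad φ), hφ.memH10⟩) ?_
  have h2 := setAverage_eq_energy (U := U) a ((fun _ => p) + grad φ)
  simp only [Pi.add_apply] at h2
  rw [h2, inv_mul_lt_iff₀ hv]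
  linarith

theorem represents_mu : Represents (dirichletMatrix hU a) (mu a U) :=
  ⟨dirichletMatrix_isSymm hU a, mu_eq hU a⟩

theorem coarseMatrix_eq : coarseMatrix a U = dirichletMatrix hU a :=
  (represents_mu hU a).eq_polarMatrix.symm

/-! ### Subdivisions -/

/-- The sets `V j` are disjoint subsets of `U` which fill `U` up to a null set. -/
structure IsSubdivision {ι : Type*} [Fintype ι] (U : Set (Vec d)) (V : ι → Set (Vec d)) : Prop where
  whole : BddOpen U
  part : ∀ j, BddOpen (V j)
  subset : ∀ j, V j ⊆ U
  disjoint : Pairwise fun i j => Disjoint (V i) (V j)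
  volume_eq : ∑ j, volume.real (V j) = volume.real U

section
variable {ι : Type*} [Fintype ι] {U : Set (Vec d)} {V : ι → Set (Vec d)}

theorem IsSubdivision.iUnion_ae_eq (h : IsSubdivision U V) : (⋃ j, V j) =ᵐ[volume] U := by
  refine ae_eq_of_subset_of_measure_ge (Set.iUnion_subset h.subset) (le_of_eq ?_)
    (MeasurableSet.iUnion fun j => (h.part j).meas).nullMeasurableSet h.whole.bdd.measure_lt_top.ne
  rw [measure_iUnion h.disjoint fun j => (h.part j).meas, tsum_fintype,
    ← ENNReal.toReal_eq_toReal_iff' h.whole.bdd.measure_lt_top.ne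
      (ENNReal.sum_ne_top.mpr fun j _ => (h.part j).bdd.measure_lt_top.ne),
    ENNReal.toReal_sum fun j _ => (h.part j).bdd.measure_lt_top.ne]
  exact h.volume_eq.symm

theorem IsSubdivision.setIntegral_eq (h : IsSubdivision U V) {f : Vec d → ℝ}
    (hf : IntegrableOn f U) : ∫ x in U, f x = ∑ j, ∫ x in V j, f x := by
  rw [← setIntegral_congr_set h.iUnion_ae_eq]
  exact integral_iUnion_fintype (fun j => (h.part j).meas) h.disjoint
    fun j => hf.mono_set (h.subset j)

theorem IsSubdivision.pairing_eq (h : IsSubdivision U V) {f g : Vec d → Vec d} (hf : MemL2 U f)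
    (hg : MemL2 U g) : pairing U f g = ∑ j, pairing (V j) f g :=
  h.setIntegral_eq (hf.integrable_dot hg)

theorem IsSubdivision.energy_eq (h : IsSubdivision U V) (a : CoeffField d) {f g : Vec d → Vec d}
    (hf : MemL2 U f) (hg : MemL2 U g) : energy a U f g = ∑ j, energy a (V j) f g :=
  h.pairing_eq hf (hg.flux a h.whole.bdd h.whole.meas)

end

/-- Extension by zero: the approximating test functions on `V` already vanish outside `V`, so the
same sequence works on `U`. -/
theorem GradLim.indicator {U V : Set (Vec d)} (hV : MeasurableSet V)
    (hVU : V ⊆ U) {f : Vec d → Vec d} (hf : GradLim V V f) : GradLim U U (V.indicator f) := by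
  obtain ⟨φ, hφ, hφf⟩ := hf.approx
  have hind : ∀ g : Vec d → ℝ, eLpNorm (V.indicator g) 2 (volume.restrict U) =
      eLpNorm g 2 (volume.restrict V) := by
    intro g
    rw [eLpNorm_indicator_eq_eLpNorm_restrict hV, Measure.restrict_restrict hV,
      Set.inter_eq_left.mpr hVU]
  have hi : ∀ i, (fun x => V.indicator f x i) = V.indicator fun x => f x i := by
    intro i; ext x; by_cases hx : x ∈ V <;> simp [hx]
  refine ⟨fun i => ?_, φ, fun k => (hφ k).mono hVU, fun i => ?_⟩
  · rw [hi, memLp_indicator_iff_restrict hV, Measure.restrict_restrict hV,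
      Set.inter_eq_left.mpr hVU]
    exact hf.memL2 i
  · refine (hφf i).congr fun k => ?_
    rw [← hind]
    congr 1
    ext x
    by_cases hx : x ∈ V
    · simp [hx]
    · simp [hx, grad, ((hφ k).pderiv i).eq_zero_of_notMem hx]

theorem pairing_indicator {U V : Set (Vec d)} (hV : MeasurableSet V)
    (hVU : V ⊆ U) (f g : Vec d → Vec d) : pairing U (V.indicator f) g = pairing V f g := by
  have : (fun x => V.indicator f x ⬝ᵥ g x) = V.indicator fun x => f x ⬝ᵥ g x := by
    ext x; by_cases hx : x ∈ V <;> simp [hx]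
  rw [pairing, this, setIntegral_indicator hV, Set.inter_eq_right.mpr hVU, pairing]

theorem energy_dirichlet_of_subset {U V : Set (Vec d)} (hU : BddOpen U) (hV : BddOpen V)
    (hVU : V ⊆ U) (a : CoeffField d) (p : Vec d) {f : Vec d → Vec d} (hf : GradLim V V f) :
    energy a V f (dirichlet hU a p) = 0 := by
  have h := energy_dirichlet_of_gradLim hU a p (hf.indicator hV.meas hVU)
  rwa [energy, pairing_indicator hV.meas hVU] at h

/-! ### Defects of additivity as energies -/

section
variable {ι : Type*} [Fintype ι] {U : Set (Vec d)} {V : ι → Set (Vec d)}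
  (h : IsSubdivision U V) (a : CoeffField d)

/-- An exact identity. On a part `V` the field `v_V - p`, extended by zero, is a test field for the
equation of the global field `v_U`, so `∫_V v_V · a v_U = ∫_V p · a v_U`. Summed over the parts, the
right-hand sides give `p` paired with the total flux of `v_U`. -/
theorem sum_energy_dirichlet_sub (p : Vec d) :
    ∑ j, energy a (V j) (dirichlet (h.part j) a p - dirichlet h.whole a p)
        (dirichlet (h.part j) a p - dirichlet h.whole a p) =
      ∑ j, volume.real (V j) * (p ⬝ᵥ (dirichletMatrix (h.part j) a *ᵥ p)) -
        volume.real U * (p ⬝ᵥ (dirichletMatrix h.whole a *ᵥ p)) := by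
  have hv := memL2_dirichlet h.whole a p
  have hp := memL2_const h.whole.bdd p
  have h1 : ∀ j, energy a (V j) (dirichlet (h.part j) a p - dirichlet h.whole a p)
        (dirichlet (h.part j) a p - dirichlet h.whole a p) =
      volume.real (V j) * (p ⬝ᵥ (dirichletMatrix (h.part j) a *ᵥ p)) -
        2 * energy a (V j) (fun _ => p) (dirichlet h.whole a p) +
        energy a (V j) (dirichlet h.whole a p) (dirichlet h.whole a p) := by
    intro j
    have hj := h.part j
    have hvj := hv.mono (h.subset j)
    have h0 := energy_dirichlet_of_subset h.whole hj (h.subset j) a p (gradLim_dirichlet hj a p)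
    rw [energy_sub_left a hj.bdd hj.meas (memL2_dirichlet hj a p) (hp.mono (h.subset j)) hvj] at h0
    rw [energy_sub_self a hj.bdd hj.meas (memL2_dirichlet hj a p) hvj, energy_dirichlet]
    linarith
  simp_rw [h1]
  rw [Finset.sum_add_distrib, Finset.sum_sub_distrib, ← Finset.mul_sum, ← h.energy_eq a hp hv,
    ← h.energy_eq a hv hv, energy_dirichlet]
  have := pairing_const_flux_dirichlet h.whole a p p
  rw [energy, this]
  ring

/-- The dual identity. The restriction of the global Neumann field to a part is admissible in the
problem on that part, so each cross term is the pairing of the global field with `q`. -/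
theorem sum_energy_neumann_sub (q : Vec d) :
    ∑ j, energy a (V j) (neumann (h.part j) a q - neumann h.whole a q)
        (neumann (h.part j) a q - neumann h.whole a q) =
      ∑ j, volume.real (V j) * (q ⬝ᵥ (neumannMatrix (h.part j) a *ᵥ q)) -
        volume.real U * (q ⬝ᵥ (neumannMatrix h.whole a *ᵥ q)) := by
  have hn := gradLim_neumann h.whole a q
  have h1 : ∀ j, energy a (V j) (neumann (h.part j) a q - neumann h.whole a q)
        (neumann (h.part j) a q - neumann h.whole a q) =
      volume.real (V j) * (q ⬝ᵥ (neumannMatrix (h.part j) a *ᵥ q)) -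
        2 * pairing (V j) (neumann h.whole a q) (fun _ => q) +
        energy a (V j) (neumann h.whole a q) (neumann h.whole a q) := by
    intro j
    have hj := h.part j
    have hnj := hn.mono (h.subset j) subset_rfl
    rw [energy_sub_self a hj.bdd hj.meas (gradLim_neumann hj a q).memL2 hnj.memL2,
      energy_neumann hj, energy_comm a (neumann hj a q), energy_neumann_of_gradLim hj a q hnj]
  simp_rw [h1]
  rw [Finset.sum_add_distrib, Finset.sum_sub_distrib, ← Finset.mul_sum,
    ← h.pairing_eq hn.memL2 (memL2_const h.whole.bdd q), ← h.energy_eq a hn.memL2 hn.memL2,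
    ← energy_neumann_of_gradLim h.whole a q hn, energy_neumann h.whole]
  ring

theorem dirichletMatrix_subadditive (p : Vec d) :
    volume.real U * (p ⬝ᵥ (dirichletMatrix h.whole a *ᵥ p)) ≤
      ∑ j, volume.real (V j) * (p ⬝ᵥ (dirichletMatrix (h.part j) a *ᵥ p)) := by
  have h1 := sum_energy_dirichlet_sub h a p
  have h2 : 0 ≤ ∑ j, energy a (V j) (dirichlet (h.part j) a p - dirichlet h.whole a p)
        (dirichlet (h.part j) a p - dirichlet h.whole a p) :=
    Finset.sum_nonneg fun j _ => energy_self_nonneg _ _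
  linarith

theorem neumannMatrix_subadditive (p : Vec d) :
    volume.real U * (p ⬝ᵥ (neumannMatrix h.whole a *ᵥ p)) ≤
      ∑ j, volume.real (V j) * (p ⬝ᵥ (neumannMatrix (h.part j) a *ᵥ p)) := by
  have h1 := sum_energy_neumann_sub h a p
  have h2 : 0 ≤ ∑ j, energy a (V j) (neumann (h.part j) a p - neumann h.whole a p)
        (neumann (h.part j) a p - neumann h.whole a p) :=
    Finset.sum_nonneg fun j _ => energy_self_nonneg _ _
  linarith

theorem energy_add_self_le {U : Set (Vec d)} (hU : BddOpen U) {f g : Vec d → Vec d}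
    (hf : MemL2 U f) (hg : MemL2 U g) :
    energy a U (f + g) (f + g) ≤ 2 * energy a U f f + 2 * energy a U g g := by
  have h1 := energy_self_nonneg (U := U) a (f - g)
  rw [energy_sub_self a hU.bdd hU.meas hf hg] at h1
  rw [energy_add_self a hU.bdd hU.meas hf hg]
  linarith

theorem energy_sub_self_le {U : Set (Vec d)} (hU : BddOpen U) {f g : Vec d → Vec d}
    (hf : MemL2 U f) (hg : MemL2 U g) :
    energy a U (f - g) (f - g) ≤ 2 * energy a U f f + 2 * energy a U g g := by
  have h1 := energy_self_nonneg (U := U) a (f + g)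
  rw [energy_add_self a hU.bdd hU.meas hf hg] at h1
  rw [energy_sub_self a hU.bdd hU.meas hf hg]
  linarith

/-- The response fields on the parts are close to the response field on the whole domain when the
response functional is nearly additive. -/
theorem sum_energy_responseField_sub_le (p q : Vec d) :
    ∑ j, energy a (V j) (responseField (h.part j) a p q - responseField h.whole a p q)
        (responseField (h.part j) a p q - responseField h.whole a p q) ≤
      4 * (∑ j, volume.real (V j) * response (h.part j) a p q -
        volume.real U * response h.whole a p q) := by
  have h1 := sum_energy_dirichlet_sub h a p
  have h2 := sum_energy_neumann_sub h a q
  have h3 : ∀ j, energy a (V j) (responseField (h.part j) a p q - responseField h.whole a p q)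
        (responseField (h.part j) a p q - responseField h.whole a p q) ≤
      2 * energy a (V j) (neumann (h.part j) a q - neumann h.whole a q)
        (neumann (h.part j) a q - neumann h.whole a q) +
      2 * energy a (V j) (dirichlet (h.part j) a p - dirichlet h.whole a p)
        (dirichlet (h.part j) a p - dirichlet h.whole a p) := by
    intro j
    have e : responseField (h.part j) a p q - responseField h.whole a p q =
        (neumann (h.part j) a q - neumann h.whole a q) -
        (dirichlet (h.part j) a p - dirichlet h.whole a p) := by
      simp only [responseField]; abel
    rw [e]
    exact energy_sub_self_le a (h.part j)
      ((gradLim_neumann _ a q).memL2.sub ((gradLim_neumann _ a q).memL2.mono (h.subset j)))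
      ((memL2_dirichlet _ a p).sub ((memL2_dirichlet _ a p).mono (h.subset j)))
  -- The factor 4 in the statement is a 2 from separating the Neumann and Dirichlet parts, times the
  -- 2 in `energy = 2 |U| J`.
  refine (Finset.sum_le_sum fun j _ => h3 j).trans (le_of_eq ?_)
  rw [Finset.sum_add_distrib, ← Finset.mul_sum, ← Finset.mul_sum, h1, h2]
  have e : ∑ j, volume.real (V j) * response (h.part j) a p q =
      (1 / 2) * ∑ j, volume.real (V j) * (p ⬝ᵥ (dirichletMatrix (h.part j) a *ᵥ p)) +
      (1 / 2) * ∑ j, volume.real (V j) * (q ⬝ᵥ (neumannMatrix (h.part j) a *ᵥ q)) -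
      volume.real U * (p ⬝ᵥ q) := by
    rw [← h.volume_eq, Finset.mul_sum, Finset.mul_sum, Finset.sum_mul, ← Finset.sum_add_distrib,
      ← Finset.sum_sub_distrib]
    refine Finset.sum_congr rfl fun j _ => ?_
    rw [response]
    ring
  rw [e, response]
  ring

end

/-! ### Bounds by the ellipticity constants -/

section
variable {U : Set (Vec d)} (hU : BddOpen U) (a : CoeffField d)

theorem dirichletMatrix_le {Λ : ℝ}
    (hΛ : ∀ᵐ x ∂volume.restrict U, ∀ ξ : Vec d, ξ ⬝ᵥ (a.toFun x *ᵥ ξ) ≤ Λ * (ξ ⬝ᵥ ξ)) (p : Vec d) :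
    p ⬝ᵥ (dirichletMatrix hU a *ᵥ p) ≤ Λ * (p ⬝ᵥ p) := by
  have h1 := dirichlet_le_energy hU a p gradLim_zero
  rw [add_zero] at h1
  have h2 := energy_le a hU.bdd hU.meas hΛ (memL2_const hU.bdd p)
  rw [pairing_const_const] at h2
  refine le_of_mul_le_mul_left ?_ hU.volume_pos
  linarith

/-- With `n` the Neumann field, its energy equals `∫ n·q`, is at least `l ∫|n|²`, and by
Cauchy–Schwarz has square at most `∫|n|² · |U||q|²`. One factor of the energy cancels. -/
theorem neumannMatrix_le {l : ℝ} (hl0 : 0 < l)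
    (hl : ∀ᵐ x ∂volume.restrict U, ∀ ξ : Vec d, l * (ξ ⬝ᵥ ξ) ≤ ξ ⬝ᵥ (a.toFun x *ᵥ ξ)) (q : Vec d) :
    q ⬝ᵥ (neumannMatrix hU a *ᵥ q) ≤ l⁻¹ * (q ⬝ᵥ q) := by
  have hn := gradLim_neumann hU a q
  have h1 := energy_neumann_of_gradLim hU a q hn
  rw [energy_neumann] at h1
  have h2 := le_energy a hU.bdd hU.meas hl hn.memL2
  rw [energy_neumann] at h2
  have h3 := pairing_sq_le hn.memL2 (memL2_const hU.bdd q)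
  rw [← h1, pairing_const_const] at h3
  have hv := hU.volume_pos
  set E := q ⬝ᵥ (neumannMatrix hU a *ᵥ q)
  set v := volume.real U
  have hE : 0 ≤ E := neumannMatrix_nonneg hU a q
  rw [le_inv_mul_iff₀ hl0]
  rcases hE.eq_or_lt with h0 | h0
  · rw [← h0, mul_zero]; exact dot_self_nonneg q
  have h4 := dot_self_nonneg q
  have h5 : (v * E) * (v * (l * E)) ≤ (v * E) * (v * (q ⬝ᵥ q)) := by
    have : l * (pairing U (neumann hU a q) (neumann hU a q) * (v * (q ⬝ᵥ q))) ≤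
        (v * E) * (v * (q ⬝ᵥ q)) := by
      rw [← mul_assoc]
      exact mul_le_mul_of_nonneg_right h2 (by positivity)
    nlinarith
  exact le_of_mul_le_mul_left (le_of_mul_le_mul_left h5 (by positivity)) hv

end

/-! ### Triadic cubes -/

/-- The cube of side length `3^m` with center `z`. -/
def cell (m : ℕ) (z : Fin d → ℤ) : Set (Vec d) :=
  {x | ∀ i, (z i : ℝ) - (1 / 2 : ℝ) * 3 ^ m < x i ∧ x i < (z i : ℝ) + (1 / 2 : ℝ) * 3 ^ m}

theorem cell_zero (m : ℕ) : cell m (0 : Fin d → ℤ) = cube d m := by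
  ext x; simp [cell, cube]

theorem cell_eq_pi (m : ℕ) (z : Fin d → ℤ) : cell m z =
    Set.pi Set.univ fun i => Set.Ioo ((z i : ℝ) - (1 / 2 : ℝ) * 3 ^ m)
      ((z i : ℝ) + (1 / 2 : ℝ) * 3 ^ m) := by
  ext x; simp [cell]

theorem volume_cell (m : ℕ) (z : Fin d → ℤ) : volume.real (cell m z) = ((3 : ℝ) ^ m) ^ d := by
  rw [Measure.real, cell_eq_pi, Real.volume_pi_Ioo_toReal]
  · simp; ring
  · intro i
    simp only
    have : (0 : ℝ) < 3 ^ m := by positivity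
    linarith

theorem convex_cell (m : ℕ) (z : Fin d → ℤ) : Convex ℝ (cell m z) := by
  rw [cell_eq_pi]
  exact convex_pi fun i _ => convex_Ioo _ _

theorem bddOpen_cell (m : ℕ) (z : Fin d → ℤ) : BddOpen (cell m z) where
  bdd := by
    rw [cell_eq_pi]
    exact Bornology.IsBounded.pi fun i => Metric.isBounded_Ioo _ _
  isOpen := by
    rw [cell_eq_pi]
    exact isOpen_set_pi Set.finite_univ fun i _ => isOpen_Ioo
  nonempty := ⟨fun i => z i, fun i => by
    have : (0 : ℝ) < 3 ^ m := by positivity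
    constructor <;> linarith⟩

theorem abs_sub_lt_of_mem_cell {m : ℕ} {z : Fin d → ℤ} {x y : Vec d} (hx : x ∈ cell m z)
    (hy : y ∈ cell m z) (i : Fin d) : |x i - y i| < 3 ^ m := by
  have h1 := hx i
  have h2 := hy i
  rw [abs_lt]
  constructor <;> linarith [h1.1, h1.2, h2.1, h2.2]

/-- The centers of the `3^{dk}` subcubes of side length `3^m` of `cell (m + k) z`. -/
def subcenter (m k : ℕ) (z : Fin d → ℤ) (j : Fin d → Fin (3 ^ k)) : Fin d → ℤ :=
  fun i => z i + 3 ^ m * ((j i : ℤ) - (3 ^ k - 1) / 2)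

/-- Since `3^k` is odd, the integer division is exact. All subcubes then have integer centres, as
stationarity under integer shifts demands. -/
theorem cast_half (k : ℕ) : (((3 ^ k - 1) / 2 : ℤ) : ℝ) = ((3 : ℝ) ^ k - 1) / 2 := by
  have h : Odd ((3 : ℤ) ^ k) := Odd.pow (by decide)
  obtain ⟨t, ht⟩ := h
  have e : ((3 : ℤ) ^ k - 1) / 2 = t := by omega
  have e2 : ((3 : ℝ) ^ k) = 2 * t + 1 := by exact_mod_cast ht
  rw [e, e2]
  ring

theorem cast_subcenter (m k : ℕ) (z : Fin d → ℤ) (j : Fin d → Fin (3 ^ k)) (i : Fin d) :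
    ((subcenter m k z j i : ℤ) : ℝ) = z i + 3 ^ m * (((j i : ℕ) : ℝ) - ((3 : ℝ) ^ k - 1) / 2) := by
  rw [subcenter, ← cast_half]
  push_cast
  rfl

theorem subcell_subset (m k : ℕ) (z : Fin d → ℤ) (j : Fin d → Fin (3 ^ k)) :
    cell m (subcenter m k z j) ⊆ cell (m + k) z := by
  intro x hx i
  have h := hx i
  rw [cast_subcenter] at h
  have h1 : ((j i : ℕ) : ℝ) + 1 ≤ 3 ^ k := by exact_mod_cast (j i).2
  have h2 : (0 : ℝ) ≤ ((j i : ℕ) : ℝ) := by positivity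
  have h3 : (0 : ℝ) < 3 ^ m := by positivity
  rw [pow_add]
  constructor <;> nlinarith

theorem le_dist_of_mem_subcells {m k : ℕ} {z : Fin d → ℤ} {j j' : Fin d → Fin (3 ^ k)} {i : Fin d}
    {s : ℝ} (hs : s ≤ |((j i : ℕ) : ℝ) - ((j' i : ℕ) : ℝ)|) {x y : Vec d}
    (hx : x ∈ cell m (subcenter m k z j)) (hy : y ∈ cell m (subcenter m k z j')) :
    3 ^ m * (s - 1) < |x i - y i| := by
  have h1 := hx i
  have h2 := hy i
  rw [cast_subcenter] at h1 h2
  have h3 : (0 : ℝ) < 3 ^ m := by positivity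
  rw [lt_abs]
  rcases le_abs.mp hs with h | h
  · left; nlinarith
  · right; nlinarith

theorem one_le_abs_of_ne {k : ℕ} {a b : Fin (3 ^ k)} (h : a ≠ b) :
    (1 : ℝ) ≤ |((a : ℕ) : ℝ) - ((b : ℕ) : ℝ)| := by
  have h1 : ((a : ℕ) : ℤ) - ((b : ℕ) : ℤ) ≠ 0 := by
    intro h0
    exact h (Fin.ext (by omega))
  have h2 := Int.one_le_abs h1
  exact_mod_cast h2

theorem two_le_abs_of_ne {k : ℕ} {a b : Fin (3 ^ k)} (h : a ≠ b)
    (hab : (a : ℕ) % 2 = (b : ℕ) % 2) : (2 : ℝ) ≤ |((a : ℕ) : ℝ) - ((b : ℕ) : ℝ)| := by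
  have h2 : (2 : ℤ) ≤ |((a : ℕ) : ℤ) - ((b : ℕ) : ℤ)| := by
    have : (a : ℕ) ≠ (b : ℕ) := fun h0 => h (Fin.ext h0)
    rw [le_abs]
    omega
  exact_mod_cast h2

theorem isSubdivision_cell (m k : ℕ) (z : Fin d → ℤ) :
    IsSubdivision (cell (m + k) z) fun j : Fin d → Fin (3 ^ k) => cell m (subcenter m k z j) where
  whole := bddOpen_cell _ _
  part _ := bddOpen_cell _ _
  subset := subcell_subset m k z
  disjoint := by
    intro j j' hjj
    obtain ⟨i, hi⟩ := Function.ne_iff.mp hjj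
    rw [Set.disjoint_left]
    intro x hx hx'
    have := le_dist_of_mem_subcells (one_le_abs_of_ne hi) hx hx'
    simp at this
  volume_eq := by
    simp only [volume_cell, Finset.sum_const, Finset.card_univ, Fintype.card_pi, Fintype.card_fin,
      Finset.prod_const, nsmul_eq_mul]
    push_cast
    rw [pow_add, mul_pow]
    ring

/-- Distinct indices of equal parity differ by at least 2 in some coordinate, which leaves a full
cell of width `3^m ≥ 1` between the two cells. -/
theorem one_le_dist_of_same_parity {m k : ℕ} {z : Fin d → ℤ} {j j' : Fin d → Fin (3 ^ k)}
    (hjj : j ≠ j') (hp : ∀ i, (j i : ℕ) % 2 = (j' i : ℕ) % 2) {x y : Vec d}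
    (hx : x ∈ cell m (subcenter m k z j)) (hy : y ∈ cell m (subcenter m k z j')) :
    1 ≤ dist x y := by
  obtain ⟨i, hi⟩ := Function.ne_iff.mp hjj
  have h1 := le_dist_of_mem_subcells (two_le_abs_of_ne hi (hp i)) hx hy
  have h2 := dist_le_pi_dist x y i
  rw [Real.dist_eq] at h2
  have h3 : (1 : ℝ) ≤ 3 ^ m := one_le_pow₀ (by norm_num)
  linarith

theorem subcenter_central (m : ℕ) (z : Fin d → ℤ) : subcenter m 1 z (fun _ => 1) = z := by
  ext i
  simp [subcenter]

/-! ### The Poincaré inequality on convex sets -/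

theorem sq_intervalIntegral_le {g : ℝ → ℝ} (hg : Continuous g) :
    (∫ t in (0 : ℝ)..1, g t) ^ 2 ≤ ∫ t in (0 : ℝ)..1, g t ^ 2 := by
  set c := ∫ t in (0 : ℝ)..1, g t with hc
  have h : 0 ≤ ∫ t in (0 : ℝ)..1, (g t - c) ^ 2 :=
    intervalIntegral.integral_nonneg zero_le_one fun t _ => sq_nonneg _
  have e : ∀ t, (g t - c) ^ 2 = g t ^ 2 - 2 * c * g t + c ^ 2 := fun t => by ring
  simp_rw [e] at h
  rw [intervalIntegral.integral_add
      (Continuous.intervalIntegrable (by fun_prop) _ _) (by simp),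
    intervalIntegral.integral_sub (Continuous.intervalIntegrable (by fun_prop) _ _)
      (Continuous.intervalIntegrable (by fun_prop) _ _),
    intervalIntegral.integral_const_mul, ← hc] at h
  simp at h
  nlinarith

theorem fderiv_eq_grad_dot (u : Vec d → ℝ) (x v : Vec d) : fderiv ℝ u x v = grad u x ⬝ᵥ v := by
  have h : v = ∑ i, v i • (Pi.single i 1 : Vec d) := by
    ext j; simp [Finset.sum_apply, Pi.single_apply]
  conv_lhs => rw [h]
  simp [dotProduct, grad, partialDeriv, mul_comm]

theorem continuous_grad_sq {u : Vec d → ℝ} (hu : ContDiff ℝ ∞ u) :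
    Continuous fun x => grad u x ⬝ᵥ grad u x := by
  simp only [dotProduct]
  exact continuous_finsetSum _ fun i _ =>
    (contDiff_partialDeriv hu i).continuous.mul (contDiff_partialDeriv hu i).continuous

theorem sq_sub_le_lintegral {u : Vec d → ℝ} (hu : ContDiff ℝ ∞ u) {x y : Vec d} {ℓ : ℝ}
    (hxy : ∀ i, |x i - y i| ≤ ℓ) :
    ENNReal.ofReal ((u x - u y) ^ 2) ≤ ∫⁻ t in Set.Icc (0 : ℝ) 1, ENNReal.ofReal (d * ℓ ^ 2) *
      ENNReal.ofReal (grad u (t • x + (1 - t) • y) ⬝ᵥ grad u (t • x + (1 - t) • y)) := by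
  have hG := continuous_grad_sq hu
  have hgc : ∀ i, Continuous (partialDeriv i u) := fun i => (contDiff_partialDeriv hu i).continuous
  have hg : Continuous fun t : ℝ => grad u (t • x + (1 - t) • y) ⬝ᵥ (x - y) := by
    simp only [dotProduct, grad]
    exact continuous_finsetSum _ fun i _ =>
      ((hgc i).comp (by fun_prop : Continuous fun t : ℝ => t • x + (1 - t) • y)).mul
        continuous_const
  have hderiv : ∀ t : ℝ, HasDerivAt (fun t : ℝ => u (t • x + (1 - t) • y))
      (grad u (t • x + (1 - t) • y) ⬝ᵥ (x - y)) t := by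
    intro t
    rw [← fderiv_eq_grad_dot]
    have h1 : HasDerivAt (fun t : ℝ => t • x + (1 - t) • y) (x - y) t := by
      have h2 := ((hasDerivAt_id t).smul_const x).add
        (((hasDerivAt_const t (1 : ℝ)).sub (hasDerivAt_id t)).smul_const y)
      have e : (1 : ℝ) • x + ((0 : ℝ) - 1) • y = x - y := by
        rw [one_smul, zero_sub, neg_one_smul, sub_eq_add_neg]
      rw [e] at h2
      exact h2
    exact ((hu.differentiable (by simp)) _).hasFDerivAt.comp_hasDerivAt t h1
  have hftc : u x - u y = ∫ t in (0 : ℝ)..1, grad u (t • x + (1 - t) • y) ⬝ᵥ (x - y) := by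
    rw [intervalIntegral.integral_eq_sub_of_hasDerivAt (fun t _ => hderiv t)
      (hg.intervalIntegrable _ _)]
    simp
  have hdot : (x - y) ⬝ᵥ (x - y) ≤ d * ℓ ^ 2 := by
    have : ∀ i ∈ Finset.univ, (x - y) i * (x - y) i ≤ ℓ ^ 2 := by
      intro i _
      have h1 := hxy i
      rw [Pi.sub_apply, ← sq, ← sq_abs]
      exact pow_le_pow_left₀ (abs_nonneg _) h1 2
    simpa [dotProduct] using Finset.sum_le_sum this
  have hcont2 : Continuous fun t : ℝ => (d * ℓ ^ 2) *
      (grad u (t • x + (1 - t) • y) ⬝ᵥ grad u (t • x + (1 - t) • y)) :=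
    continuous_const.mul (hG.comp (by fun_prop : Continuous fun t : ℝ => t • x + (1 - t) • y))
  have hmain : (u x - u y) ^ 2 ≤ ∫ t in (0 : ℝ)..1, (d * ℓ ^ 2) *
      (grad u (t • x + (1 - t) • y) ⬝ᵥ grad u (t • x + (1 - t) • y)) := by
    rw [hftc]
    refine (sq_intervalIntegral_le hg).trans (intervalIntegral.integral_mono_on zero_le_one
      ((hg.pow 2).intervalIntegrable _ _) (hcont2.intervalIntegrable _ _) fun t _ => ?_)
    refine (dot_sq_le _ _).trans ?_
    rw [mul_comm]
    exact mul_le_mul_of_nonneg_right hdot (dot_self_nonneg _)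
  refine (ENNReal.ofReal_le_ofReal hmain).trans (le_of_eq ?_)
  rw [intervalIntegral.integral_of_le zero_le_one, ← integral_Icc_eq_integral_Ioc,
    ofReal_integral_eq_lintegral_ofReal (hcont2.continuousOn.integrableOn_Icc)
      (ae_of_all _ fun t => mul_nonneg (by positivity) (dot_self_nonneg _))]
  refine lintegral_congr fun t => ?_
  rw [ENNReal.ofReal_mul (by positivity)]

/-- By convexity `y ↦ s y + (1-s) x` maps `U` into itself, and its inverse Jacobian `s^{-d}` is at
most `2^d` for `s ≥ 1/2`. -/
theorem lintegral_comp_affine_le {U : Set (Vec d)} (hc : Convex ℝ U) (hUm : MeasurableSet U)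
    {F : Vec d → ENNReal} (hF : Measurable F) {s : ℝ} (hs : 1 / 2 ≤ s) (hs1 : s ≤ 1) {x : Vec d}
    (hx : x ∈ U) :
    ∫⁻ y in U, F (s • y + (1 - s) • x) ≤ 2 ^ d * ∫⁻ y in U, F y := by
  have hs0 : 0 < s := by linarith
  have hG : Measurable (U.indicator F) := hF.indicator hUm
  calc ∫⁻ y in U, F (s • y + (1 - s) • x)
      ≤ ∫⁻ y in U, U.indicator F (s • y + (1 - s) • x) := by
        refine setLIntegral_mono' hUm fun y hy => ?_
        rw [Set.indicator_of_mem]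
        exact hc hy hx hs0.le (by linarith) (by ring)
    _ ≤ ∫⁻ y, U.indicator F (s • y + (1 - s) • x) := setLIntegral_le_lintegral _ _
    _ = ∫⁻ y, U.indicator F (y + (1 - s) • x) ∂(Measure.map (s • ·) volume) := by
        exact (lintegral_map (f := fun y => U.indicator F (y + (1 - s) • x))
          (hG.comp (measurable_add_const _)) (measurable_const_smul s)).symm
    _ = ENNReal.ofReal |(s ^ d)⁻¹| * ∫⁻ y in U, F y := by
        rw [Measure.map_addHaar_smul _ hs0.ne', lintegral_smul_measure,
          lintegral_add_right_eq_self (U.indicator F), lintegral_indicator hUm]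
        simp
    _ ≤ _ := by
        gcongr
        rw [abs_of_pos (by positivity), ← inv_pow, ENNReal.ofReal_pow (by positivity)]
        gcongr
        rw [show (2 : ENNReal) = ENNReal.ofReal 2 by simp]
        apply ENNReal.ofReal_le_ofReal
        rw [inv_le_comm₀ hs0 (by norm_num)]
        linarith

/-- One of `t` and `1-t` is at least `1/2`; the change of variables is made in the endpoint that
carries the larger weight. -/
theorem lintegral_lintegral_segment_le {U : Set (Vec d)} (hc : Convex ℝ U) (hUm : MeasurableSet U)
    {F : Vec d → ENNReal} (hF : Measurable F) {t : ℝ} (ht : t ∈ Set.Icc (0 : ℝ) 1) :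
    ∫⁻ y in U, ∫⁻ x in U, F (t • x + (1 - t) • y) ≤ volume U * (2 ^ d * ∫⁻ y in U, F y) := by
  have key : ∀ s : ℝ, 1 / 2 ≤ s → s ≤ 1 →
      ∫⁻ y in U, ∫⁻ x in U, F (s • x + (1 - s) • y) ≤ volume U * (2 ^ d * ∫⁻ y in U, F y) := by
    intro s h1 h2
    calc _ ≤ ∫⁻ _y in U, (2 ^ d * ∫⁻ y in U, F y) :=
          setLIntegral_mono' hUm fun y hy => lintegral_comp_affine_le hc hUm hF h1 h2 hy
      _ = _ := by simp [mul_comm]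
  rcases le_total (1 / 2) t with h | h
  · exact key t h ht.2
  · rw [lintegral_lintegral_swap (by
      refine Measurable.aemeasurable ?_
      exact hF.comp (by fun_prop))]
    have := key (1 - t) (by linarith) (by linarith [ht.1])
    simp only [sub_sub_cancel] at this
    simpa only [add_comm] using this

theorem integral_sub_mean_sq_le {U : Set (Vec d)} (hU : BddOpen U) {u : Vec d → ℝ}
    (hu : MemLp u 2 (volume.restrict U)) (c : ℝ) :
    ∫ x in U, (u x - (volume.real U)⁻¹ * ∫ y in U, u y) ^ 2 ≤ ∫ x in U, (u x - c) ^ 2 := by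
  have := isFiniteMeasure_restrict_of_isBounded hU.bdd
  have hi : Integrable u (volume.restrict U) := hu.integrable (by norm_num)
  have h2 : Integrable (fun x => u x ^ 2) (volume.restrict U) := hu.integrable_sq
  have hv := hU.volume_pos
  have key : ∀ c : ℝ, ∫ x in U, (u x - c) ^ 2 =
      (∫ x in U, u x ^ 2) - 2 * c * (∫ x in U, u x) + c ^ 2 * volume.real U := by
    intro c
    have e : ∀ x, (u x - c) ^ 2 = u x ^ 2 - 2 * c * u x + c ^ 2 := fun t => by ring
    simp_rw [e]
    rw [integral_add (f := fun x => u x ^ 2 - 2 * c * u x) (h2.sub (hi.const_mul _))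
      (integrable_const _), integral_sub h2 (hi.const_mul _), integral_const_mul]
    simp [mul_comm, Measure.real]
  rw [key, key]
  set v := volume.real U
  set I := ∫ x in U, u x
  have h3 : (c * v - I) ^ 2 * v⁻¹ ≥ 0 := by positivity
  have h4 : (c * v - I) ^ 2 * v⁻¹ = c ^ 2 * v - 2 * c * I + (v⁻¹ * I) * I := by
    field_simp
    ring
  have h5 : 2 * (v⁻¹ * I) * I - (v⁻¹ * I) ^ 2 * v = (v⁻¹ * I) * I := by
    field_simp
    ring
  linarith

theorem memLp_of_continuous_of_isBounded {U : Set (Vec d)} (hU : BddOpen U) {u : Vec d → ℝ}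
    (hu : Continuous u) : MemLp u 2 (volume.restrict U) := by
  have := isFiniteMeasure_restrict_of_isBounded hU.bdd
  obtain ⟨K, hK⟩ := hU.bdd.isCompact_closure.exists_bound_of_continuousOn hu.continuousOn
  refine MemLp.of_bound hu.aestronglyMeasurable K ?_
  filter_upwards [ae_restrict_mem hU.meas] with x hx using hK x (subset_closure hx)

theorem memL2_grad_of_contDiff {U : Set (Vec d)} (hU : BddOpen U) {u : Vec d → ℝ}
    (hu : ContDiff ℝ ∞ u) : MemL2 U (grad u) := fun i =>
  memLp_of_continuous_of_isBounded hU (contDiff_partialDeriv hu i).continuous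

/-- The mean of `u` over `U`. -/
noncomputable def mean (U : Set (Vec d)) (u : Vec d → ℝ) : ℝ := (volume.real U)⁻¹ * ∫ y in U, u y

theorem lintegral_rotate {α β γ : Type*} [MeasurableSpace α] [MeasurableSpace β]
    [MeasurableSpace γ] {μ : Measure α} {ν : Measure β} {τ : Measure γ} [SFinite μ] [SFinite ν]
    [SFinite τ] {H : α → β → γ → ENNReal}
    (hH : Measurable fun q : (α × β) × γ => H q.1.1 q.1.2 q.2) :
    ∫⁻ y, ∫⁻ x, ∫⁻ t, H y x t ∂τ ∂ν ∂μ = ∫⁻ t, ∫⁻ y, ∫⁻ x, H y x t ∂ν ∂μ ∂τ := by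
  have e1 : ∀ y, ∫⁻ x, ∫⁻ t, H y x t ∂τ ∂ν = ∫⁻ t, ∫⁻ x, H y x t ∂ν ∂τ := fun y =>
    lintegral_lintegral_swap (Measurable.aemeasurable
      (hH.comp (by fun_prop : Measurable fun q : β × γ => ((y, q.1), q.2))))
  simp_rw [e1]
  refine lintegral_lintegral_swap (Measurable.aemeasurable ?_)
  exact Measurable.lintegral_prod_right' (ν := ν)
    (f := fun q : (α × γ) × β => H q.1.1 q.2 q.1.2)
    (hH.comp (by fun_prop : Measurable fun q : (α × γ) × β => ((q.1.1, q.2), q.1.2)))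

/-- The mean is the best constant, so it may be replaced by `u(y)` and the result averaged over `y`.
Then `|u(x) - u(y)|²` is bounded by the integral of `|∇u|²` along the segment, times `dℓ²`, which
bounds `|x - y|²` for points at sup-distance at most `ℓ`. Integration over `x` and `y` costs `2^d
|U|`. -/
theorem poincare_convex {U : Set (Vec d)} (hU : BddOpen U) (hc : Convex ℝ U) {ℓ : ℝ}
    (hℓ : ∀ x ∈ U, ∀ y ∈ U, ∀ i, |x i - y i| ≤ ℓ) {u : Vec d → ℝ} (hu : ContDiff ℝ ∞ u) :
    ∫ x in U, (u x - mean U u) ^ 2 ≤ 2 ^ d * (d * ℓ ^ 2) * pairing U (grad u) (grad u) := by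
  set m := mean U u with hm
  set F : Vec d → ENNReal := fun x => ENNReal.ofReal (grad u x ⬝ᵥ grad u x) with hFdef
  have hF : Measurable F := ENNReal.measurable_ofReal.comp (continuous_grad_sq hu).measurable
  have hfin := isFiniteMeasure_restrict_of_isBounded hU.bdd
  have hLp : ∀ c : ℝ, MemLp (fun x => u x - c) 2 (volume.restrict U) := fun c =>
    memLp_of_continuous_of_isBounded hU (hu.continuous.sub continuous_const)
  have h1 : ∀ y, ENNReal.ofReal (∫ x in U, (u x - m) ^ 2) ≤
      ∫⁻ x in U, ENNReal.ofReal ((u x - u y) ^ 2) := by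
    intro y
    rw [← ofReal_integral_eq_lintegral_ofReal (hLp (u y)).integrable_sq
      (ae_of_all _ fun x => sq_nonneg _)]
    exact ENNReal.ofReal_le_ofReal (integral_sub_mean_sq_le hU
      (memLp_of_continuous_of_isBounded hU hu.continuous) (u y))
  set D := ENNReal.ofReal (d * ℓ ^ 2)
  have hmeas3 : Measurable fun q : (Vec d × Vec d) × ℝ =>
      D * F (q.2 • q.1.2 + (1 - q.2) • q.1.1) :=
    (hF.comp (by fun_prop)).const_mul D
  have h2 : volume U * ENNReal.ofReal (∫ x in U, (u x - m) ^ 2) ≤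
      ∫⁻ y in U, ∫⁻ x in U, ∫⁻ t in Set.Icc (0 : ℝ) 1, D * F (t • x + (1 - t) • y) := by
    calc _ = ∫⁻ _y in U, ENNReal.ofReal (∫ x in U, (u x - m) ^ 2) := by simp [mul_comm]
      _ ≤ ∫⁻ y in U, ∫⁻ x in U, ENNReal.ofReal ((u x - u y) ^ 2) := lintegral_mono fun y => h1 y
      _ ≤ _ := setLIntegral_mono' hU.meas fun y hy => setLIntegral_mono' hU.meas fun x hx =>
          sq_sub_le_lintegral hu (hℓ x hx y hy)
  have h3 : ∫⁻ y in U, ∫⁻ x in U, ∫⁻ t in Set.Icc (0 : ℝ) 1, D * F (t • x + (1 - t) • y) =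
      ∫⁻ t in Set.Icc (0 : ℝ) 1, ∫⁻ y in U, ∫⁻ x in U, D * F (t • x + (1 - t) • y) :=
    lintegral_rotate (H := fun y x t => D * F (t • x + (1 - t) • y)) hmeas3
  have h4 : ∫⁻ t in Set.Icc (0 : ℝ) 1, ∫⁻ y in U, ∫⁻ x in U, D * F (t • x + (1 - t) • y) ≤
      D * (volume U * (2 ^ d * ∫⁻ y in U, F y)) := by
    calc _ ≤ ∫⁻ _t in Set.Icc (0 : ℝ) 1, D * (volume U * (2 ^ d * ∫⁻ y in U, F y)) := by
          refine setLIntegral_mono' measurableSet_Icc fun t ht => ?_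
          have hm1 : ∀ y, ∫⁻ x in U, D * F (t • x + (1 - t) • y) =
              D * ∫⁻ x in U, F (t • x + (1 - t) • y) := fun y =>
            lintegral_const_mul' _ _ ENNReal.ofReal_ne_top
          simp_rw [hm1]
          rw [lintegral_const_mul' _ _ ENNReal.ofReal_ne_top]
          gcongr
          exact lintegral_lintegral_segment_le hc hU.meas hF ht
      _ = _ := by simp
  have h5 : ∫⁻ y in U, F y = ENNReal.ofReal (pairing U (grad u) (grad u)) :=
    (ofReal_integral_eq_lintegral_ofReal ((memL2_grad_of_contDiff hU hu).integrable_dot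
      (memL2_grad_of_contDiff hU hu)) (ae_of_all _ fun x => dot_self_nonneg _)).symm
  have h6 := h2.trans (h3.le.trans h4)
  have hp : 0 ≤ pairing U (grad u) (grad u) := integral_nonneg fun x => dot_self_nonneg _
  have h7 : D * (volume U * (2 ^ d * ∫⁻ y in U, F y)) =
      volume U * ENNReal.ofReal (2 ^ d * (d * ℓ ^ 2) * pairing U (grad u) (grad u)) := by
    rw [h5, ENNReal.ofReal_mul (by positivity), ENNReal.ofReal_mul (by positivity),
      ENNReal.ofReal_pow (by norm_num)]
    simp only [ENNReal.ofReal_ofNat, D]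
    ring
  rw [h7, ENNReal.mul_le_mul_iff_right (hU.isOpen.measure_pos _ hU.nonempty).ne'
    hU.bdd.measure_lt_top.ne] at h6
  exact (ENNReal.ofReal_le_ofReal_iff (by positivity)).mp h6

/-! ### Cutoff functions -/

theorem partialDeriv_comp_smul {u : Vec d → ℝ} (hu : Differentiable ℝ u) (s : ℝ) (i : Fin d)
    (x : Vec d) : partialDeriv i (fun x => u (s • x)) x = s * partialDeriv i u (s • x) := by
  have h1 : HasFDerivAt (fun x : Vec d => s • x) (s • ContinuousLinearMap.id ℝ (Vec d)) x :=
    (hasFDerivAt_id x).const_smul s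
  have h2 := (hu (s • x)).hasFDerivAt.comp x h1
  have h3 : fderiv ℝ (fun x => u (s • x)) x = _ := h2.fderiv
  rw [partialDeriv, h3]
  simp [partialDeriv]

theorem IsTestFunction.exists_bound {U : Set (Vec d)} {φ : Vec d → ℝ} (hφ : IsTestFunction U φ) :
    ∃ K, ∀ x, |φ x| ≤ K := hφ.2.1.exists_bound_of_continuous hφ.1.continuous

/-- Cutoff functions between consecutive triadic cubes. -/
theorem exists_cutoff (d : ℕ) : ∃ K : ℝ, 0 < K ∧ ∀ n : ℕ, ∃ η : Vec d → ℝ,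
    IsTestFunction (cell (n + 1) 0) η ∧ (∀ x, 0 ≤ η x) ∧ (∀ x ∈ cell n 0, η x = 1) ∧
    (∀ i x, |partialDeriv i η x| ≤ K / 3 ^ (n + 1)) ∧
    ∀ i j x, |partialDeriv j (partialDeriv i η) x| ≤ K / (3 ^ (n + 1)) ^ 2 := by
  -- Balls are cubes in the sup norm. Rescaled by `3^n`, this bump is one on `□_n`, and its support
  -- has half side `3^n`, which is less than the half side `3^{n+1}/2` of `□_{n+1}`.
  let χ : ContDiffBump (0 : Vec d) := ⟨1 / 2, 1, by norm_num, by norm_num⟩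
  have hχ : IsTestFunction (Set.univ : Set (Vec d)) χ :=
    ⟨χ.contDiff, χ.hasCompactSupport, Set.subset_univ _⟩
  choose K1 hK1 using fun i => (hχ.pderiv i).exists_bound
  choose K2 hK2 using fun i j => ((hχ.pderiv i).pderiv j).exists_bound
  obtain ⟨B, hB0, hB1, hB2⟩ : ∃ B : ℝ, 0 < B ∧ (∀ i, K1 i ≤ B) ∧ ∀ i j, K2 i j ≤ B := by
    refine ⟨1 + ∑ i, |K1 i| + ∑ i, ∑ j, |K2 i j|, by positivity, fun i => ?_, fun i j => ?_⟩
    · have h1 := Finset.single_le_sum (f := fun i => |K1 i|) (fun i _ => abs_nonneg _)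
        (Finset.mem_univ i)
      have h2 : 0 ≤ ∑ i, ∑ j, |K2 i j| := by positivity
      linarith [le_abs_self (K1 i)]
    · have h1 := Finset.single_le_sum (f := fun j => |K2 i j|) (fun j _ => abs_nonneg _)
        (Finset.mem_univ j)
      have h2 := Finset.single_le_sum (f := fun i => ∑ j, |K2 i j|)
        (fun i _ => Finset.sum_nonneg fun j _ => abs_nonneg _) (Finset.mem_univ i)
      have h3 : 0 ≤ ∑ i, |K1 i| := by positivity
      linarith [le_abs_self (K2 i j)]
  -- The natural length of the rescaled bump is `3^n`. Expressing the second derivatives through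
  -- `3^{n+1}` costs `3² = 9`.
  refine ⟨9 * B, by positivity, fun n => ?_⟩
  set s : ℝ := (3 ^ n)⁻¹ with hs
  have hs0 : 0 < s := by positivity
  have hmem : ∀ (m : ℕ) (x : Vec d), x ∈ cell m 0 ↔ ‖x‖ < 1 / 2 * 3 ^ m := by
    intro m x
    rw [pi_norm_lt_iff (by positivity)]
    simp only [cell, Set.mem_ofPred_eq, Real.norm_eq_abs, abs_lt, Pi.zero_apply, Int.cast_zero,
      zero_sub, zero_add]
  have hsm : ContDiff ℝ ∞ fun x : Vec d => χ (s • x) := χ.contDiff.comp (by fun_prop)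
  have hd1 : ∀ i, partialDeriv i (fun x : Vec d => χ (s • x)) =
      fun x => s * partialDeriv i χ (s • x) := fun i =>
    funext fun x => partialDeriv_comp_smul hχ.differentiable s i x
  have hd2 : ∀ i j x, partialDeriv j (partialDeriv i (fun x : Vec d => χ (s • x))) x =
      s * (s * partialDeriv j (partialDeriv i χ) (s • x)) := by
    intro i j x
    rw [hd1]
    have h1 : (fun x : Vec d => s * partialDeriv i χ (s • x)) =
        fun x => (s • partialDeriv i χ) (s • x) := by
      ext x; simp
    rw [h1, partialDeriv_comp_smul ((hχ.pderiv i).differentiable.const_smul s)]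
    congr 1
    exact congrFun (congrFun (grad_smul s (hχ.pderiv i).differentiable) (s • x)) j
  have hsupp : tsupport (fun x : Vec d => χ (s • x)) ⊆ Metric.closedBall 0 (3 ^ n) := by
    refine closure_minimal (fun x hx => ?_) Metric.isClosed_closedBall
    have h1 : s • x ∈ Metric.ball (0 : Vec d) 1 := by
      rw [← χ.support_eq]; exact hx
    rw [mem_ball_zero_iff, norm_smul, Real.norm_of_nonneg hs0.le, hs, inv_mul_lt_iff₀ (by positivity),
      mul_one] at h1
    rw [mem_closedBall_zero_iff]
    exact h1.le
  refine ⟨fun x => χ (s • x), ⟨hsm, ?_, fun x hx => ?_⟩, fun x => χ.nonneg, fun x hx => ?_,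
    fun i x => ?_, fun i j x => ?_⟩
  · exact (isCompact_closedBall (0 : Vec d) (3 ^ n)).of_isClosed_subset (isClosed_tsupport _) hsupp
  · have h1 := hsupp hx
    rw [mem_closedBall_zero_iff] at h1
    rw [hmem, pow_succ]
    have : (0 : ℝ) < 3 ^ n := by positivity
    linarith
  · refine χ.one_of_mem_closedBall ?_
    rw [hmem] at hx
    rw [mem_closedBall_zero_iff, norm_smul, Real.norm_of_nonneg hs0.le, hs,
      inv_mul_le_iff₀ (by positivity)]
    change _ ≤ 3 ^ n * (1 / 2 : ℝ)
    linarith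
  · rw [hd1, abs_mul, abs_of_pos hs0]
    have h1 := (hK1 i (s • x)).trans (hB1 i)
    calc s * |partialDeriv i χ (s • x)| ≤ s * B := by gcongr
      _ ≤ 9 * B / 3 ^ (n + 1) := by
        rw [hs, pow_succ]
        field_simp
        norm_num
  · rw [hd2, abs_mul, abs_mul, abs_of_pos hs0]
    have h1 := (hK2 i j (s • x)).trans (hB2 i j)
    calc s * (s * |partialDeriv j (partialDeriv i χ) (s • x)|) ≤ s * (s * B) := by gcongr
      _ ≤ 9 * B / (3 ^ (n + 1)) ^ 2 := by
        rw [hs, show (3 : ℝ) ^ (n + 1) = 3 ^ n * 3 from pow_succ _ _]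
        field_simp
        norm_num

/-! ### A quantitative div-curl estimate -/

section
variable {U V : Set (Vec d)}

theorem pairing_self_nonneg (f : Vec d → Vec d) : 0 ≤ pairing U f f :=
  integral_nonneg fun _ => dot_self_nonneg _

theorem pairing_le_young {f g : Vec d → Vec d} (hf : MemL2 U f) (hg : MemL2 U g) {t : ℝ}
    (ht : 0 < t) : 2 * |pairing U f g| ≤ t * pairing U f f + t⁻¹ * pairing U g g := by
  have h1 := pairing_sq_le hf hg
  have h2 := pairing_self_nonneg (U := U) f
  have h3 := pairing_self_nonneg (U := U) g
  have h4 : 0 ≤ t * pairing U f f + t⁻¹ * pairing U g g := by positivity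
  have h5 : (2 * pairing U f g) ^ 2 ≤ (t * pairing U f f + t⁻¹ * pairing U g g) ^ 2 := by
    have e : (t * pairing U f f) * (t⁻¹ * pairing U g g) = pairing U f f * pairing U g g := by
      field_simp
    nlinarith [sq_nonneg (t * pairing U f f - t⁻¹ * pairing U g g)]
  have := abs_le_of_sq_le_sq h5 h4
  rwa [abs_mul, abs_two] at this

theorem pairing_self_eq_sum {f : Vec d → Vec d} (hf : MemL2 U f) :
    pairing U f f = ∑ i, ∫ x in U, f x i ^ 2 := by
  simp only [pairing, dotProduct, ← sq]
  exact integral_finsetSum _ fun i _ => (hf i).integrable_sq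

theorem integral_sub_mean_sq {U : Set (Vec d)} (hU : BddOpen U) {u : Vec d → ℝ}
    (hu : MemLp u 2 (volume.restrict U)) :
    ∫ x in U, (u x - mean U u) ^ 2 = (∫ x in U, u x ^ 2) - volume.real U * mean U u ^ 2 := by
  have := isFiniteMeasure_restrict_of_isBounded hU.bdd
  have hi : Integrable u (volume.restrict U) := hu.integrable (by norm_num)
  have h2 : Integrable (fun x => u x ^ 2) (volume.restrict U) := hu.integrable_sq
  have hv := hU.volume_pos
  have e : ∀ x, (u x - mean U u) ^ 2 = u x ^ 2 - 2 * mean U u * u x + mean U u ^ 2 :=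
    fun t => by ring
  have hI : ∫ x in U, u x = volume.real U * mean U u := by
    rw [mean]; field_simp
  simp_rw [e]
  rw [integral_add (f := fun x => u x ^ 2 - 2 * mean U u * u x) (h2.sub (hi.const_mul _))
    (integrable_const _), integral_sub h2 (hi.const_mul _), integral_const_mul, hI]
  simp [Measure.real]
  ring

theorem volume_mul_mean_sq_le {U : Set (Vec d)} (hU : BddOpen U) {u : Vec d → ℝ}
    (hu : MemLp u 2 (volume.restrict U)) :
    volume.real U * mean U u ^ 2 ≤ ∫ x in U, u x ^ 2 := by
  have h1 := integral_sub_mean_sq hU hu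
  have h2 : 0 ≤ ∫ x in U, (u x - mean U u) ^ 2 := integral_nonneg fun x => sq_nonneg _
  linarith

theorem mul_memL2 (hU : BddOpen U) {η : Vec d → ℝ} (hη : Continuous η) {f : Vec d → Vec d}
    (hf : MemL2 U f) : MemL2 U fun x => η x • f x := by
  obtain ⟨K, hK⟩ := hU.bdd.isCompact_closure.exists_bound_of_continuousOn hη.continuousOn
  intro i
  refine MemLp.of_le_mul (c := K) (hf i) (hη.aestronglyMeasurable.mul (hf i).1) ?_
  filter_upwards [ae_restrict_mem hU.meas] with x hx
  simp only [Pi.smul_apply, smul_eq_mul, norm_mul]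
  exact mul_le_mul_of_nonneg_right (hK x (subset_closure hx)) (norm_nonneg _)

theorem pairing_mul_left (η : Vec d → ℝ) (f g : Vec d → Vec d) :
    pairing U (fun x => η x • f x) g = pairing U f fun x => η x • g x := by
  simp [pairing]

theorem partialDeriv_sub_const (u : Vec d → ℝ) (c : ℝ) (i : Fin d) (x : Vec d) :
    partialDeriv i (fun x => u x - c) x = partialDeriv i u x := by
  rw [partialDeriv, fderiv_sub_const, partialDeriv]

/-- The field `(u - c) ∇η`. -/
noncomputable def cutoffField (η u : Vec d → ℝ) (c : ℝ) : Vec d → Vec d :=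
  fun x => (u x - c) • grad η x

theorem grad_mul_sub {η u : Vec d → ℝ} (hη : Differentiable ℝ η) (hu : Differentiable ℝ u) (c : ℝ) :
    grad (η * fun x => u x - c) = (fun x => η x • grad u x) + cutoffField η u c := by
  ext x i
  have h := partialDeriv_mul hη (hu.sub_const c) i x
  rw [partialDeriv_sub_const] at h
  simpa [cutoffField, grad] using h

theorem contDiff_cutoffField {η u : Vec d → ℝ} (hη : ContDiff ℝ ∞ η) (hu : ContDiff ℝ ∞ u) (c : ℝ)
    (i : Fin d) : ContDiff ℝ ∞ fun x => cutoffField η u c x i :=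
  (hu.sub contDiff_const).mul (contDiff_partialDeriv hη i)

theorem memL2_cutoffField (hU : BddOpen U) {η u : Vec d → ℝ} (hη : ContDiff ℝ ∞ η)
    (hu : ContDiff ℝ ∞ u) (c : ℝ) : MemL2 U (cutoffField η u c) := fun i =>
  memLp_of_continuous_of_isBounded hU (contDiff_cutoffField hη hu c i).continuous

theorem grad_cutoffField_sq_le {η u : Vec d → ℝ} (hη : ContDiff ℝ ∞ η) (hu : ContDiff ℝ ∞ u)
    (c : ℝ) {K ℓ : ℝ} (h1 : ∀ i x, |partialDeriv i η x| ≤ K / ℓ)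
    (h2 : ∀ i j x, |partialDeriv j (partialDeriv i η) x| ≤ K / ℓ ^ 2) (i : Fin d) (x : Vec d) :
    grad (fun x => cutoffField η u c x i) x ⬝ᵥ grad (fun x => cutoffField η u c x i) x ≤
      2 * (K / ℓ) ^ 2 * (grad u x ⬝ᵥ grad u x) + 2 * d * (K / ℓ ^ 2) ^ 2 * (u x - c) ^ 2 := by
  have e : ∀ j, grad (fun x => cutoffField η u c x i) x j =
      (u x - c) * partialDeriv j (partialDeriv i η) x + partialDeriv i η x * partialDeriv j u x := by
    intro j
    have h := partialDeriv_mul ((hu.differentiable (by simp)).sub_const c)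
      ((contDiff_partialDeriv hη i).differentiable (by simp)) j x
    rw [partialDeriv_sub_const] at h
    exact h
  have hb : ∀ j ∈ Finset.univ, grad (fun x => cutoffField η u c x i) x j *
      grad (fun x => cutoffField η u c x i) x j ≤
      2 * (K / ℓ) ^ 2 * (grad u x j * grad u x j) + 2 * (K / ℓ ^ 2) ^ 2 * (u x - c) ^ 2 := by
    intro j _
    rw [e j]
    have b1 : partialDeriv i η x ^ 2 ≤ (K / ℓ) ^ 2 := by
      rw [← sq_abs]; exact pow_le_pow_left₀ (abs_nonneg _) (h1 i x) 2
    have b2 : partialDeriv j (partialDeriv i η) x ^ 2 ≤ (K / ℓ ^ 2) ^ 2 := by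
      rw [← sq_abs]; exact pow_le_pow_left₀ (abs_nonneg _) (h2 i j x) 2
    have c1 := mul_le_mul_of_nonneg_right b1 (sq_nonneg (partialDeriv j u x))
    have c2 := mul_le_mul_of_nonneg_right b2 (sq_nonneg (u x - c))
    simp only [grad]
    nlinarith [sq_nonneg ((u x - c) * partialDeriv j (partialDeriv i η) x -
      partialDeriv i η x * partialDeriv j u x)]
  have hsum := Finset.sum_le_sum hb
  simp only [dotProduct]
  refine hsum.trans (le_of_eq ?_)
  rw [Finset.sum_add_distrib, ← Finset.mul_sum]
  simp
  ring

/-- The constant in the estimates for `(u - c) ∇η`. -/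
def cutoffConst (d : ℕ) : ℝ := 2 ^ d * d * (2 * d + 2 * d ^ 2 * (2 ^ d * d)) + d * (2 ^ d * d) + 1

/-- The factor `1/ℓ` in `∇η` is compensated by the factor `ℓ` that Poincaré's inequality gives for
`u` minus its mean. -/
theorem pairing_cutoffField_le (hU : BddOpen U) (hc : Convex ℝ U) {ℓ : ℝ} (hℓ0 : 0 < ℓ)
    (hℓ : ∀ x ∈ U, ∀ y ∈ U, ∀ i, |x i - y i| ≤ ℓ)
    {η u : Vec d → ℝ} (hη : ContDiff ℝ ∞ η) (hu : ContDiff ℝ ∞ u)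
    {K : ℝ} (h1 : ∀ i x, |partialDeriv i η x| ≤ K / ℓ) :
    pairing U (cutoffField η u (mean U u)) (cutoffField η u (mean U u)) ≤
      cutoffConst d * K ^ 2 * pairing U (grad u) (grad u) := by
  have hp := poincare_convex hU hc hℓ hu
  have hI : MemLp (fun x => u x - mean U u) 2 (volume.restrict U) :=
    memLp_of_continuous_of_isBounded hU (hu.continuous.sub continuous_const)
  have hf := memL2_cutoffField hU hη hu (mean U u)
  have hg0 := pairing_self_nonneg (U := U) (grad u)
  calc _ ≤ ∫ x in U, d * (K / ℓ) ^ 2 * (u x - mean U u) ^ 2 := by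
        refine integral_mono (hf.integrable_dot hf) (hI.integrable_sq.const_mul _) fun x => ?_
        have hb : ∀ i ∈ Finset.univ, cutoffField η u (mean U u) x i *
            cutoffField η u (mean U u) x i ≤ (K / ℓ) ^ 2 * (u x - mean U u) ^ 2 := by
          intro i _
          have b1 : partialDeriv i η x ^ 2 ≤ (K / ℓ) ^ 2 := by
            rw [← sq_abs]; exact pow_le_pow_left₀ (abs_nonneg _) (h1 i x) 2
          have c2 := mul_le_mul_of_nonneg_right b1 (sq_nonneg (u x - mean U u))
          simp only [cutoffField, grad, Pi.smul_apply, smul_eq_mul]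
          nlinarith
        simpa [dotProduct, mul_assoc] using Finset.sum_le_sum hb
    _ = d * (K / ℓ) ^ 2 * ∫ x in U, (u x - mean U u) ^ 2 := integral_const_mul _ _
    _ ≤ d * (K / ℓ) ^ 2 * (2 ^ d * (d * ℓ ^ 2) * pairing U (grad u) (grad u)) := by gcongr
    _ = d * (2 ^ d * d) * K ^ 2 * pairing U (grad u) (grad u) := by field_simp
    _ ≤ _ := by
        gcongr
        have : (0 : ℝ) ≤ 2 ^ d * d * (2 * d + 2 * d ^ 2 * (2 ^ d * d)) := by positivity
        rw [cutoffConst]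
        linarith

/-- Derivatives of `(u - mean u)∇η` are of order `|∇u|/ℓ` and `|u - mean u|/ℓ²`. Poincaré's
inequality on each part of size `s`, and once more on `U`, gains the factor `(s/ℓ)²` over the size
of the field itself. -/
theorem sum_pairing_cutoffField_sub_mean_le {ι : Type*} [Fintype ι] {V : ι → Set (Vec d)}
    (h : IsSubdivision U V) (hc : Convex ℝ U) (hcV : ∀ j, Convex ℝ (V j)) {ℓ s : ℝ} (hℓ0 : 0 < ℓ)
    (hs0 : 0 < s) (hℓ : ∀ x ∈ U, ∀ y ∈ U, ∀ i, |x i - y i| ≤ ℓ)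
    (hs : ∀ j, ∀ x ∈ V j, ∀ y ∈ V j, ∀ i, |x i - y i| ≤ s)
    {η u : Vec d → ℝ} (hη : ContDiff ℝ ∞ η) (hu : ContDiff ℝ ∞ u)
    {K : ℝ} (h1 : ∀ i x, |partialDeriv i η x| ≤ K / ℓ)
    (h2 : ∀ i j x, |partialDeriv j (partialDeriv i η) x| ≤ K / ℓ ^ 2) :
    ∑ j, pairing (V j)
        (cutoffField η u (mean U u) - fun _ i => mean (V j) fun x => cutoffField η u (mean U u) x i)
        (cutoffField η u (mean U u) - fun _ i => mean (V j) fun x => cutoffField η u (mean U u) x i)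
      ≤ cutoffConst d * K ^ 2 * (s / ℓ) ^ 2 * pairing U (grad u) (grad u) := by
  have hU := h.whole
  have hp := poincare_convex hU hc hℓ hu
  set c := mean U u
  have hI : MemLp (fun x => u x - c) 2 (volume.restrict U) :=
    memLp_of_continuous_of_isBounded hU (hu.continuous.sub continuous_const)
  set f := cutoffField η u c
  have hf : ∀ i, ContDiff ℝ ∞ fun x => f x i := contDiff_cutoffField hη hu c
  have hg := memL2_grad_of_contDiff hU hu
  have hg0 := pairing_self_nonneg (U := U) (grad u)
  have hj : ∀ j, pairing (V j) (f - fun _ i => mean (V j) fun x => f x i)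
        (f - fun _ i => mean (V j) fun x => f x i) ≤
      2 ^ d * (d * s ^ 2) * ∑ i, pairing (V j) (grad fun x => f x i) (grad fun x => f x i) := by
    intro j
    have hm := (memL2_cutoffField (h.part j) hη hu c).sub
      (memL2_const (h.part j).bdd fun i => mean (V j) fun x => f x i)
    rw [pairing_self_eq_sum hm, Finset.mul_sum]
    exact Finset.sum_le_sum fun i _ => poincare_convex (h.part j) (hcV j) (hs j) (hf i)
  have hi : ∀ i, pairing U (grad fun x => f x i) (grad fun x => f x i) ≤
      2 * (K / ℓ) ^ 2 * pairing U (grad u) (grad u) +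
        2 * d * (K / ℓ ^ 2) ^ 2 * ∫ x in U, (u x - c) ^ 2 := by
    intro i
    have hm := memL2_grad_of_contDiff hU (hf i)
    have e1 := (hg.integrable_dot hg).const_mul (2 * (K / ℓ) ^ 2)
    have e2 := hI.integrable_sq.const_mul (2 * d * (K / ℓ ^ 2) ^ 2)
    rw [pairing, pairing, ← integral_const_mul, ← integral_const_mul, ← integral_add e1 e2]
    exact integral_mono (hm.integrable_dot hm) (e1.add e2)
      fun x => grad_cutoffField_sq_le hη hu c h1 h2 i x
  calc _ ≤ ∑ j, 2 ^ d * (d * s ^ 2) *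
        ∑ i, pairing (V j) (grad fun x => f x i) (grad fun x => f x i) :=
        Finset.sum_le_sum fun j _ => hj j
    _ = 2 ^ d * (d * s ^ 2) * ∑ i, pairing U (grad fun x => f x i) (grad fun x => f x i) := by
        rw [← Finset.mul_sum, Finset.sum_comm]
        congr 1
        refine Finset.sum_congr rfl fun i _ => ?_
        have hm := memL2_grad_of_contDiff hU (hf i)
        rw [h.pairing_eq hm hm]
    _ ≤ 2 ^ d * (d * s ^ 2) * ∑ _i : Fin d, (2 * (K / ℓ) ^ 2 * pairing U (grad u) (grad u) +
        2 * d * (K / ℓ ^ 2) ^ 2 * (2 ^ d * (d * ℓ ^ 2) * pairing U (grad u) (grad u))) := by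
        gcongr with i
        exact (hi i).trans (by gcongr)
    _ = 2 ^ d * d * (2 * d + 2 * d ^ 2 * (2 ^ d * d)) * K ^ 2 * (s / ℓ) ^ 2 *
        pairing U (grad u) (grad u) := by
        simp only [Finset.sum_const, Finset.card_univ, Fintype.card_fin, nsmul_eq_mul]
        field_simp
    _ ≤ _ := by
        gcongr
        have : (0 : ℝ) ≤ d * (2 ^ d * d) := by positivity
        rw [cutoffConst]
        linarith

theorem sum_volume_mul_mean_sq_le {ι : Type*} [Fintype ι] {V : ι → Set (Vec d)}
    (h : IsSubdivision U V) {f : Vec d → Vec d} (hf : MemL2 U f) :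
    ∑ j, volume.real (V j) * ((fun i => mean (V j) fun x => f x i) ⬝ᵥ
      fun i => mean (V j) fun x => f x i) ≤ pairing U f f := by
  rw [h.pairing_eq hf hf]
  refine Finset.sum_le_sum fun j _ => ?_
  have hj := hf.mono (h.subset j)
  rw [pairing_self_eq_sum hj, dotProduct, Finset.mul_sum]
  refine Finset.sum_le_sum fun i _ => ?_
  rw [← sq]
  exact volume_mul_mean_sq_le (h.part j) (hj i)

end

/-! ### The energy of the response field tested with a cutoff -/

section
variable {U : Set (Vec d)} {ι : Type*} [Fintype ι] {V : ι → Set (Vec d)}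

/-- With `w` the response field of the whole domain and `w_j` that of the part, `∫ f·a w = ∫ (f -
e)·a w + |V_j| e·(q - D_j p) - ∫ e·a(w_j - w)`, because the mean flux of `w_j` is `q - D_j p`.
Young's inequality is applied with weight `α` to the oscillation of `f` and weight `β` to the two
terms with `e`, later the mean of `f`. -/
theorem flux_pairing_part_le (h : IsSubdivision U V) (a : CoeffField d) {Λ α β : ℝ} (hα : 0 < α)
    (hβ : 0 < β)
    (hΛ : ∀ᵐ x ∂volume.restrict U, ∀ ξ : Vec d, ξ ⬝ᵥ (a.toFun x *ᵥ ξ) ≤ Λ * (ξ ⬝ᵥ ξ))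
    (p q : Vec d) {f : Vec d → Vec d} (hf : MemL2 U f) (j : ι) (e : Vec d) :
    2 * |pairing (V j) f (a.flux (responseField h.whole a p q))| ≤
      α * pairing (V j) (f - fun _ => e) (f - fun _ => e) +
      2 * β * (volume.real (V j) * (e ⬝ᵥ e)) +
      α⁻¹ * (Λ * energy a (V j) (responseField h.whole a p q) (responseField h.whole a p q)) +
      β⁻¹ * (Λ * energy a (V j) (responseField (h.part j) a p q - responseField h.whole a p q)
        (responseField (h.part j) a p q - responseField h.whole a p q) +
        volume.real (V j) * ((q - dirichletMatrix (h.part j) a *ᵥ p) ⬝ᵥ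
          (q - dirichletMatrix (h.part j) a *ᵥ p))) := by
  have hj := h.part j
  have hΛj := ae_restrict_of_ae_restrict_of_subset (h.subset j) hΛ
  set w := responseField h.whole a p q
  set wj := responseField (h.part j) a p q
  have hw : MemL2 (V j) w := (gradLim_responseField h.whole a p q).memL2.mono (h.subset j)
  have hwj : MemL2 (V j) wj := (gradLim_responseField hj a p q).memL2
  have hF := hw.flux a hj.bdd hj.meas
  have hD := (hwj.sub hw).flux a hj.bdd hj.meas
  have hfj := hf.mono (h.subset j)
  have he := memL2_const hj.bdd e
  set Q := q - dirichletMatrix (h.part j) a *ᵥ p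
  have e1 : pairing (V j) f (a.flux w) = pairing (V j) (f - fun _ => e) (a.flux w) +
      volume.real (V j) * (e ⬝ᵥ Q) - pairing (V j) (fun _ => e) (a.flux (wj - w)) := by
    have h1 := pairing_const_flux_responseField hj a e p q
    rw [pairing_sub_left hfj he hF, a.flux_sub, pairing_comm (fun _ => e) (a.flux wj - a.flux w),
      pairing_sub_left (hwj.flux a hj.bdd hj.meas) hF he, pairing_comm _ (fun _ => e), h1,
      pairing_comm (a.flux w)]
    ring
  have y1 := pairing_le_young (hfj.sub he) hF hα
  have y2 := pairing_le_young he hD hβ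
  have y3 := pairing_le_young he (memL2_const hj.bdd Q) hβ
  rw [pairing_const_const, pairing_const_const, pairing_const_const] at y3
  rw [pairing_const_const] at y2
  have f1 := flux_pairing_le a hj.bdd hj.meas hΛj hw
  have f2 := flux_pairing_le a hj.bdd hj.meas hΛj (hwj.sub hw)
  have f1' := mul_le_mul_of_nonneg_left f1 (inv_nonneg.mpr hα.le)
  have f2' := mul_le_mul_of_nonneg_left f2 (inv_nonneg.mpr hβ.le)
  have tri : |pairing (V j) f (a.flux w)| ≤ |pairing (V j) (f - fun _ => e) (a.flux w)| +
      |volume.real (V j) * (e ⬝ᵥ Q)| + |pairing (V j) (fun _ => e) (a.flux (wj - w))| := by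
    rw [e1]
    refine (abs_sub _ _).trans ?_
    gcongr
    exact abs_add_le _ _
  rw [mul_add β⁻¹]
  linarith

variable (h : IsSubdivision U V) (a : CoeffField d) (hc : Convex ℝ U) (hcV : ∀ j, Convex ℝ (V j))
  {ℓ s : ℝ} (hℓ0 : 0 < ℓ) (hs0 : 0 < s) (hℓ : ∀ x ∈ U, ∀ y ∈ U, ∀ i, |x i - y i| ≤ ℓ)
  (hs : ∀ j, ∀ x ∈ V j, ∀ y ∈ V j, ∀ i, |x i - y i| ≤ s)
  {η : Vec d → ℝ} (hη : IsTestFunction U η) {K : ℝ}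
  (h1 : ∀ i x, |partialDeriv i η x| ≤ K / ℓ)
  (h2 : ∀ i j x, |partialDeriv j (partialDeriv i η) x| ≤ K / ℓ ^ 2)

include hc hcV hℓ0 hs0 hℓ hs hη h1 h2

/-- The energy density of the response field, averaged against a cutoff function, is controlled by
the spatial averages of its flux on the parts of a subdivision. -/
theorem pairing_cutoff_responseField_le {Λ α β : ℝ} (hα : 0 < α) (hβ : 0 < β)
    (hΛ : ∀ᵐ x ∂volume.restrict U, ∀ ξ : Vec d, ξ ⬝ᵥ (a.toFun x *ᵥ ξ) ≤ Λ * (ξ ⬝ᵥ ξ))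
    (p q : Vec d) :
    2 * pairing U (responseField h.whole a p q)
        (fun x => η x • a.flux (responseField h.whole a p q) x) ≤
      (α * (cutoffConst d * K ^ 2 * (s / ℓ) ^ 2) + 2 * β * (cutoffConst d * K ^ 2)) *
        pairing U (responseField h.whole a p q) (responseField h.whole a p q) +
      α⁻¹ * (Λ * energy a U (responseField h.whole a p q) (responseField h.whole a p q)) +
      β⁻¹ * (Λ * ∑ j, energy a (V j) (responseField (h.part j) a p q - responseField h.whole a p q)
        (responseField (h.part j) a p q - responseField h.whole a p q) +
        ∑ j, volume.real (V j) * ((q - dirichletMatrix (h.part j) a *ᵥ p) ⬝ᵥ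
          (q - dirichletMatrix (h.part j) a *ᵥ p))) := by
  have hU := h.whole
  set w := responseField h.whole a p q with hwdef
  have hw := gradLim_responseField hU a p q
  rw [← hwdef] at hw
  have hF := hw.memL2.flux a hU.bdd hU.meas
  have hηc := hη.1.continuous
  set R := α⁻¹ * (Λ * energy a U w w) +
      β⁻¹ * (Λ * ∑ j, energy a (V j) (responseField (h.part j) a p q - w)
        (responseField (h.part j) a p q - w) +
        ∑ j, volume.real (V j) * ((q - dirichletMatrix (h.part j) a *ᵥ p) ⬝ᵥ
          (q - dirichletMatrix (h.part j) a *ᵥ p))) with hR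
  -- The gradient `w` is replaced by smooth gradients `∇u`, for which `(u - mean u)∇η` and
  -- Poincaré's inequality are available. The flux is kept equal to that of `w`, whose equation is
  -- exact; the limit is taken at the end.
  obtain ⟨φ, hφ, hφw⟩ := hw.approx
  have hφm : ∀ k, MemL2 U (grad (φ k)) := fun k => (hφ k).memL2_grad
  have key : ∀ k, 2 * pairing U (grad (φ k)) (fun x => η x • a.flux w x) ≤
      (α * (cutoffConst d * K ^ 2 * (s / ℓ) ^ 2) + 2 * β * (cutoffConst d * K ^ 2)) *
        pairing U (grad (φ k)) (grad (φ k)) + R := by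
    intro k
    set u := φ k
    have hu : ContDiff ℝ ∞ u := (hφ k).1
    set f := cutoffField η u (mean U u)
    have hf : MemL2 U f := memL2_cutoffField hU hη.1 hu _
    -- The flux is tested with `η(u - mean u)`, whose gradient is `η∇u + (u - mean u)∇η`.
    have horth := energy_responseField_of_gradLim hU a p q
      (hη.mul_right (hu.sub (contDiff_const (c := mean U u)))).gradLim
    rw [grad_mul_sub hη.differentiable (hφ k).differentiable] at horth
    have hηg := mul_memL2 hU hηc (hφm k)
    rw [energy, pairing_add_left hηg hf hF, pairing_mul_left] at horth
    have hT : 2 * |pairing U f (a.flux w)| ≤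
        (α * (cutoffConst d * K ^ 2 * (s / ℓ) ^ 2) + 2 * β * (cutoffConst d * K ^ 2)) *
        pairing U (grad u) (grad u) + R := by
      have s0 : 2 * |pairing U f (a.flux w)| ≤ ∑ j, 2 * |pairing (V j) f (a.flux w)| := by
        rw [h.pairing_eq hf hF, ← Finset.mul_sum]
        gcongr
        exact Finset.abs_sum_le_sum_abs _ _
      have s1 := Finset.sum_le_sum fun j (_ : j ∈ Finset.univ) =>
        flux_pairing_part_le h a hα hβ hΛ p q hf j fun i => mean (V j) fun x => f x i
      simp only [Finset.sum_add_distrib, ← Finset.mul_sum] at s1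
      rw [← h.energy_eq a hw.memL2 hw.memL2, ← hwdef] at s1
      rw [← Finset.mul_sum] at s0
      have s2 := sum_pairing_cutoffField_sub_mean_le h hc hcV hℓ0 hs0 hℓ hs hη.1 hu h1 h2
      rw [show cutoffField η u (mean U u) = f from rfl] at s2
      have s3 := (sum_volume_mul_mean_sq_le h hf).trans
        (pairing_cutoffField_le hU hc hℓ0 hℓ hη.1 hu h1)
      have s2' := mul_le_mul_of_nonneg_left s2 hα.le
      have s3' := mul_le_mul_of_nonneg_left s3 (by positivity : 0 ≤ 2 * β)
      rw [hR]
      linarith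
    have := neg_abs_le (pairing U f (a.flux w))
    linarith
  have l1 := TendstoL2.pairing hφm hw.memL2 (fun _ => mul_memL2 hU hηc hF) (mul_memL2 hU hηc hF)
    hφw (tendstoL2_const _)
  have l2 := TendstoL2.pairing hφm hw.memL2 hφm hw.memL2 hφw hφw
  have := le_of_tendsto_of_tendsto' (l1.const_mul 2) ((l2.const_mul _).add_const R) key
  linarith

end

/-! ### Decay of the response -/

section
variable (a : CoeffField d)

theorem energy_mono_cutoff {U U' : Set (Vec d)} (hU : BddOpen U) (hU' : BddOpen U') (hUU : U' ⊆ U)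
    {η : Vec d → ℝ} (hη : IsTestFunction U η) (hη0 : ∀ x, 0 ≤ η x) (hη1 : ∀ x ∈ U', η x = 1)
    {w : Vec d → Vec d} (hw : MemL2 U w) :
    energy a U' w w ≤ pairing U w fun x => η x • a.flux w x := by
  have hF := mul_memL2 hU hη.1.continuous (hw.flux a hU.bdd hU.meas)
  have e : energy a U' w w = pairing U' w fun x => η x • a.flux w x :=
    setIntegral_congr_fun hU'.meas fun x hx => by simp [hη1 x hx]
  rw [e]
  refine setIntegral_mono_set (hw.integrable_dot hF) (ae_of_all _ fun x => ?_)
    (LE.le.eventuallyLE hUU)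
  simp only [dotProduct_smul, smul_eq_mul, Pi.zero_apply]
  exact mul_nonneg (hη0 x) (a.quad_nonneg x _)

/-- The sum of the response functional over the subcubes of side length `3^m`. -/
noncomputable def sumResponse (m k : ℕ) (p q : Vec d) : ℝ :=
  ∑ j : Fin d → Fin (3 ^ k), response (bddOpen_cell m (subcenter m k 0 j)) a p q

theorem response_bound_arith {v v' J J' Y Z P E N ε A B T F G : ℝ} (hε : 0 < ε) (hE0 : 0 ≤ E)
    (htri : 2 * v' * J' ≤ 2 * Y + 2 * Z) {W : ℝ} (hY : Y ≤ W) (hZ : Z ≤ P)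
    (hP : 2 * P ≤ (A + B) * N + F + G) (hA : A * N ≤ ε / 6 * E) (hB : B * N ≤ ε / 18 * E)
    (hF : F = ε / 6 * E) (hG : G ≤ T) (hT : 0 ≤ T) (hE : E = 2 * v * J) :
    v' * J' ≤ W + ε * (v * J) + T := by
  have h1 : 0 ≤ ε * E := by positivity
  have h2 : ε * E = 2 * (ε * (v * J)) := by rw [hE]; ring
  nlinarith

/-- On the central subcube `□_{m+k}` the response field is compared with that of `□_{m+k+1}`, which
costs the defect of additivity over one scale. The energy of the latter on the central subcube is
bounded through a cutoff by the average fluxes on the cells of side `3^m`. A small multiple `ε` of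
the full response is left over, to be absorbed later. -/
theorem exists_response_le (d : ℕ) : ∃ C : ℝ, 0 < C ∧ ∀ (a : CoeffField d) (m k : ℕ) (l Λ ε : ℝ),
    0 < l → l ≤ Λ → 0 < ε → ε ≤ 1 →
    (∀ᵐ x ∂volume.restrict (cell (m + (k + 1)) (0 : Fin d → ℤ)), ∀ ξ : Vec d,
      l * (ξ ⬝ᵥ ξ) ≤ ξ ⬝ᵥ (a.toFun x *ᵥ ξ) ∧ ξ ⬝ᵥ (a.toFun x *ᵥ ξ) ≤ Λ * (ξ ⬝ᵥ ξ)) →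
    C * (Λ / l) ≤ ε ^ 2 * 9 ^ (k + 1) →
    ∀ p q : Vec d,
      (3 ^ (m + k)) ^ d * response (bddOpen_cell (m + k) 0) a p q ≤
      4 * ((3 ^ (m + k)) ^ d * sumResponse a (m + k) 1 p q -
        (3 ^ (m + (k + 1))) ^ d * response (bddOpen_cell (m + (k + 1)) 0) a p q) +
      ε * ((3 ^ (m + (k + 1))) ^ d * response (bddOpen_cell (m + (k + 1)) 0) a p q) +
      C / (ε * l) * (Λ * ((3 ^ m) ^ d * sumResponse a m (k + 1) p q -
        (3 ^ (m + (k + 1))) ^ d * response (bddOpen_cell (m + (k + 1)) 0) a p q) +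
        (3 ^ m) ^ d * ∑ j : Fin d → Fin (3 ^ (k + 1)),
          (q - dirichletMatrix (bddOpen_cell m (subcenter m (k + 1) 0 j)) a *ᵥ p) ⬝ᵥ
          (q - dirichletMatrix (bddOpen_cell m (subcenter m (k + 1) 0 j)) a *ᵥ p)) := by
  obtain ⟨K, hK0, hcut⟩ := exists_cutoff d
  have hCd : 0 < cutoffConst d := by rw [cutoffConst]; positivity
  set C0 := cutoffConst d * K ^ 2 with hC0
  have hC00 : 0 < C0 := by positivity
  -- Here `36 C0/(εl)` is `β⁻¹` for the weight `β` below, and 4 is the factor of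
  -- `sum_energy_responseField_sub_le`.
  refine ⟨36 * C0 * 4, by positivity, ?_⟩
  intro a m k l Λ ε hl hlΛ hε hε1 hell hsmall p q
  have hΛ0 : 0 < Λ := hl.trans_le hlΛ
  set n := m + (k + 1) with hn
  have hsub : IsSubdivision (cell n (0 : Fin d → ℤ)) fun j : Fin d → Fin (3 ^ (k + 1)) =>
    cell m (subcenter m (k + 1) 0 j) := isSubdivision_cell m (k + 1) 0
  have hsub1 : IsSubdivision (cell n (0 : Fin d → ℤ)) fun j : Fin d → Fin (3 ^ 1) =>
    cell (m + k) (subcenter (m + k) 1 0 j) := isSubdivision_cell (m + k) 1 0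
  obtain ⟨η, hη, hη0, hη1, hd1, hd2⟩ := hcut (m + k)
  have hU : BddOpen (cell n (0 : Fin d → ℤ)) := hsub.whole
  set w := responseField hU a p q
  have hw : MemL2 (cell n 0) w := (gradLim_responseField hU a p q).memL2
  -- This makes `α⁻¹ΛE` equal to `εE/6`, with `E` the full energy. The term with `α` carries the
  -- gain `9^{-(k+1)}`, and the smallness hypothesis bounds it by `εE/6` too. The weight `β` is
  -- chosen so that its term is at most `εE/18`; the lower ellipticity bound `l` enters because
  -- `∫|w|² ≤ E/l`.
  set α := Λ * (6 / ε)
  have hα : 0 < α := by positivity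
  set β := ε * l / (36 * C0)
  have hβ : 0 < β := by positivity
  have hmain := pairing_cutoff_responseField_le hsub a (convex_cell n 0) (fun j => convex_cell m _)
    (ℓ := 3 ^ n) (s := 3 ^ m) (by positivity) (by positivity)
    (fun x hx y hy i => (abs_sub_lt_of_mem_cell hx hy i).le)
    (fun j x hx y hy i => (abs_sub_lt_of_mem_cell hx hy i).le) hη hd1 hd2 hα hβ
    (hell.mono fun x hx ξ => (hx ξ).2) p q
  rw [← hC0] at hmain
  have hD := sum_energy_responseField_sub_le hsub a p q
  have hN := le_energy a hU.bdd hU.meas (hell.mono fun x hx ξ => (hx ξ).1) hw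
  have hE := energy_responseField hU a p q
  simp only [volume_cell] at hmain hD hE
  rw [← Finset.mul_sum] at hmain hD
  change _ ≤ 4 * ((3 ^ m) ^ d * sumResponse a m (k + 1) p q - _) at hD
  have hcutoff := energy_mono_cutoff a hU (bddOpen_cell (m + k) 0)
    (by have := hsub1.subset fun _ => 1
        rwa [subcenter_central] at this) hη hη0 hη1 hw
  -- the central subcube
  have hD1 := sum_energy_responseField_sub_le hsub1 a p q
  have hcentral : energy a (cell (m + k) 0)
      (responseField (bddOpen_cell (m + k) 0) a p q - w)
      (responseField (bddOpen_cell (m + k) 0) a p q - w) ≤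
      4 * ((3 ^ (m + k)) ^ d * sumResponse a (m + k) 1 p q -
        (3 ^ n) ^ d * response hU a p q) := by
    have h3 := Finset.single_le_sum (f := fun j => energy a (cell (m + k) (subcenter (m + k) 1 0 j))
        (responseField (hsub1.part j) a p q - responseField hsub1.whole a p q)
        (responseField (hsub1.part j) a p q - responseField hsub1.whole a p q))
      (fun j _ => energy_self_nonneg _ _) (Finset.mem_univ fun _ => 1)
    simp only [volume_cell] at hD1
    rw [← Finset.mul_sum] at hD1
    have h4 := h3.trans hD1
    simp only [subcenter_central] at h4
    exact h4
  have hJ' := energy_responseField (bddOpen_cell (m + k) (0 : Fin d → ℤ)) a p q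
  have hw' : MemL2 (cell (m + k) 0) w := hw.mono (by
    have := hsub1.subset fun _ => 1
    rwa [subcenter_central] at this)
  have hwc := (gradLim_responseField (bddOpen_cell (m + k) (0 : Fin d → ℤ)) a p q).memL2
  have htri := energy_add_self_le a (bddOpen_cell (m + k) (0 : Fin d → ℤ)) (hwc.sub hw') hw'
  rw [sub_add_cancel, hJ', volume_cell] at htri
  set E := energy a (cell n 0) w w
  set N := pairing (cell n 0) w w
  set S := (3 ^ m : ℝ) ^ d * ∑ j : Fin d → Fin (3 ^ (k + 1)),
          (q - dirichletMatrix (bddOpen_cell m (subcenter m (k + 1) 0 j)) a *ᵥ p) ⬝ᵥ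
          (q - dirichletMatrix (bddOpen_cell m (subcenter m (k + 1) 0 j)) a *ᵥ p) with hS
  set Df := (3 ^ m : ℝ) ^ d * sumResponse a m (k + 1) p q -
        (3 ^ n) ^ d * response hU a p q
  have hNl : N ≤ E / l := by rw [le_div_iff₀ hl, mul_comm]; exact hN
  have hE0 : 0 ≤ E := energy_self_nonneg _ _
  have hN0 : 0 ≤ N := pairing_self_nonneg _
  have t1 : α * (C0 * ((3 : ℝ) ^ m / 3 ^ n) ^ 2) * N ≤ ε / 6 * E := by
    have e9 : ((3 : ℝ) ^ m / 3 ^ n) ^ 2 = (9 ^ (k + 1))⁻¹ := by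
      rw [hn, pow_add 3 m (k + 1), div_mul_cancel_left₀ (by positivity), inv_pow, ← pow_mul,
        mul_comm (k + 1) 2, pow_mul]
      norm_num
    rw [e9]
    calc α * (C0 * (9 ^ (k + 1))⁻¹) * N ≤ α * (C0 * (9 ^ (k + 1))⁻¹) * (E / l) := by gcongr
      _ = (36 * C0 * (Λ / l)) * (9 ^ (k + 1))⁻¹ * (E / (6 * ε)) := by
          simp only [α]; field_simp; ring
      _ ≤ (ε ^ 2 * 9 ^ (k + 1)) * (9 ^ (k + 1))⁻¹ * (E / (6 * ε)) := by
          have h0 : 36 * C0 * (Λ / l) ≤ ε ^ 2 * 9 ^ (k + 1) := by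
            refine le_trans ?_ hsmall
            have : 0 ≤ C0 * (Λ / l) := by positivity
            nlinarith
          gcongr ?_ * _ * _
      _ = ε / 6 * E := by field_simp
  have t2 : 2 * β * C0 * N ≤ ε / 18 * E := by
    calc 2 * β * C0 * N ≤ 2 * β * C0 * (E / l) := by gcongr
      _ = ε / 18 * E := by simp only [β]; field_simp; ring
  have t3 : α⁻¹ * (Λ * E) = ε / 6 * E := by simp only [α]; field_simp
  have t4 : β⁻¹ * (Λ * ∑ j, energy a (cell m (subcenter m (k + 1) 0 j))
        (responseField (hsub.part j) a p q - w) (responseField (hsub.part j) a p q - w) + S) ≤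
      36 * C0 / (ε * l) * (4 * (Λ * Df + S)) := by
    have hS0 : 0 ≤ S := mul_nonneg (by positivity)
      (Finset.sum_nonneg fun j _ => dot_self_nonneg _)
    have eβ : β⁻¹ = 36 * C0 / (ε * l) := by simp only [β]; rw [inv_div]
    rw [eβ]
    gcongr
    have := mul_le_mul_of_nonneg_left hD hΛ0.le
    linarith
  have t5 : 36 * C0 * 4 / (ε * l) * (Λ * Df + S) = 36 * C0 / (ε * l) * (4 * (Λ * Df + S)) := by
    ring
  rw [t5]
  have hS0 : 0 ≤ S := mul_nonneg (by positivity) (Finset.sum_nonneg fun j _ => dot_self_nonneg _)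
  have hsum0 : 0 ≤ ∑ j, energy a (cell m (subcenter m (k + 1) 0 j))
        (responseField (hsub.part j) a p q - w) (responseField (hsub.part j) a p q - w) :=
      Finset.sum_nonneg fun j _ => energy_self_nonneg _ _
  have hpos : 0 ≤ 36 * C0 / (ε * l) * (4 * (Λ * Df + S)) := le_trans
    (mul_nonneg (inv_nonneg.mpr hβ.le) (add_nonneg (mul_nonneg hΛ0.le hsum0) hS0)) t4
  exact response_bound_arith hε hE0 htri hcentral hcutoff hmain t1 t2 t3 t4 hpos hE

end

/-! ### Measurability of the coarse-grained matrices -/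

theorem sigmaField_mono {U V : Set (Vec d)} (h : U ⊆ V) : sigmaField U ≤ sigmaField V :=
  iSup_mono fun _ => iSup_mono fun _ => iSup_mono fun _ =>
    iSup_le fun hφ => le_iSup_of_le (hφ.mono h) le_rfl

theorem measurable_integral_test {U : Set (Vec d)} {φ : Vec d → ℝ} (hφ : IsTestFunction U φ)
    (i j : Fin d) : Measurable[sigmaField U] fun a : CoeffField d => ∫ x, a.toFun x i j * φ x := by
  rw [measurable_iff_comap_le]
  exact le_iSup_of_le i (le_iSup_of_le j (le_iSup_of_le φ (le_iSup_of_le hφ le_rfl)))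

/-- For a smooth `f ≥ 0` that is nonzero exactly on `U`, the smooth transition of `k f - 1` vanishes
where `k f ≤ 1` and equals one where `k f ≥ 2`. -/
theorem exists_testFunction_tendsto_one {U : Set (Vec d)} (hU : BddOpen U) :
    ∃ χ : ℕ → Vec d → ℝ, (∀ k, IsTestFunction U (χ k)) ∧ (∀ k x, |χ k x| ≤ 1) ∧
      ∀ x ∈ U, Tendsto (fun k => χ k x) atTop (𝓝 1) := by
  obtain ⟨f, hf, hfs, hfr⟩ := hU.isOpen.exists_contDiff_support_eq (n := ⊤)
  have hts : ∀ k : ℕ, tsupport (fun x => Real.smoothTransition (k * f x - 1)) ⊆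
      {x | 1 ≤ k * f x} := by
    intro k
    refine closure_minimal (fun x hx => ?_)
      (isClosed_le continuous_const (continuous_const.mul hfs.continuous))
    by_contra h
    simp only [Set.mem_ofPred_eq, not_le] at h
    exact hx (Real.smoothTransition.zero_of_nonpos (by linarith))
  have hsub : ∀ k : ℕ, {x | 1 ≤ k * f x} ⊆ U := by
    intro k x hx
    rw [← hf, Function.mem_support]
    intro h0
    simp [h0] at hx
    linarith
  refine ⟨fun k x => Real.smoothTransition (k * f x - 1), fun k => ⟨?_, ?_, (hts k).trans (hsub k)⟩,
    fun k x => ?_, fun x hx => ?_⟩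
  · exact Real.smoothTransition.contDiff.comp ((contDiff_const.mul hfs).sub contDiff_const)
  · refine Metric.isCompact_of_isClosed_isBounded (isClosed_tsupport _)
      (hU.bdd.subset ((hts k).trans (hsub k)))
  · rw [abs_of_nonneg (Real.smoothTransition.nonneg _)]
    exact Real.smoothTransition.le_one _
  · have h0 : f x ≠ 0 := by rwa [← hf] at hx
    have h1 : 0 < f x := lt_of_le_of_ne (hfr ⟨x, rfl⟩).1 h0.symm
    refine tendsto_const_nhds.congr' ?_
    filter_upwards [eventually_ge_atTop ⌈2 / f x⌉₊] with k hk
    refine (Real.smoothTransition.one_of_one_le ?_).symm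
    have h2 := (Nat.le_ceil _).trans (Nat.cast_le (α := ℝ).mpr hk)
    rw [div_le_iff₀ h1] at h2
    linarith

/-- The generators of `F_U` only involve test functions supported in `U`. Integrals over all of `U`
are limits of these by dominated convergence, hence `F_U`-measurable; the mixing condition needs
this and not only `F`-measurability. -/
theorem measurable_setIntegral_mul {U : Set (Vec d)} (hU : BddOpen U) {ψ : Vec d → ℝ}
    (hψ : ContDiff ℝ ∞ ψ) (i j : Fin d) :
    Measurable[sigmaField U] fun a : CoeffField d => ∫ x in U, a.toFun x i j * ψ x := by
  obtain ⟨χ, hχ, hχ1, hχlim⟩ := exists_testFunction_tendsto_one hU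
  refine @measurable_of_tendsto_metrizable _ _ (sigmaField U) _ _ _ _
    (fun k a => ∫ x, a.toFun x i j * (χ k * ψ) x) _
    (fun k => measurable_integral_test ((hχ k).mul_right hψ) i j) ?_
  refine tendsto_pi_nhds.mpr fun a => ?_
  have h1 : ∀ k, ∫ x, a.toFun x i j * (χ k * ψ) x = ∫ x in U, a.toFun x i j * (χ k * ψ) x := by
    intro k
    refine (setIntegral_eq_integral_of_forall_compl_eq_zero fun x hx => ?_).symm
    simp [(hχ k).eq_zero_of_notMem hx]
  simp_rw [h1]
  have := isFiniteMeasure_restrict_of_isBounded hU.bdd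
  obtain ⟨K, hK0, hK⟩ := a.exists_entry_bound hU.bdd
  obtain ⟨B, hB⟩ := hU.bdd.isCompact_closure.exists_bound_of_continuousOn
    hψ.continuous.continuousOn
  refine tendsto_integral_of_dominated_convergence (fun _ => K * B) (fun k => ?_)
    (integrable_const _) (fun k => ?_) ?_
  · exact ((a.measurable_entry i j).mul
      ((hχ k).1.continuous.measurable.mul hψ.continuous.measurable)).aestronglyMeasurable
  · filter_upwards [ae_restrict_mem hU.meas] with x hx
    rw [norm_mul, Pi.mul_apply, norm_mul]
    have h2 := hB x (subset_closure hx)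
    have h3 : ‖χ k x‖ * ‖ψ x‖ ≤ 1 * B := mul_le_mul (hχ1 k x) h2 (norm_nonneg _) zero_le_one
    rw [one_mul] at h3
    exact mul_le_mul (hK x hx i j) h3 (by positivity) hK0.le
  · filter_upwards [ae_restrict_mem hU.meas] with x hx
    have := ((hχlim x hx).mul_const (ψ x)).const_mul (a.toFun x i j)
    simpa using this

theorem measurable_energy {U : Set (Vec d)} (hU : BddOpen U) {F : Vec d → Vec d}
    (hF : ∀ i, ContDiff ℝ ∞ fun x => F x i) :
    Measurable[sigmaField U] fun a : CoeffField d => energy a U F F := by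
  have hm : MemL2 U F := fun i => memLp_of_continuous_of_isBounded hU (hF i).continuous
  have e : ∀ a : CoeffField d, energy a U F F =
      ∑ i, ∑ j, ∫ x in U, a.toFun x i j * (F x i * F x j) := by
    intro a
    have hint : ∀ i j, Integrable (fun x => a.toFun x i j * (F x i * F x j))
        (volume.restrict U) := by
      intro i j
      obtain ⟨K, hK0, hK⟩ := a.exists_entry_bound hU.bdd
      refine Integrable.bdd_mul (c := K) ((hm i).integrable_mul (hm j))
        (a.measurable_entry i j).aestronglyMeasurable ?_
      filter_upwards [ae_restrict_mem hU.meas] with x hx using hK x hx i j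
    simp_rw [← integral_finsetSum _ fun j _ => hint _ j]
    rw [← integral_finsetSum _ fun i _ => integrable_finsetSum _ fun j _ => hint i j]
    refine integral_congr_ae (ae_of_all _ fun x => ?_)
    simp only [dotProduct, CoeffField.flux, Matrix.mulVec, Finset.mul_sum]
    exact Finset.sum_congr rfl fun i _ => Finset.sum_congr rfl fun j _ => by ring
  simp_rw [e]
  exact Finset.measurable_sum _ fun i _ => Finset.measurable_sum _ fun j _ =>
    measurable_setIntegral_mul hU ((hF i).mul (hF j)) i j

/-- A countable family of test functions whose gradients approximate all gradients. -/
theorem exists_countable_test (U W : Set (Vec d)) :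
    ∃ φ : ℕ → Vec d → ℝ, (∀ k, IsTestFunction W (φ k)) ∧ ∀ ψ, IsTestFunction W ψ →
      ∃ n : ℕ → ℕ, TendstoL2 U (fun k => grad (φ (n k))) (grad ψ) := by
  let X := {φ : Vec d → ℝ // IsTestFunction W φ}
  let Φ : X → Fin d → Lp ℝ 2 (volume.restrict U) :=
    fun φ i => (φ.2.memL2_grad (V := U) i).toLp
  -- Test functions carry the topology induced by the `L²(U)` classes of their gradients. It
  -- inherits second countability, hence separability.
  let _ : TopologicalSpace X := TopologicalSpace.induced Φ inferInstance
  have _ : Fact ((2 : ENNReal) ≠ ⊤) := ⟨ENNReal.ofNat_ne_top⟩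
  have _ : SecondCountableTopology (Lp ℝ 2 (volume.restrict U)) := Lp.SecondCountableTopology
  have _ : SecondCountableTopology X := TopologicalSpace.secondCountableTopology_induced X _ Φ
  have _ : Nonempty X := ⟨⟨0, isTestFunction_zero⟩⟩
  refine ⟨fun k => (TopologicalSpace.denseSeq X k).1, fun k => (TopologicalSpace.denseSeq X k).2,
    fun ψ hψ => ?_⟩
  have h1 : (⟨ψ, hψ⟩ : X) ∈ closure (Set.range (TopologicalSpace.denseSeq X)) :=
    TopologicalSpace.denseRange_denseSeq X _
  obtain ⟨s, hs, hlim⟩ := mem_closure_iff_seq_limit.mp h1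
  choose n hn using hs
  refine ⟨n, fun i => ?_⟩
  have h2 : Tendsto (fun k => Φ (s k) i) atTop (𝓝 (Φ ⟨ψ, hψ⟩ i)) :=
    (((continuous_apply i).comp continuous_induced_dom).tendsto _).comp hlim
  simp only [Φ] at h2
  rw [Lp.tendsto_Lp_iff_tendsto_eLpNorm''] at h2
  refine h2.congr fun k => ?_
  rw [← eLpNorm_neg]
  congr 1
  ext x
  simp [hn k]

/-- The form is an infimum over test functions, and by density countably many suffice. Each strict
sublevel set is then a countable union of `F_U`-measurable sets. -/
theorem measurable_quad_dirichlet {U : Set (Vec d)} (hU : BddOpen U) (p : Vec d) :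
    Measurable[sigmaField U] fun a => p ⬝ᵥ (dirichletMatrix hU a *ᵥ p) := by
  obtain ⟨φ, hφ, hφd⟩ := exists_countable_test U U
  have hp := memL2_const hU.bdd p
  have hm : ∀ k, MemL2 U ((fun _ => p) + grad (φ k)) := fun k => hp.add (hφ k).memL2_grad
  have hmeas : ∀ k, Measurable[sigmaField U] fun a =>
      energy a U ((fun _ => p) + grad (φ k)) ((fun _ => p) + grad (φ k)) := fun k =>
    measurable_energy hU fun i => contDiff_const.add (contDiff_partialDeriv (hφ k).1 i)
  have hv := hU.volume_pos
  refine @measurable_of_Iio _ _ _ _ _ (sigmaField U) _ _ _ _ fun c => ?_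
  have e : (fun a => p ⬝ᵥ (dirichletMatrix hU a *ᵥ p)) ⁻¹' Set.Iio c = ⋃ k, (fun a =>
      energy a U ((fun _ => p) + grad (φ k)) ((fun _ => p) + grad (φ k))) ⁻¹'
        Set.Iio (volume.real U * c) := by
    ext a
    simp only [Set.mem_preimage, Set.mem_Iio, Set.mem_iUnion]
    constructor
    · intro ha
      obtain ⟨ψ, hψ, h1⟩ := exists_energy_dirichlet_lt hU a p
        (ε := volume.real U * (c - p ⬝ᵥ (dirichletMatrix hU a *ᵥ p)))
        (mul_pos hv (by linarith))
      obtain ⟨n, hn⟩ := hφd ψ hψ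
      have hψm : MemL2 U ((fun _ => p) + grad ψ) := hp.add hψ.memL2_grad
      have hn' : TendstoL2 U (fun k => (fun _ => p) + grad (φ (n k))) ((fun _ => p) + grad ψ) :=
        TendstoL2.add (fun _ => hp) hp (fun k => (hφ (n k)).memL2_grad) hψ.memL2_grad
          (tendstoL2_const _) hn
      have h2 := TendstoL2.pairing (fun k => hm (n k)) hψm
        (fun k => (hm (n k)).flux a hU.bdd hU.meas) (hψm.flux a hU.bdd hU.meas) hn'
        (TendstoL2.flux a hU.bdd hU.meas (fun k => hm (n k)) hψm hn')
      have h3 : pairing U ((fun _ => p) + grad ψ) (a.flux ((fun _ => p) + grad ψ)) <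
          volume.real U * c := by
        rw [energy] at h1
        linarith
      obtain ⟨k, hk⟩ := (h2.eventually (gt_mem_nhds h3)).exists
      exact ⟨n k, hk⟩
    · rintro ⟨k, hk⟩
      exact lt_of_mul_lt_mul_left ((dirichlet_le_energy hU a p (hφ k).gradLim).trans_lt hk) hv.le
  rw [e]
  exact MeasurableSet.iUnion fun k => hmeas k measurableSet_Iio

theorem measurable_quad_neumann {U : Set (Vec d)} (hU : BddOpen U) (q : Vec d) :
    Measurable[sigmaField U] fun a => q ⬝ᵥ (neumannMatrix hU a *ᵥ q) := by
  obtain ⟨φ, hφ, hφd⟩ := exists_countable_test U Set.univ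
  have hq := memL2_const hU.bdd q
  have hm : ∀ k, MemL2 U (grad (φ k)) := fun k => (hφ k).memL2_grad
  have hmeas : ∀ k, Measurable[sigmaField U] fun a =>
      2 * pairing U (grad (φ k)) (fun _ => q) - energy a U (grad (φ k)) (grad (φ k)) := fun k =>
    measurable_const.sub (measurable_energy hU fun i => contDiff_partialDeriv (hφ k).1 i)
  have hv := hU.volume_pos
  refine @measurable_of_Ioi _ _ _ _ _ (sigmaField U) _ _ _ _ fun c => ?_
  have e : (fun a => q ⬝ᵥ (neumannMatrix hU a *ᵥ q)) ⁻¹' Set.Ioi c = ⋃ k, (fun a =>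
      2 * pairing U (grad (φ k)) (fun _ => q) - energy a U (grad (φ k)) (grad (φ k))) ⁻¹'
        Set.Ioi (volume.real U * c) := by
    ext a
    simp only [Set.mem_preimage, Set.mem_Ioi, Set.mem_iUnion]
    constructor
    · intro ha
      obtain ⟨ψ, hψ, h1⟩ := exists_lt_neumann hU a q
        (ε := volume.real U * (q ⬝ᵥ (neumannMatrix hU a *ᵥ q) - c))
        (mul_pos hv (by linarith))
      obtain ⟨n, hn⟩ := hφd ψ hψ
      have hψm : MemL2 U (grad ψ) := hψ.memL2_grad
      have h2 := TendstoL2.pairing (fun k => hm (n k)) hψm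
        (fun k => (hm (n k)).flux a hU.bdd hU.meas) (hψm.flux a hU.bdd hU.meas) hn
        (TendstoL2.flux a hU.bdd hU.meas (fun k => hm (n k)) hψm hn)
      have h4 := TendstoL2.pairing (fun k => hm (n k)) hψm (fun _ => hq) hq hn (tendstoL2_const _)
      have h3 : volume.real U * c <
          2 * pairing U (grad ψ) (fun _ => q) - pairing U (grad ψ) (a.flux (grad ψ)) := by
        rw [energy] at h1
        linarith
      obtain ⟨k, hk⟩ := (((h4.const_mul 2).sub h2).eventually (lt_mem_nhds h3)).exists
      exact ⟨n k, hk⟩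
    · rintro ⟨k, hk⟩
      exact lt_of_mul_lt_mul_left (hk.trans_le (le_neumann hU a q (hφ k).gradLim)) hv.le
  rw [e]
  exact MeasurableSet.iUnion fun k => hmeas k measurableSet_Ioi

theorem entry_eq_polarization {A : Mat d} (hA : A.IsSymm) (i j : Fin d) :
    A i j = (1 / 2 : ℝ) * ((Pi.single i 1 + Pi.single j 1) ⬝ᵥ (A *ᵥ (Pi.single i 1 + Pi.single j 1))
      - Pi.single i 1 ⬝ᵥ (A *ᵥ Pi.single i 1) - Pi.single j 1 ⬝ᵥ (A *ᵥ Pi.single j 1)) := by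
  have hij : A j i = A i j := hA.apply i j
  simp only [Matrix.mulVec_add, add_dotProduct, dotProduct_add,
    Matrix.mulVec_single_one, single_one_dotProduct, Matrix.col_apply, hij]
  ring

theorem isSymm_ext {A B : Mat d} (hA : A.IsSymm) (hB : B.IsSymm)
    (h : ∀ p, p ⬝ᵥ (A *ᵥ p) = p ⬝ᵥ (B *ᵥ p)) : A = B := by
  ext i j
  rw [entry_eq_polarization hA, entry_eq_polarization hB, h, h, h]

theorem measurable_dirichletMatrix {U : Set (Vec d)} (hU : BddOpen U) (i j : Fin d) :
    Measurable[sigmaField U] fun a => dirichletMatrix hU a i j := by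
  simp_rw [fun a => entry_eq_polarization (dirichletMatrix_isSymm hU a) i j]
  exact (((measurable_quad_dirichlet hU _).sub (measurable_quad_dirichlet hU _)).sub
    (measurable_quad_dirichlet hU _)).const_mul _

theorem measurable_neumannMatrix {U : Set (Vec d)} (hU : BddOpen U) (i j : Fin d) :
    Measurable[sigmaField U] fun a => neumannMatrix hU a i j := by
  simp_rw [fun a => entry_eq_polarization (neumannMatrix_isSymm hU a) i j]
  exact (((measurable_quad_neumann hU _).sub (measurable_quad_neumann hU _)).sub
    (measurable_quad_neumann hU _)).const_mul _

/-! ### Translations -/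

theorem shift_neg_shift (z : Vec d) (a : CoeffField d) : shift (-z) (shift z a) = a := by
  simp [shift]

theorem shift_shift_neg (z : Vec d) (a : CoeffField d) : shift z (shift (-z) a) = a := by
  simp [shift]

section
variable {U U' : Set (Vec d)} {z : Vec d} (hz : ∀ x, x + z ∈ U' ↔ x ∈ U)
include hz

theorem setIntegral_translate (g : Vec d → ℝ) : ∫ x in U, g (x + z) = ∫ x in U', g x := by
  have h := (measurePreserving_add_right (volume : Measure (Vec d)) z).setIntegral_preimage_emb
    (MeasurableEquiv.addRight z).measurableEmbedding g U'
  have e : (fun x => x + z) ⁻¹' U' = U := by ext x; exact hz x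
  rw [← e]
  exact h

theorem IsTestFunction.translate {φ : Vec d → ℝ} (hφ : IsTestFunction U' φ) :
    IsTestFunction U fun x => φ (x + z) := by
  refine ⟨hφ.1.comp (by fun_prop), hφ.2.1.comp_homeomorph (Homeomorph.addRight z), fun x hx => ?_⟩
  have h1 : x + z ∈ tsupport φ := by
    have := tsupport_comp_subset_preimage φ (f := fun x => x + z) (by fun_prop)
    exact this hx
  exact (hz x).mp (hφ.2.2 h1)

omit hz in
theorem grad_translate (φ : Vec d → ℝ) (x : Vec d) :
    grad (fun x => φ (x + z)) x = grad φ (x + z) := by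
  ext i
  simp only [grad, partialDeriv]
  rw [fderiv_comp_add_right]

theorem dirichletMatrix_quad_le_translate (hU : BddOpen U) (hU' : BddOpen U') (a : CoeffField d)
    (p : Vec d) :
    p ⬝ᵥ (dirichletMatrix hU (shift z a) *ᵥ p) ≤ p ⬝ᵥ (dirichletMatrix hU' a *ᵥ p) := by
  have hv := hU.volume_pos
  have hvol : volume.real U = volume.real U' := by
    have := setIntegral_translate hz fun _ => 1
    simpa [Measure.real] using this
  refine le_of_mul_le_mul_left (le_of_forall_pos_lt_add fun ε hε => ?_) hv
  obtain ⟨φ, hφ, h1⟩ := exists_energy_dirichlet_lt hU' a p hε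
  have h2 := dirichlet_le_energy hU (shift z a) p (hφ.translate hz).gradLim
  have h3 : energy (shift z a) U ((fun _ => p) + grad fun x => φ (x + z))
      ((fun _ => p) + grad fun x => φ (x + z)) =
      energy a U' ((fun _ => p) + grad φ) ((fun _ => p) + grad φ) := by
    rw [energy, energy, pairing, pairing, ← setIntegral_translate hz]
    simp only [Pi.add_apply, CoeffField.flux, grad_translate, shift]
  rw [h3] at h2
  rw [hvol] at h2 ⊢
  linarith

theorem neumannMatrix_quad_le_translate (hU : BddOpen U) (hU' : BddOpen U') (a : CoeffField d)
    (q : Vec d) :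
    q ⬝ᵥ (neumannMatrix hU' a *ᵥ q) ≤ q ⬝ᵥ (neumannMatrix hU (shift z a) *ᵥ q) := by
  have hv := hU.volume_pos
  have hvol : volume.real U = volume.real U' := by
    have := setIntegral_translate hz fun _ => 1
    simpa [Measure.real] using this
  refine le_of_mul_le_mul_left (le_of_forall_pos_lt_add fun ε hε => ?_) hv
  obtain ⟨φ, hφ, h1⟩ := exists_lt_neumann hU' a q hε
  have hφ' : IsTestFunction Set.univ fun x => φ (x + z) :=
    IsTestFunction.translate (U' := Set.univ) (by simp) hφ
  have h2 := le_neumann hU (shift z a) q hφ'.gradLim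
  have h3 : energy (shift z a) U (grad fun x => φ (x + z)) (grad fun x => φ (x + z)) =
      energy a U' (grad φ) (grad φ) := by
    rw [energy, energy, pairing, pairing, ← setIntegral_translate hz]
    simp only [CoeffField.flux, grad_translate, shift]
  have h4 : pairing U (grad fun x => φ (x + z)) (fun _ => q) = pairing U' (grad φ) fun _ => q := by
    rw [pairing, pairing, ← setIntegral_translate hz]
    simp only [grad_translate]
  rw [h3, h4] at h2
  rw [hvol] at h2 ⊢
  linarith

/-- One inequality comes from translating competitors, the other from applying it to the inverse
shift. -/
theorem dirichletMatrix_translate (hU : BddOpen U) (hU' : BddOpen U') (a : CoeffField d) :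
    dirichletMatrix hU' a = dirichletMatrix hU (shift z a) := by
  refine isSymm_ext (dirichletMatrix_isSymm _ _) (dirichletMatrix_isSymm _ _) fun p =>
    le_antisymm ?_ (dirichletMatrix_quad_le_translate hz hU hU' a p)
  have h := dirichletMatrix_quad_le_translate (z := -z) (U := U') (U' := U)
    (fun x => by rw [← hz]; simp) hU' hU (shift z a) p
  rwa [shift_neg_shift] at h

theorem neumannMatrix_translate (hU : BddOpen U) (hU' : BddOpen U') (a : CoeffField d) :
    neumannMatrix hU' a = neumannMatrix hU (shift z a) := by
  refine isSymm_ext (neumannMatrix_isSymm _ _) (neumannMatrix_isSymm _ _) fun p =>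
    le_antisymm (neumannMatrix_quad_le_translate hz hU hU' a p) ?_
  have h := neumannMatrix_quad_le_translate (z := -z) (U := U') (U' := U)
    (fun x => by rw [← hz]; simp) hU' hU (shift z a) p
  rwa [shift_neg_shift] at h

end

theorem add_mem_cell (m : ℕ) (z : Fin d → ℤ) (x : Vec d) :
    x + (fun i => (z i : ℝ)) ∈ cell m z ↔ x ∈ cell m 0 := by
  simp only [cell, Set.mem_ofPred_eq, Pi.add_apply, Pi.zero_apply, Int.cast_zero]
  refine forall_congr' fun i => ?_
  constructor <;> rintro ⟨h1, h2⟩ <;> constructor <;> linarith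

theorem measurable_shift (z : Vec d) : Measurable (shift (d := d) z) := by
  rw [measurable_iff_comap_le]
  simp only [instMeasurableSpaceCoeffField, sigmaField, MeasurableSpace.comap_iSup]
  refine iSup_le fun i => iSup_le fun j => iSup_le fun φ => iSup_le fun hφ => ?_
  rw [MeasurableSpace.comap_comp]
  have e : (fun a : CoeffField d => ∫ x, a.toFun x i j * φ x) ∘ shift z =
      fun a => ∫ x, a.toFun x i j * φ (x + -z) := by
    ext a
    simp only [Function.comp, shift]
    rw [← integral_add_right_eq_self (fun x => a.toFun x i j * φ (x + -z)) z]
    simp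
  rw [e]
  have h2 : IsTestFunction Set.univ fun x => φ (x + -z) :=
    IsTestFunction.translate (U' := Set.univ) (by simp) hφ
  exact le_iSup_of_le i (le_iSup_of_le j (le_iSup_of_le _ (le_iSup_of_le h2 le_rfl)))

theorem IsStationary.measurePreserving {P : Measure (CoeffField d)} (hP : IsStationary P)
    (z : Fin d → ℤ) : MeasurePreserving (shift fun i => (z i : ℝ)) P P := by
  refine ⟨measurable_shift _, Measure.ext fun A hA => ?_⟩
  -- Stationarity is stated for images of events. The preimage under the shift by `z` is the image
  -- under the shift by `-z`.
  rw [Measure.map_apply (measurable_shift _) hA, ← hP (-z) A hA]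
  congr 1
  have e : (fun i => (((-z) i : ℤ) : ℝ)) = -(fun i => (z i : ℝ)) := by ext i; simp
  rw [e]
  ext a
  simp only [Set.mem_preimage, Set.mem_image]
  exact ⟨fun h => ⟨_, h, shift_neg_shift _ _⟩, by rintro ⟨b, hb, rfl⟩; rwa [shift_shift_neg]⟩

/-! ### Ellipticity constants and the tail condition -/

theorem isBoundedUnder_of_ae_mem_Icc {X : Type*} [MeasurableSpace X] {μ : Measure X} {f : X → ℝ}
    {b c : ℝ} (h : ∀ᵐ x ∂μ, b ≤ f x ∧ f x ≤ c) :
    IsBoundedUnder (· ≤ ·) (ae μ) f ∧ IsBoundedUnder (· ≥ ·) (ae μ) f :=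
  ⟨⟨c, eventually_map.mpr (h.mono fun _ hx => hx.2)⟩,
    ⟨b, eventually_map.mpr (h.mono fun _ hx => hx.1)⟩⟩

/-- For real-valued functions, essential and pointwise suprema and infima have their expected
meaning only under boundedness, which the local bounds on `a` and `a⁻¹` supply. Homogeneity passes
from unit vectors to all vectors. -/
theorem ell_spec (hd : 0 < d) {U : Set (Vec d)} (hU : BddOpen U) (a : CoeffField d) :
    0 < lowerEll a U ∧ lowerEll a U ≤ upperEll a U ∧
      ∀ᵐ x ∂volume.restrict U, ∀ ξ : Vec d, lowerEll a U * (ξ ⬝ᵥ ξ) ≤ ξ ⬝ᵥ (a.toFun x *ᵥ ξ) ∧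
        ξ ⬝ᵥ (a.toFun x *ᵥ ξ) ≤ upperEll a U * (ξ ⬝ᵥ ξ) := by
  obtain ⟨K, hK0, hK⟩ := a.exists_quad_bounds hU.bdd
  have hne : (ae (volume.restrict U)).NeBot := by
    rw [ae_neBot, Ne, Measure.restrict_eq_zero]
    exact (hU.isOpen.measure_pos _ hU.nonempty).ne'
  let S := {ξ : Vec d // ξ ⬝ᵥ ξ = 1}
  -- The unit sphere is empty in dimension zero; this is where `0 < d` is used.
  have hS : Nonempty S := ⟨⟨Pi.single ⟨0, hd⟩ 1, by simp⟩⟩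
  let f : Vec d → S → ℝ := fun x ξ => ξ.1 ⬝ᵥ (a.toFun x *ᵥ ξ.1)
  have hf : ∀ x ∈ U, ∀ ξ, K⁻¹ ≤ f x ξ ∧ f x ξ ≤ K := by
    intro x hx ξ
    obtain ⟨h1, h2⟩ := hK x hx ξ.1
    rw [ξ.2] at h1 h2
    exact ⟨by rwa [inv_le_iff_one_le_mul₀' hK0], by simpa using h1⟩
  have hup : ∀ x ∈ U, BddAbove (Set.range (f x)) := fun x hx =>
    ⟨K, by rintro _ ⟨ξ, rfl⟩; exact (hf x hx ξ).2⟩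
  have hlo : ∀ x ∈ U, BddBelow (Set.range (f x)) := fun x hx =>
    ⟨K⁻¹, by rintro _ ⟨ξ, rfl⟩; exact (hf x hx ξ).1⟩
  have hsup : ∀ᵐ x ∂volume.restrict U, K⁻¹ ≤ (⨆ ξ, f x ξ) ∧ (⨆ ξ, f x ξ) ≤ K := by
    filter_upwards [ae_restrict_mem hU.meas] with x hx
    exact ⟨(hf x hx hS.some).1.trans (le_ciSup (hup x hx) _), ciSup_le fun ξ => (hf x hx ξ).2⟩
  have hinf : ∀ᵐ x ∂volume.restrict U, K⁻¹ ≤ (⨅ ξ, f x ξ) ∧ (⨅ ξ, f x ξ) ≤ K := by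
    filter_upwards [ae_restrict_mem hU.meas] with x hx
    exact ⟨le_ciInf fun ξ => (hf x hx ξ).1, (ciInf_le (hlo x hx) hS.some).trans (hf x hx _).2⟩
  obtain ⟨u1, u2⟩ := isBoundedUnder_of_ae_mem_Icc hsup
  obtain ⟨l1, l2⟩ := isBoundedUnder_of_ae_mem_Icc hinf
  have hupper : ∀ᵐ x ∂volume.restrict U, (⨆ ξ, f x ξ) ≤ upperEll a U := ae_le_essSup u1
  have hlower : ∀ᵐ x ∂volume.restrict U, lowerEll a U ≤ ⨅ ξ, f x ξ := ae_essInf_le l2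
  refine ⟨?_, ?_, ?_⟩
  · refine (inv_pos.mpr hK0).trans_le (le_essInf_of_ae_le _ (hinf.mono fun x hx => hx.1) ?_)
    exact l1.isCoboundedUnder_ge
  · obtain ⟨x, ⟨h1, h2⟩, hx⟩ := ((hlower.and hupper).and (ae_restrict_mem hU.meas)).exists
    exact h1.trans ((ciInf_le (hlo x hx) hS.some).trans ((le_ciSup (hup x hx) _).trans h2))
  · filter_upwards [hlower, hupper, ae_restrict_mem hU.meas] with x h1 h2 hx ξ
    rcases eq_or_ne ξ 0 with rfl | hξ
    · simp
    have hpos := dot_self_pos hξ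
    have hr : 0 < Real.sqrt (ξ ⬝ᵥ ξ) := Real.sqrt_pos.mpr hpos
    have hr2 : Real.sqrt (ξ ⬝ᵥ ξ) * Real.sqrt (ξ ⬝ᵥ ξ) = ξ ⬝ᵥ ξ := Real.mul_self_sqrt hpos.le
    let η : S := ⟨(Real.sqrt (ξ ⬝ᵥ ξ))⁻¹ • ξ, by
      rw [smul_dotProduct, dotProduct_smul, smul_eq_mul, smul_eq_mul, ← mul_assoc, ← mul_inv, hr2,
        inv_mul_cancel₀ hpos.ne']⟩
    have e : ξ ⬝ᵥ (a.toFun x *ᵥ ξ) = f x η * (ξ ⬝ᵥ ξ) := by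
      simp only [f, η, Matrix.mulVec_smul, smul_dotProduct, dotProduct_smul, smul_eq_mul]
      rw [← mul_assoc (Real.sqrt _)⁻¹, ← mul_inv, hr2]
      field_simp
    rw [e]
    exact ⟨mul_le_mul_of_nonneg_right (h1.trans (ciInf_le (hlo x hx) η)) hpos.le,
      mul_le_mul_of_nonneg_right ((le_ciSup (hup x hx) η).trans h2) hpos.le⟩

/-- The quantity `λ(□_n)⁻³ + Λ(□_n)³`. -/
noncomputable def ellCube (n : ℕ) (a : CoeffField d) : ℝ :=
  (lowerEll a (cube d n))⁻¹ ^ 3 + upperEll a (cube d n) ^ 3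

theorem ell_spec_cell (hd : 0 < d) (n : ℕ) (a : CoeffField d) :
    0 < lowerEll a (cube d n) ∧ lowerEll a (cube d n) ≤ upperEll a (cube d n) ∧
      ∀ᵐ x ∂volume.restrict (cell n (0 : Fin d → ℤ)), ∀ ξ : Vec d,
        lowerEll a (cube d n) * (ξ ⬝ᵥ ξ) ≤ ξ ⬝ᵥ (a.toFun x *ᵥ ξ) ∧
        ξ ⬝ᵥ (a.toFun x *ᵥ ξ) ≤ upperEll a (cube d n) * (ξ ⬝ᵥ ξ) := by
  have h := ell_spec hd (bddOpen_cell n (0 : Fin d → ℤ)) a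
  rwa [cell_zero] at h ⊢

/-- Since `λ ≤ Λ`, either `Λ ≥ 1` or `λ⁻¹ ≥ 1`. Constants and lower powers of `λ⁻¹` and `Λ` can thus
be absorbed in `ellCube`. -/
theorem one_le_ellCube (hd : 0 < d) (n : ℕ) (a : CoeffField d) : 1 ≤ ellCube n a := by
  obtain ⟨h1, h2, -⟩ := ell_spec_cell hd n a
  have h3 : 0 < upperEll a (cube d n) := h1.trans_le h2
  rw [ellCube]
  rcases le_total 1 (upperEll a (cube d n)) with h | h
  · have := one_le_pow₀ h (n := 3)
    have : 0 < (lowerEll a (cube d n))⁻¹ ^ 3 := by positivity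
    linarith
  · have := one_le_pow₀ ((one_le_inv₀ h1).mpr (h2.trans h)) (n := 3)
    have : 0 < upperEll a (cube d n) ^ 3 := by positivity
    linarith

theorem upperEll_sq_le (hd : 0 < d) (n : ℕ) (a : CoeffField d) :
    upperEll a (cube d n) ^ 2 ≤ 2 * ellCube n a := by
  obtain ⟨h1, h2, -⟩ := ell_spec_cell hd n a
  have h3 : 0 < upperEll a (cube d n) := h1.trans_le h2
  have h4 := one_le_ellCube hd n a
  have h5 : 0 < (lowerEll a (cube d n))⁻¹ ^ 3 := by positivity
  have h6 : upperEll a (cube d n) ^ 3 ≤ ellCube n a := by rw [ellCube]; linarith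
  nlinarith [sq_nonneg (upperEll a (cube d n) - 1), mul_nonneg h3.le (sq_nonneg
    (upperEll a (cube d n) - 1))]

theorem upperEll_le (hd : 0 < d) (n : ℕ) (a : CoeffField d) :
    upperEll a (cube d n) ≤ 2 * ellCube n a := by
  have h := upperEll_sq_le hd n a
  have h4 := one_le_ellCube hd n a
  nlinarith [sq_nonneg (upperEll a (cube d n) - 1)]

theorem inv_lowerEll_le (hd : 0 < d) (n : ℕ) (a : CoeffField d) :
    (lowerEll a (cube d n))⁻¹ ≤ 2 * ellCube n a := by
  obtain ⟨h1, h2, -⟩ := ell_spec_cell hd n a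
  have h3 : 0 < upperEll a (cube d n) := h1.trans_le h2
  have h4 := one_le_ellCube hd n a
  have h5 : 0 < (lowerEll a (cube d n))⁻¹ := by positivity
  have h6 : (lowerEll a (cube d n))⁻¹ ^ 3 ≤ ellCube n a := by
    rw [ellCube]; linarith [pow_pos h3 3]
  nlinarith [mul_nonneg h5.le (sq_nonneg ((lowerEll a (cube d n))⁻¹ - 1)),
    sq_nonneg ((lowerEll a (cube d n))⁻¹ - 1)]

/-! ### Consequences of the tail condition -/

section
variable {P : Measure (CoeffField d)} {L : ℝ} {δ M : ℕ → ℝ}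

theorem IsSuppressive.mono (h : IsSuppressive P L δ M) {L' : ℝ} (hL : L ≤ L') :
    IsSuppressive P L' δ M :=
  { h with
    tail := fun n => (h.tail n).trans (ENNReal.ofReal_le_ofReal (by gcongr)) }

theorem IsSuppressive.δ_le_one (h : IsSuppressive P L δ M) (n : ℕ) : δ n ≤ 1 :=
  h.δ_zero ▸ h.δ_antitone (Nat.zero_le n)

theorem IsSuppressive.one_le_M (h : IsSuppressive P L δ M) (n : ℕ) : 1 ≤ M n :=
  h.M_zero ▸ h.M_monotone (Nat.zero_le n)

theorem IsSuppressive.inv_le_ratio (h : IsSuppressive P L δ M) (n : ℕ) : (δ n)⁻¹ ≤ M n / δ n := by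
  rw [div_eq_mul_inv]
  exact le_mul_of_one_le_left (inv_pos.mpr (h.δ_pos n)).le (h.one_le_M n)

theorem IsSuppressive.M_le_ratio (h : IsSuppressive P L δ M) (n : ℕ) : M n ≤ M n / δ n := by
  rw [div_eq_mul_inv]
  exact le_mul_of_one_le_right (h.M_pos n).le ((one_le_inv₀ (h.δ_pos n)).mpr (h.δ_le_one n))

/-- A nonnegative random variable that is controlled by the ellipticity of `□_n` is bounded in
expectation by any of its majorants on the event `{δ_n < λ(□_n), Λ(□_n) < M_n}`, up to the tail. -/
theorem IsSuppressive.integral_le (hL : 0 ≤ L) (h : IsSuppressive P L δ M) {n : ℕ}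
    {X Y : CoeffField d → ℝ} (hX : Measurable X) (hX0 : ∀ a, 0 ≤ X a) (hY : Measurable Y)
    (hY0 : ∀ a, 0 ≤ Y a) (hYi : Integrable Y P) {K : ℝ} (hK : 0 ≤ K)
    (hXK : ∀ a, X a ≤ K * ellCube n a)
    (hXY : ∀ a, δ n < lowerEll a (cube d n) → upperEll a (cube d n) < M n → X a ≤ Y a) :
    Integrable X P ∧ ∫ a, X a ∂P ≤ ∫ a, Y a ∂P + K * L * Real.exp (-(n : ℝ)) := by
  -- No measurability of the bad event is needed: the integral is split by subadditivity over `B`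
  -- and its complement, and each comparison has the form of a monotonicity statement. On the
  -- complement it uses that `Y` is measurable.
  set B : Set (CoeffField d) :=
    {a | lowerEll a (cube d n) ≤ δ n} ∪ {a | M n ≤ upperEll a (cube d n)} with hB
  have h1 : ∫⁻ a in Bᶜ, ENNReal.ofReal (X a) ∂P ≤ ∫⁻ a, ENNReal.ofReal (Y a) ∂P := by
    refine (setLIntegral_mono hY.ennreal_ofReal fun a ha => ?_).trans (setLIntegral_le_lintegral _ _)
    simp only [hB, Set.mem_compl_iff, Set.mem_union, Set.mem_ofPred_eq, not_or, not_le] at ha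
    exact ENNReal.ofReal_le_ofReal (hXY a ha.1 ha.2)
  have h2 : ∫⁻ a in B, ENNReal.ofReal (X a) ∂P ≤
      ENNReal.ofReal (K * L * Real.exp (-(n : ℝ))) := by
    calc ∫⁻ a in B, ENNReal.ofReal (X a) ∂P
        ≤ ∫⁻ a in B, ENNReal.ofReal K * ENNReal.ofReal (ellCube n a) ∂P := by
          refine lintegral_mono fun a => ?_
          rw [← ENNReal.ofReal_mul hK]
          exact ENNReal.ofReal_le_ofReal (hXK a)
      _ = ENNReal.ofReal K * ∫⁻ a in B, ENNReal.ofReal (ellCube n a) ∂P :=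
          lintegral_const_mul' _ _ ENNReal.ofReal_ne_top
      _ ≤ ENNReal.ofReal K * ENNReal.ofReal (L * Real.exp (-(n : ℝ))) := by
          gcongr
          exact h.tail n
      _ = _ := by rw [← ENNReal.ofReal_mul hK, mul_assoc]
  have h3 : ∫⁻ a, ENNReal.ofReal (X a) ∂P ≤
      ENNReal.ofReal (∫ a, Y a ∂P + K * L * Real.exp (-(n : ℝ))) := by
    rw [ENNReal.ofReal_add (integral_nonneg hY0) (by positivity),
      ofReal_integral_eq_lintegral_ofReal hYi (ae_of_all _ hY0)]
    refine le_trans ?_ (add_le_add h1 h2)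
    refine le_trans ?_ (lintegral_union_le _ _ _)
    rw [Set.compl_union_self, Measure.restrict_univ]
  have hXi : Integrable X P := by
    refine ⟨hX.aestronglyMeasurable, ?_⟩
    rw [hasFiniteIntegral_iff_ofReal (ae_of_all _ hX0)]
    exact h3.trans_lt ENNReal.ofReal_lt_top
  refine ⟨hXi, ?_⟩
  rw [← ofReal_integral_eq_lintegral_ofReal hXi (ae_of_all _ hX0)] at h3
  have h4 : 0 ≤ ∫ a, Y a ∂P := integral_nonneg hY0
  exact (ENNReal.ofReal_le_ofReal_iff (by positivity)).mp h3

/-- Integrability of random variables that are controlled by the ellipticity of `□_n`. -/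
theorem IsSuppressive.integrable_of_le [IsProbabilityMeasure P] (hd : 0 < d) (hL : 0 ≤ L)
    (h : IsSuppressive P L δ M) {n : ℕ}
    {X : CoeffField d → ℝ} (hX : Measurable X) {K : ℝ} (hK : 0 ≤ K)
    (hXK : ∀ a, |X a| ≤ K * ellCube n a) :
    Integrable X P ∧ ∫ a, |X a| ∂P ≤ K * ((δ n)⁻¹ ^ 3 + M n ^ 3) + K * L := by
  have hδ := h.δ_pos n
  have hM := h.M_pos n
  obtain ⟨h1, h2⟩ := h.integral_le hL (n := n) (X := fun a => |X a|)
    (Y := fun _ => K * ((δ n)⁻¹ ^ 3 + M n ^ 3)) hX.abs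
    (fun a => abs_nonneg _) measurable_const (fun _ => by positivity)
    (integrable_const _) hK hXK fun a ha1 ha2 => by
      refine (hXK a).trans (mul_le_mul_of_nonneg_left ?_ hK)
      obtain ⟨e1, e2, -⟩ := ell_spec_cell hd n a
      have e3 : 0 < upperEll a (cube d n) := e1.trans_le e2
      rw [ellCube]
      gcongr
  refine ⟨(integrable_norm_iff hX.aestronglyMeasurable).mp h1, h2.trans ?_⟩
  rw [integral_const, probReal_univ, one_smul]
  exact add_le_add_right (mul_le_of_le_one_right (by positivity)
    (Real.exp_le_one_iff.mpr (neg_nonpos.mpr (Nat.cast_nonneg n)))) _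

end

/-! ### Variance of sums under mixing -/

section
variable {Ω ι : Type*} [MeasurableSpace Ω] {P : Measure Ω} [IsProbabilityMeasure P]
  [DecidableEq ι] {X : ι → Ω → ℝ}

/-- Signs are chosen greedily: attaching a new summand with sign `±` adds its variance and `±2`
times a covariance, and one of the two signs makes the last term nonpositive. -/
theorem exists_signs_variance_le (s : Finset ι) (hX : ∀ i, MemLp (X i) 2 P) :
    ∃ t ⊆ s, Var[∑ i ∈ t, X i - ∑ i ∈ s \ t, X i; P] ≤ ∑ i ∈ s, Var[X i; P] := by
  have hS : ∀ t : Finset ι, MemLp (∑ i ∈ t, X i) 2 P := fun t => memLp_finsetSum' _ fun i _ => hX i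
  induction s using Finset.induction_on with
  | empty => exact ⟨∅, by simp⟩
  | insert j s hj ih =>
    obtain ⟨t, hts, ht⟩ := ih
    have hjt : j ∉ t := fun h => hj (hts h)
    have hY := (hS t).sub (hS (s \ t))
    rw [Finset.sum_insert hj]
    have e1 := variance_add (hX j) hY
    have e2 := variance_sub hY (hX j)
    rcases le_total (cov[X j, ∑ i ∈ t, X i - ∑ i ∈ s \ t, X i; P]) 0 with h | h
    · refine ⟨insert j t, Finset.insert_subset_insert _ hts, ?_⟩
      have e : insert j s \ insert j t = s \ t := by
        ext x
        simp only [Finset.mem_sdiff, Finset.mem_insert]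
        grind
      rw [e, Finset.sum_insert hjt, add_sub_assoc]
      linarith
    · refine ⟨t, hts.trans (Finset.subset_insert _ _), ?_⟩
      have e : insert j s \ t = insert j (s \ t) := Finset.insert_sdiff_of_notMem _ hjt
      rw [e, Finset.sum_insert (by simp [hj]), add_comm (X j), ← sub_sub]
      rw [covariance_comm] at h
      linarith

/-- Let `A` and `B` be the variances of the sums over the plus and the minus signs, and `c` their
covariance. The choice of signs gives `A + B - 2c ≤ Σ Var`, and the correlation bound gives `2c ≤
r(A + B)`. Hence `(1-r)(A + B) ≤ Σ Var`, whereas `Var(Σ) = A + B + 2c ≤ (1+r)(A + B)`. A correlation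
bound for one splitting thus suffices, with no loss in the number of summands. -/
theorem variance_sum_le_of_correlation {r : ℝ} (hr : 0 ≤ r) (s : Finset ι)
    (hX : ∀ i, MemLp (X i) 2 P)
    (h : ∀ t ⊆ s, cov[∑ i ∈ t, X i, ∑ i ∈ s \ t, X i; P] ≤
      r * (√(Var[∑ i ∈ t, X i; P]) * √(Var[∑ i ∈ s \ t, X i; P]))) :
    (1 - r) * Var[∑ i ∈ s, X i; P] ≤ (1 + r) * ∑ i ∈ s, Var[X i; P] := by
  have hS : ∀ t : Finset ι, MemLp (∑ i ∈ t, X i) 2 P := fun t => memLp_finsetSum' _ fun i _ => hX i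
  obtain ⟨t, hts, ht⟩ := exists_signs_variance_le s hX
  have h1 := h t hts
  have e : ∑ i ∈ s, X i = ∑ i ∈ t, X i + ∑ i ∈ s \ t, X i := by
    rw [add_comm, Finset.sum_sdiff hts]
  rw [e, variance_add (hS _) (hS _)]
  rw [variance_sub (hS _) (hS _)] at ht
  set A := Var[∑ i ∈ t, X i; P] with hA
  set B := Var[∑ i ∈ s \ t, X i; P] with hB
  set c := cov[∑ i ∈ t, X i, ∑ i ∈ s \ t, X i; P]
  have hA0 : 0 ≤ A := variance_nonneg _ _
  have hB0 : 0 ≤ B := variance_nonneg _ _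
  have h2 : 2 * (√A * √B) ≤ A + B := by
    nlinarith [sq_nonneg (√A - √B), Real.sq_sqrt hA0, Real.sq_sqrt hB0]
  have h3 : 2 * c ≤ r * (A + B) := by nlinarith
  rcases le_or_gt 1 r with h4 | h4
  · have h5 : 0 ≤ A + 2 * c + B := by
      rw [← variance_add (hS _) (hS _)]
      exact variance_nonneg _ _
    have h6 : 0 ≤ ∑ i ∈ s, Var[X i; P] := Finset.sum_nonneg fun i _ => variance_nonneg _ _
    nlinarith
  · nlinarith

omit [DecidableEq ι] in
theorem variance_sum_le_card_mul (s : Finset ι) (hX : ∀ i, MemLp (X i) 2 P) :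
    Var[∑ i ∈ s, X i; P] ≤ s.card * ∑ i ∈ s, Var[X i; P] := by
  rw [variance_sum' fun i _ => hX i]
  calc ∑ i ∈ s, ∑ j ∈ s, cov[X i, X j; P]
      ≤ ∑ i ∈ s, ∑ j ∈ s, (Var[X i; P] + Var[X j; P]) / 2 := by
        refine Finset.sum_le_sum fun i _ => Finset.sum_le_sum fun j _ => ?_
        have := variance_nonneg (X i - X j) P
        rw [variance_sub (hX i) (hX j)] at this
        linarith
    _ = s.card * ∑ i ∈ s, Var[X i; P] := by
        simp only [add_div, Finset.sum_add_distrib, Finset.sum_const, nsmul_eq_mul,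
          ← Finset.mul_sum, ← Finset.sum_div]
        ring

end

/-! ### Variances under the mixing hypothesis -/

section
variable {P : Measure (CoeffField d)} [IsProbabilityMeasure P] {r : ℝ}

theorem IsMixing.variance_sum_le (hP : IsMixing P r) (hr : 0 ≤ r) {ι : Type*} [DecidableEq ι]
    (s : Finset ι) {U : ι → Set (Vec d)} (hU : ∀ i, MeasurableSet (U i))
    (hsep : ∀ i ∈ s, ∀ j ∈ s, i ≠ j → ∀ x ∈ U i, ∀ y ∈ U j, 1 ≤ dist x y)
    {X : ι → CoeffField d → ℝ} (hX : ∀ i, MemLp (X i) 2 P)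
    (hm : ∀ i, Measurable[sigmaField (U i)] (X i)) :
    (1 - r) * Var[∑ i ∈ s, X i; P] ≤ (1 + r) * ∑ i ∈ s, Var[X i; P] := by
  have hS : ∀ t : Finset ι, MemLp (∑ i ∈ t, X i) 2 P := fun t => memLp_finsetSum' _ fun i _ => hX i
  have hSm : ∀ t : Finset ι, Measurable[sigmaField (⋃ i ∈ t, U i)] (∑ i ∈ t, X i) := by
    intro t
    rw [show (∑ i ∈ t, X i) = fun a => ∑ i ∈ t, X i a from funext fun a => Finset.sum_apply _ _ _]
    refine @Finset.measurable_sum ℝ ι (CoeffField d) _ _ _ (sigmaField (⋃ i ∈ t, U i)) X t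
      fun i hi => ?_
    exact (hm i).mono (sigmaField_mono (Set.subset_biUnion_of_mem (u := U) hi)) le_rfl
  have hUm : ∀ t : Finset ι, MeasurableSet (⋃ i ∈ t, U i) := fun t =>
    Finset.measurableSet_biUnion _ fun i _ => hU i
  refine variance_sum_le_of_correlation hr s hX fun t ht => ?_
  refine hP _ _ (hUm t) (hUm (s \ t)) ?_ _ _ (hSm t) (hS t) (hSm _) (hS _)
  intro u hu v hv
  simp only [Set.mem_iUnion] at hu hv
  obtain ⟨i, hi, hu⟩ := hu
  obtain ⟨j, hj, hv⟩ := hv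
  rw [Finset.mem_sdiff] at hj
  exact hsep i (ht hi) j hj.1 (fun h => hj.2 (h ▸ hi)) u hu v hv

/-- The variance of a sum over the subcells of a cell. -/
theorem IsMixing.variance_sum_subcells_le (hP : IsMixing P r) (hr : r ∈ Set.Ioo (0 : ℝ) 1)
    (m k : ℕ) {X : (Fin d → Fin (3 ^ k)) → CoeffField d → ℝ} (hX : ∀ j, MemLp (X j) 2 P)
    (hm : ∀ j, Measurable[sigmaField (cell m (subcenter m k 0 j))] (X j)) :
    Var[∑ j, X j; P] ≤ 2 ^ d * ((1 + r) / (1 - r)) * ∑ j, Var[X j; P] := by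
  classical
  -- Cells are coloured by the parities of their indices. Within a colour they are at distance at
  -- least one; combining the `2^d` colours costs the factor `2^d`.
  let col : (Fin d → Fin (3 ^ k)) → Fin d → Fin 2 := fun j i =>
    ⟨(j i : ℕ) % 2, Nat.mod_lt _ two_pos⟩
  have hr1 : 0 < 1 - r := by linarith [hr.2]
  have e1 : ∑ j, X j = ∑ c : Fin d → Fin 2, ∑ j with col j = c, X j :=
    (Finset.sum_fiberwise _ _ _).symm
  have e2 : ∑ j, Var[X j; P] = ∑ c : Fin d → Fin 2, ∑ j with col j = c, Var[X j; P] :=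
    (Finset.sum_fiberwise _ _ _).symm
  rw [e1, e2]
  refine (variance_sum_le_card_mul _ fun c => memLp_finsetSum' _ fun i _ => hX i).trans ?_
  have e3 : ((Finset.univ : Finset (Fin d → Fin 2)).card : ℝ) = 2 ^ d := by simp
  rw [e3, mul_assoc, Finset.mul_sum (a := (1 + r) / (1 - r))]
  refine mul_le_mul_of_nonneg_left (Finset.sum_le_sum fun c _ => ?_) (by positivity)
  have h := hP.variance_sum_le hr.1.le (Finset.univ.filter fun j => col j = c)
    (U := fun j => cell m (subcenter m k 0 j)) (fun j => (bddOpen_cell _ _).meas)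
    (fun i hi j hj hij x hx y hy => ?_) hX hm
  · rw [div_mul_eq_mul_div, le_div_iff₀ hr1]
    linarith
  · refine one_le_dist_of_same_parity hij (fun l => ?_) hx hy
    have hc : col i = col j := (Finset.mem_filter.mp hi).2.trans (Finset.mem_filter.mp hj).2.symm
    exact congrArg Fin.val (congrFun hc l)

end

/-! ### Moments of the coarse-grained matrices -/

theorem abs_entry_le_of_quad_le {A : Mat d} (hs : A.IsSymm) (hA : ∀ x, 0 ≤ x ⬝ᵥ (A *ᵥ x)) {K : ℝ}
    (hK : ∀ x, x ⬝ᵥ (A *ᵥ x) ≤ K * (x ⬝ᵥ x)) (i j : Fin d) : |A i j| ≤ K := by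
  have h1 := quad_cauchy_schwarz hs hA (Pi.single i 1) (Pi.single j 1)
  have hi := hK (Pi.single i 1)
  have hj := hK (Pi.single j 1)
  have hi0 := hA (Pi.single i 1)
  have hj0 := hA (Pi.single j 1)
  simp only [Matrix.mulVec_single_one, single_one_dotProduct, Matrix.col_apply, Pi.single_eq_same,
    mul_one] at h1 hi hj hi0 hj0
  refine abs_le_of_sq_le_sq ?_ (hi0.trans hi)
  rw [sq K]
  exact h1.trans (mul_le_mul hi hj hj0 (hi0.trans hi))

/-- Each squared entry is at most the product of two diagonal entries, by Cauchy–Schwarz, and these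
lie between zero and the trace. -/
theorem entry_sq_le_trace_sq {A : Mat d} (hs : A.IsSymm) (hA : ∀ x, 0 ≤ x ⬝ᵥ (A *ᵥ x))
    (i j : Fin d) : A i j ^ 2 ≤ A.trace ^ 2 := by
  have h1 := quad_cauchy_schwarz hs hA (Pi.single i 1) (Pi.single j 1)
  have h2 : ∀ i, 0 ≤ A i i := fun i => by
    have := hA (Pi.single i 1)
    simpa using this
  simp only [Matrix.mulVec_single_one, single_one_dotProduct, Matrix.col_apply] at h1
  have h3 : ∀ i, A i i ≤ A.trace := fun i =>
    Finset.single_le_sum (f := fun i => A i i) (fun i _ => h2 i) (Finset.mem_univ i)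
  rw [sq A.trace]
  exact h1.trans (mul_le_mul (h3 i) (h3 j) (h2 j) ((h2 i).trans (h3 i)))

theorem dirichletMatrix_le_upperEll (hd : 0 < d) {n : ℕ} {U : Set (Vec d)} (hU : BddOpen U)
    (hUn : U ⊆ cell n 0) (a : CoeffField d) (p : Vec d) :
    p ⬝ᵥ (dirichletMatrix hU a *ᵥ p) ≤ upperEll a (cube d n) * (p ⬝ᵥ p) := by
  refine dirichletMatrix_le hU a ?_ p
  have h := ae_restrict_of_ae_restrict_of_subset hUn (ell_spec_cell hd n a).2.2
  exact h.mono fun x hx ξ => (hx ξ).2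

theorem neumannMatrix_le_lowerEll (hd : 0 < d) {n : ℕ} {U : Set (Vec d)} (hU : BddOpen U)
    (hUn : U ⊆ cell n 0) (a : CoeffField d) (q : Vec d) :
    q ⬝ᵥ (neumannMatrix hU a *ᵥ q) ≤ (lowerEll a (cube d n))⁻¹ * (q ⬝ᵥ q) := by
  refine neumannMatrix_le hU a (ell_spec_cell hd n a).1 ?_ q
  have h := ae_restrict_of_ae_restrict_of_subset hUn (ell_spec_cell hd n a).2.2
  exact h.mono fun x hx ξ => (hx ξ).1

theorem measurable_dirichletMatrix' {U : Set (Vec d)} (hU : BddOpen U) (i j : Fin d) :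
    Measurable fun a => dirichletMatrix hU a i j :=
  (measurable_dirichletMatrix hU i j).mono (sigmaField_mono (Set.subset_univ U)) le_rfl

theorem measurable_neumannMatrix' {U : Set (Vec d)} (hU : BddOpen U) (i j : Fin d) :
    Measurable fun a => neumannMatrix hU a i j :=
  (measurable_neumannMatrix hU i j).mono (sigmaField_mono (Set.subset_univ U)) le_rfl

theorem measurable_quad {F : CoeffField d → Mat d} (hF : ∀ i j, Measurable fun a => F a i j)
    (p q : Vec d) : Measurable fun a => p ⬝ᵥ (F a *ᵥ q) := by
  simp only [dotProduct, Matrix.mulVec]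
  exact Finset.measurable_sum _ fun i _ =>
    (Finset.measurable_sum _ fun j _ => (hF i j).mul_const _).const_mul _

/-- The entrywise expectation of a random matrix. -/
noncomputable def meanMatrix (P : Measure (CoeffField d)) (F : CoeffField d → Mat d) : Mat d :=
  Matrix.of fun i j => ∫ a, F a i j ∂P

section
variable {P : Measure (CoeffField d)} {F : CoeffField d → Mat d}

theorem integrable_quad (hF : ∀ i j, Integrable (fun a => F a i j) P) (p q : Vec d) :
    Integrable (fun a => p ⬝ᵥ (F a *ᵥ q)) P := by
  simp only [dotProduct, Matrix.mulVec]
  exact integrable_finsetSum _ fun i _ =>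
    (integrable_finsetSum _ fun j _ => (hF i j).mul_const _).const_mul _

theorem integral_quad (hF : ∀ i j, Integrable (fun a => F a i j) P) (p q : Vec d) :
    ∫ a, p ⬝ᵥ (F a *ᵥ q) ∂P = p ⬝ᵥ (meanMatrix P F *ᵥ q) := by
  simp only [dotProduct, Matrix.mulVec, meanMatrix, Matrix.of_apply]
  rw [integral_finsetSum _ fun i _ =>
    (integrable_finsetSum _ fun j _ => (hF i j).mul_const _).const_mul _]
  refine Finset.sum_congr rfl fun i _ => ?_
  rw [integral_const_mul, integral_finsetSum _ fun j _ => (hF i j).mul_const _]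
  simp_rw [integral_mul_const]

theorem meanMatrix_isSymm (hF : ∀ a, (F a).IsSymm) : (meanMatrix P F).IsSymm := by
  ext i j
  simp only [meanMatrix, Matrix.transpose_apply, Matrix.of_apply]
  simp_rw [fun a => (hF a).apply i j]

theorem integral_shift (hP : IsStationary P) (z : Fin d → ℤ) {f : CoeffField d → ℝ}
    (hf : Measurable f) : ∫ a, f (shift (fun i => (z i : ℝ)) a) ∂P = ∫ a, f a ∂P := by
  have h := hP.measurePreserving z
  have h1 := integral_map (μ := P) h.measurable.aemeasurable (f := f) hf.aestronglyMeasurable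
  rw [h.map_eq] at h1
  exact h1.symm

end

/-- The Dirichlet matrix of `□_n`. -/
noncomputable def cubeD (n : ℕ) (a : CoeffField d) : Mat d := dirichletMatrix (bddOpen_cell n 0) a

/-- The Neumann matrix of `□_n`. -/
noncomputable def cubeN (n : ℕ) (a : CoeffField d) : Mat d := neumannMatrix (bddOpen_cell n 0) a

theorem dirichletMatrix_cell (m : ℕ) (z : Fin d → ℤ) (a : CoeffField d) :
    dirichletMatrix (bddOpen_cell m z) a = cubeD m (shift (fun i => (z i : ℝ)) a) :=
  dirichletMatrix_translate (add_mem_cell m z) _ _ a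

theorem neumannMatrix_cell (m : ℕ) (z : Fin d → ℤ) (a : CoeffField d) :
    neumannMatrix (bddOpen_cell m z) a = cubeN m (shift (fun i => (z i : ℝ)) a) :=
  neumannMatrix_translate (add_mem_cell m z) _ _ a

theorem measurable_cubeD (n : ℕ) (i j : Fin d) : Measurable fun a => cubeD n a i j :=
  measurable_dirichletMatrix' _ i j

theorem measurable_cubeN (n : ℕ) (i j : Fin d) : Measurable fun a => cubeN n a i j :=
  measurable_neumannMatrix' _ i j

theorem abs_dirichletMatrix_le (hd : 0 < d) {n : ℕ} {U : Set (Vec d)} (hU : BddOpen U)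
    (hUn : U ⊆ cell n 0) (a : CoeffField d) (i j : Fin d) :
    |dirichletMatrix hU a i j| ≤ upperEll a (cube d n) :=
  abs_entry_le_of_quad_le (dirichletMatrix_isSymm _ a) (dirichletMatrix_nonneg _ a)
    (dirichletMatrix_le_upperEll hd hU hUn a) i j

theorem abs_neumannMatrix_le (hd : 0 < d) {n : ℕ} {U : Set (Vec d)} (hU : BddOpen U)
    (hUn : U ⊆ cell n 0) (a : CoeffField d) (i j : Fin d) :
    |neumannMatrix hU a i j| ≤ (lowerEll a (cube d n))⁻¹ :=
  abs_entry_le_of_quad_le (neumannMatrix_isSymm _ a) (neumannMatrix_nonneg _ a)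
    (neumannMatrix_le_lowerEll hd hU hUn a) i j

section
variable {P : Measure (CoeffField d)} [IsProbabilityMeasure P] {L : ℝ} {δ M : ℕ → ℝ}
  (hd : 0 < d) (hL : 0 ≤ L) (hS : IsSuppressive P L δ M)
include hd hL hS

theorem integrable_cubeD (n : ℕ) (i j : Fin d) : Integrable (fun a => cubeD n a i j) P :=
  (hS.integrable_of_le hd hL (n := n) (measurable_cubeD n i j) zero_le_two fun a =>
    (abs_dirichletMatrix_le hd _ subset_rfl a i j).trans (upperEll_le hd n a)).1

theorem integrable_cubeN (n : ℕ) (i j : Fin d) : Integrable (fun a => cubeN n a i j) P :=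
  (hS.integrable_of_le hd hL (n := n) (measurable_cubeN n i j) zero_le_two fun a =>
    (abs_neumannMatrix_le hd _ subset_rfl a i j).trans (inv_lowerEll_le hd n a)).1

theorem integral_cubeD_sq (n : ℕ) (i j : Fin d) : Integrable (fun a => cubeD n a i j ^ 2) P ∧
    ∫ a, cubeD n a i j ^ 2 ∂P ≤ 2 * ((δ n)⁻¹ ^ 3 + M n ^ 3) + 2 * L := by
  have h := hS.integrable_of_le hd hL (n := n) (X := fun a => cubeD n a i j ^ 2)
    ((measurable_cubeD n i j).pow_const 2) zero_le_two fun a => by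
      rw [abs_of_nonneg (sq_nonneg _), ← sq_abs]
      exact (pow_le_pow_left₀ (abs_nonneg _)
        (abs_dirichletMatrix_le hd _ subset_rfl a i j) 2).trans (upperEll_sq_le hd n a)
  refine ⟨h.1, ?_⟩
  simpa only [abs_sq] using h.2

theorem memLp_cubeD (n : ℕ) (i j : Fin d) : MemLp (fun a => cubeD n a i j) 2 P :=
  (memLp_two_iff_integrable_sq (measurable_cubeD n i j).aestronglyMeasurable).mpr
    (integral_cubeD_sq hd hL hS n i j).1

theorem meanD_le (n : ℕ) (i j : Fin d) :
    |meanMatrix P (cubeD n) i j| ≤ 2 * ((δ n)⁻¹ ^ 3 + M n ^ 3) + 2 * L :=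
  abs_integral_le_integral_abs.trans
    (hS.integrable_of_le hd hL (n := n) (measurable_cubeD n i j) zero_le_two fun a =>
      (abs_dirichletMatrix_le hd _ subset_rfl a i j).trans (upperEll_le hd n a)).2

theorem meanN_le (n : ℕ) (i j : Fin d) :
    |meanMatrix P (cubeN n) i j| ≤ 2 * ((δ n)⁻¹ ^ 3 + M n ^ 3) + 2 * L :=
  abs_integral_le_integral_abs.trans
    (hS.integrable_of_le hd hL (n := n) (measurable_cubeN n i j) zero_le_two fun a =>
      (abs_neumannMatrix_le hd _ subset_rfl a i j).trans (inv_lowerEll_le hd n a)).2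

end

/-! ### Stationarity and subadditivity -/

section
variable {P : Measure (CoeffField d)} (hst : IsStationary P)
include hst

theorem integral_cell_entry (m : ℕ) (z : Fin d → ℤ) (i j : Fin d) :
    ∫ a, dirichletMatrix (bddOpen_cell m z) a i j ∂P = meanMatrix P (cubeD m) i j := by
  simp_rw [dirichletMatrix_cell]
  exact integral_shift hst z (measurable_cubeD m i j)

theorem integral_cell_quad_dirichlet (m : ℕ) (z : Fin d → ℤ) (p q : Vec d)
    (hi : ∀ i j, Integrable (fun a => cubeD m a i j) P) :
    Integrable (fun a => p ⬝ᵥ (dirichletMatrix (bddOpen_cell m z) a *ᵥ q)) P ∧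
    ∫ a, p ⬝ᵥ (dirichletMatrix (bddOpen_cell m z) a *ᵥ q) ∂P =
      p ⬝ᵥ (meanMatrix P (cubeD m) *ᵥ q) := by
  simp_rw [dirichletMatrix_cell]
  rw [integral_shift hst z (measurable_quad (measurable_cubeD m) p q), integral_quad hi]
  exact ⟨(hst.measurePreserving z).integrable_comp_of_integrable (integrable_quad hi p q), rfl⟩

theorem integral_cell_quad_neumann (m : ℕ) (z : Fin d → ℤ) (p q : Vec d)
    (hi : ∀ i j, Integrable (fun a => cubeN m a i j) P) :
    Integrable (fun a => p ⬝ᵥ (neumannMatrix (bddOpen_cell m z) a *ᵥ q)) P ∧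
    ∫ a, p ⬝ᵥ (neumannMatrix (bddOpen_cell m z) a *ᵥ q) ∂P =
      p ⬝ᵥ (meanMatrix P (cubeN m) *ᵥ q) := by
  simp_rw [neumannMatrix_cell]
  rw [integral_shift hst z (measurable_quad (measurable_cubeN m) p q), integral_quad hi]
  exact ⟨(hst.measurePreserving z).integrable_comp_of_integrable (integrable_quad hi p q), rfl⟩

/-- Subadditivity over the `3^d` subcubes, in expectation, where by stationarity all subcubes
contribute equally. -/
theorem meanD_quad_antitone (hi : ∀ n i j, Integrable (fun a => cubeD n a i j) P) (p : Vec d) :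
    Antitone fun n => p ⬝ᵥ (meanMatrix P (cubeD n) *ᵥ p) := by
  refine antitone_nat_of_succ_le fun m => ?_
  have h : ∀ a : CoeffField d, _ := fun a =>
    dirichletMatrix_subadditive (isSubdivision_cell m 1 0) a p
  simp only [volume_cell] at h
  have h1 := integral_mono (((integral_cell_quad_dirichlet hst (m + 1) 0 p p (hi _)).1).const_mul _)
    (integrable_finsetSum _ fun j _ =>
      ((integral_cell_quad_dirichlet hst m (subcenter m 1 0 j) p p (hi _)).1).const_mul _) h
  rw [integral_const_mul, integral_finsetSum _ fun j _ =>
      ((integral_cell_quad_dirichlet hst m (subcenter m 1 0 j) p p (hi _)).1).const_mul _] at h1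
  simp_rw [integral_const_mul, (integral_cell_quad_dirichlet hst _ _ p p (hi _)).2] at h1
  simp only [Finset.sum_const, Finset.card_univ, Fintype.card_pi, Fintype.card_fin,
    Finset.prod_const, nsmul_eq_mul] at h1
  push_cast at h1
  rw [← mul_assoc, ← mul_pow, ← pow_succ'] at h1
  exact le_of_mul_le_mul_left h1 (by positivity)

theorem meanN_quad_antitone (hi : ∀ n i j, Integrable (fun a => cubeN n a i j) P) (p : Vec d) :
    Antitone fun n => p ⬝ᵥ (meanMatrix P (cubeN n) *ᵥ p) := by
  refine antitone_nat_of_succ_le fun m => ?_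
  have h : ∀ a : CoeffField d, _ := fun a =>
    neumannMatrix_subadditive (isSubdivision_cell m 1 0) a p
  simp only [volume_cell] at h
  have h1 := integral_mono (((integral_cell_quad_neumann hst (m + 1) 0 p p (hi _)).1).const_mul _)
    (integrable_finsetSum _ fun j _ =>
      ((integral_cell_quad_neumann hst m (subcenter m 1 0 j) p p (hi _)).1).const_mul _) h
  rw [integral_const_mul, integral_finsetSum _ fun j _ =>
      ((integral_cell_quad_neumann hst m (subcenter m 1 0 j) p p (hi _)).1).const_mul _] at h1
  simp_rw [integral_const_mul, (integral_cell_quad_neumann hst _ _ p p (hi _)).2] at h1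
  simp only [Finset.sum_const, Finset.card_univ, Fintype.card_pi, Fintype.card_fin,
    Finset.prod_const, nsmul_eq_mul] at h1
  push_cast at h1
  rw [← mul_assoc, ← mul_pow, ← pow_succ'] at h1
  exact le_of_mul_le_mul_left h1 (by positivity)

end

/-! ### The recursion for the variance -/

/-- The sum of the variances of the entries of the Dirichlet matrix of `□_n`. -/
noncomputable def varD (P : Measure (CoeffField d)) (n : ℕ) : ℝ :=
  ∑ i, ∑ j, Var[fun a => cubeD n a i j; P]

theorem varD_nonneg (P : Measure (CoeffField d)) (n : ℕ) : 0 ≤ varD P n :=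
  Finset.sum_nonneg fun _ _ => Finset.sum_nonneg fun _ _ => variance_nonneg _ _

/-- The average of the Dirichlet matrices over the subcells of `□_{m+k}`. -/
noncomputable def averageD (m k : ℕ) (a : CoeffField d) : Mat d :=
  (((3 : ℝ) ^ k) ^ d)⁻¹ • ∑ j : Fin d → Fin (3 ^ k),
    dirichletMatrix (bddOpen_cell m (subcenter m k 0 j)) a

theorem averageD_quad (m k : ℕ) (a : CoeffField d) (p : Vec d) : p ⬝ᵥ (averageD m k a *ᵥ p) =
    (((3 : ℝ) ^ k) ^ d)⁻¹ * ∑ j : Fin d → Fin (3 ^ k),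
      p ⬝ᵥ (dirichletMatrix (bddOpen_cell m (subcenter m k 0 j)) a *ᵥ p) := by
  rw [averageD, Matrix.smul_mulVec, dotProduct_smul, Matrix.sum_mulVec, dotProduct_sum, smul_eq_mul]

theorem averageD_apply (m k : ℕ) (a : CoeffField d) (i j : Fin d) : averageD m k a i j =
    (((3 : ℝ) ^ k) ^ d)⁻¹ * ∑ z : Fin d → Fin (3 ^ k),
      dirichletMatrix (bddOpen_cell m (subcenter m k 0 z)) a i j := by
  simp [averageD, Matrix.sum_apply]

theorem averageD_isSymm (m k : ℕ) (a : CoeffField d) : (averageD m k a).IsSymm := by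
  ext i j
  rw [Matrix.transpose_apply, averageD_apply, averageD_apply]
  simp_rw [fun z => (dirichletMatrix_isSymm (bddOpen_cell m (subcenter m k 0 z)) a).apply i j]

theorem cubeD_quad_le_averageD (m k : ℕ) (a : CoeffField d) (p : Vec d) :
    p ⬝ᵥ (cubeD (m + k) a *ᵥ p) ≤ p ⬝ᵥ (averageD m k a *ᵥ p) := by
  have h := dirichletMatrix_subadditive (isSubdivision_cell m k 0) a p
  simp only [volume_cell] at h
  rw [averageD_quad, ← div_eq_inv_mul, le_div_iff₀ (by positivity)]
  rw [← Finset.mul_sum, pow_add, mul_pow, mul_assoc] at h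
  have := le_of_mul_le_mul_left h (by positivity)
  rw [cubeD]
  linarith

theorem averageD_quad_le (hd : 0 < d) (m k : ℕ) (a : CoeffField d) (p : Vec d) :
    p ⬝ᵥ (averageD m k a *ᵥ p) ≤ upperEll a (cube d (m + k)) * (p ⬝ᵥ p) := by
  rw [averageD_quad, ← div_eq_inv_mul, div_le_iff₀ (by positivity)]
  refine (Finset.sum_le_sum fun j _ => dirichletMatrix_le_upperEll hd
    (bddOpen_cell m (subcenter m k 0 j)) (subcell_subset m k 0 j) a p).trans (le_of_eq ?_)
  simp [Finset.card_univ]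
  ring

theorem measurable_averageD (m k : ℕ) (i j : Fin d) : Measurable fun a => averageD m k a i j := by
  simp_rw [averageD_apply]
  exact (Finset.measurable_sum _ fun z _ => measurable_dirichletMatrix' _ i j).const_mul _

theorem variance_add_le {Ω : Type*} [MeasurableSpace Ω] {P : Measure Ω} [IsProbabilityMeasure P]
    {X Y : Ω → ℝ} (hX : MemLp X 2 P) (hY : MemLp Y 2 P) :
    Var[X - Y; P] ≤ 2 * Var[X; P] + 2 * Var[Y; P] := by
  have h1 := variance_sub hX hY
  have h2 := variance_add hX hY
  have h3 := variance_nonneg (X + Y) P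
  linarith

section
variable {P : Measure (CoeffField d)} [IsProbabilityMeasure P] {L r : ℝ} {δ M : ℕ → ℝ}
  (hd : 0 < d) (hL : 0 ≤ L) (hS : IsSuppressive P L δ M) (hst : IsStationary P)
include hd hL hS hst

theorem memLp_cell_entry (m : ℕ) (z : Fin d → ℤ) (i j : Fin d) :
    MemLp (fun a => dirichletMatrix (bddOpen_cell m z) a i j) 2 P := by
  simp_rw [dirichletMatrix_cell]
  exact (memLp_cubeD hd hL hS m i j).comp_measurePreserving (hst.measurePreserving z)

theorem memLp_averageD (m k : ℕ) (i j : Fin d) : MemLp (fun a => averageD m k a i j) 2 P := by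
  simp_rw [averageD_apply]
  exact (memLp_finsetSum _ fun z _ => memLp_cell_entry hd hL hS hst m _ i j).const_mul _

theorem integral_averageD (m k : ℕ) (i j : Fin d) :
    ∫ a, averageD m k a i j ∂P = meanMatrix P (cubeD m) i j := by
  simp_rw [averageD_apply]
  rw [integral_const_mul, integral_finsetSum _ fun z _ =>
    (memLp_cell_entry hd hL hS hst m _ i j).integrable one_le_two]
  simp_rw [integral_cell_entry hst]
  simp [Finset.card_univ]

theorem variance_averageD_le (hmix : IsMixing P r) (hr : r ∈ Set.Ioo (0 : ℝ) 1) (m k : ℕ)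
    (i j : Fin d) : Var[fun a => averageD m k a i j; P] ≤
      2 ^ d * ((1 + r) / (1 - r)) * (((3 : ℝ) ^ k) ^ d)⁻¹ * Var[fun a => cubeD m a i j; P] := by
  have h := hmix.variance_sum_subcells_le hr m k
    (X := fun z a => dirichletMatrix (bddOpen_cell m (subcenter m k 0 z)) a i j)
    (fun z => memLp_cell_entry hd hL hS hst m _ i j) fun z => measurable_dirichletMatrix _ i j
  have hv : ∀ z : Fin d → ℤ, Var[fun a => dirichletMatrix (bddOpen_cell m z) a i j; P] =
      Var[fun a => cubeD m a i j; P] := by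
    intro z
    have h1 := (hst.measurePreserving z).variance_fun_comp (f := fun a => cubeD m a i j)
      (measurable_cubeD m i j).aemeasurable
    rw [← h1]
    refine congrArg (fun f => Var[f; P]) (funext fun a => ?_)
    rw [dirichletMatrix_cell]
  simp_rw [hv] at h
  have e : (fun a => averageD m k a i j) = fun a => (((3 : ℝ) ^ k) ^ d)⁻¹ *
      (∑ z, fun a => dirichletMatrix (bddOpen_cell m (subcenter m k 0 z)) a i j) a := by
    ext a
    rw [averageD_apply, Finset.sum_apply]
  rw [e, variance_const_mul]
  simp only [Finset.sum_const, Finset.card_univ, Fintype.card_pi, Fintype.card_fin,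
    Finset.prod_const, nsmul_eq_mul, Nat.cast_pow, Nat.cast_ofNat] at h
  have hN : (0 : ℝ) < ((3 : ℝ) ^ k) ^ d := by positivity
  calc _ ≤ (((3 : ℝ) ^ k) ^ d)⁻¹ ^ 2 * (2 ^ d * ((1 + r) / (1 - r)) *
        (((3 : ℝ) ^ k) ^ d * Var[fun a => cubeD m a i j; P])) := by gcongr
    _ = _ := by field_simp

/-- Write `D_{m+k}` as the average over subcells minus a matrix `Δ`, which is nonnegative by
subadditivity. The mixing condition handles the average. Each entry of `Δ` is at most `tr Δ`, whose
expectation is the drop of `tr E[D]` between the two scales. -/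
theorem varD_le (hmix : IsMixing P r) (hr : r ∈ Set.Ioo (0 : ℝ) 1) (m k : ℕ) :
    varD P (m + k) ≤ 2 * (2 ^ d * ((1 + r) / (1 - r)) * (((3 : ℝ) ^ k) ^ d)⁻¹) * varD P m +
      2 * d ^ 2 * (d * M (m + k) * ((meanMatrix P (cubeD m)).trace -
        (meanMatrix P (cubeD (m + k))).trace) +
        2 * d ^ 2 * L * Real.exp (-((m + k : ℕ) : ℝ))) := by
  set n := m + k with hn
  let Δ : CoeffField d → Mat d := fun a => averageD m k a - cubeD n a
  have hΔs : ∀ a, (Δ a).IsSymm := fun a => (averageD_isSymm m k a).sub (dirichletMatrix_isSymm _ a)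
  have hΔq : ∀ a p, p ⬝ᵥ (Δ a *ᵥ p) = p ⬝ᵥ (averageD m k a *ᵥ p) - p ⬝ᵥ (cubeD n a *ᵥ p) := by
    intro a p
    simp only [Δ, Matrix.sub_mulVec, dotProduct_sub]
  have hΔ0 : ∀ a p, 0 ≤ p ⬝ᵥ (Δ a *ᵥ p) := fun a p => by
    rw [hΔq]
    linarith [cubeD_quad_le_averageD m k a p]
  have hΔΛ : ∀ a p, p ⬝ᵥ (Δ a *ᵥ p) ≤ upperEll a (cube d n) * (p ⬝ᵥ p) := fun a p => by
    rw [hΔq]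
    have h1 := averageD_quad_le hd m k a p
    have h2 : 0 ≤ p ⬝ᵥ (cubeD n a *ᵥ p) := dirichletMatrix_nonneg _ a p
    linarith
  have hdiag : ∀ a i, 0 ≤ Δ a i i ∧ Δ a i i ≤ upperEll a (cube d n) := by
    intro a i
    have h1 := hΔ0 a (Pi.single i 1)
    have h2 := hΔΛ a (Pi.single i 1)
    simp only [Matrix.mulVec_single_one, single_one_dotProduct, Matrix.col_apply,
      Pi.single_eq_same, mul_one] at h1 h2
    exact ⟨h1, h2⟩
  have htr0 : ∀ a, 0 ≤ (Δ a).trace := fun a => Finset.sum_nonneg fun i _ => (hdiag a i).1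
  have htr : ∀ a, (Δ a).trace ≤ d * upperEll a (cube d n) := fun a =>
    (Finset.sum_le_sum fun i _ => (hdiag a i).2).trans (by simp)
  have hΔm : ∀ i j, Measurable fun a => Δ a i j := fun i j =>
    (measurable_averageD m k i j).sub (measurable_cubeD n i j)
  have hΔL : ∀ i j, MemLp (fun a => Δ a i j) 2 P := fun i j =>
    (memLp_averageD hd hL hS hst m k i j).sub (memLp_cubeD hd hL hS n i j)
  have htrm : Measurable fun a => (Δ a).trace := Finset.measurable_sum _ fun i _ => hΔm i i
  have htri : Integrable (fun a => (Δ a).trace) P :=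
    integrable_finsetSum _ fun i _ => (hΔL i i).integrable one_le_two
  have hM := hS.M_pos n
  -- On the good event `(tr Δ)² ≤ d M_n tr Δ`, so the second moment becomes linear in `E[tr Δ]`. On
  -- the bad event `(tr Δ)² ≤ d² Λ² ≤ 2 d² ellCube`.
  obtain ⟨hX1, hX2⟩ := hS.integral_le hL (n := n) (X := fun a => (Δ a).trace ^ 2)
    (Y := fun a => d * M n * (Δ a).trace) (K := 2 * d ^ 2) (htrm.pow_const 2)
    (fun a => sq_nonneg _) (htrm.const_mul _)
    (fun a => by have := htr0 a; positivity) (htri.const_mul _) (by positivity)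
    (fun a => by
      have h1 := pow_le_pow_left₀ (htr0 a) (htr a) 2
      have h2 := mul_le_mul_of_nonneg_left (upperEll_sq_le hd n a) (sq_nonneg (d : ℝ))
      rw [mul_pow] at h1
      linarith)
    (fun a _ ha => by
      have h1 : (Δ a).trace ≤ d * M n := (htr a).trans (by gcongr)
      rw [sq]
      exact mul_le_mul_of_nonneg_right h1 (htr0 a))
  have hEtr : ∫ a, (Δ a).trace ∂P =
      (meanMatrix P (cubeD m)).trace - (meanMatrix P (cubeD n)).trace := by
    simp only [Matrix.trace, Matrix.diag]
    rw [integral_finsetSum _ fun i _ => (hΔL i i).integrable one_le_two, ← Finset.sum_sub_distrib]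
    refine Finset.sum_congr rfl fun i _ => ?_
    rw [← integral_averageD hd hL hS hst m k]
    exact integral_sub ((memLp_averageD hd hL hS hst m k i i).integrable one_le_two)
      (integrable_cubeD hd hL hS n i i)
  rw [integral_const_mul, hEtr] at hX2
  have hent : ∀ i j, Var[fun a => cubeD n a i j; P] ≤
      2 * (2 ^ d * ((1 + r) / (1 - r)) * (((3 : ℝ) ^ k) ^ d)⁻¹) * Var[fun a => cubeD m a i j; P] +
        2 * ∫ a, (Δ a).trace ^ 2 ∂P := by
    intro i j
    have e : (fun a => cubeD n a i j) = (fun a => averageD m k a i j) - fun a => Δ a i j := by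
      ext a
      simp [Δ]
    have h1 := variance_add_le (memLp_averageD hd hL hS hst m k i j) (hΔL i j)
    rw [← e] at h1
    have h2 := variance_averageD_le hd hL hS hst hmix hr m k i j
    have h3 : Var[fun a => Δ a i j; P] ≤ ∫ a, (Δ a).trace ^ 2 ∂P := by
      refine (variance_le_expectation_sq (hΔm i j).aestronglyMeasurable).trans ?_
      refine integral_mono (hΔL i j).integrable_sq hX1 fun a => ?_
      exact entry_sq_le_trace_sq (hΔs a) (hΔ0 a) i j
    linarith
  have hsum := Finset.sum_le_sum fun i (_ : i ∈ Finset.univ) =>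
    Finset.sum_le_sum fun j (_ : j ∈ Finset.univ) => hent i j
  simp only [Finset.sum_add_distrib, ← Finset.mul_sum, Finset.sum_const, Finset.card_univ,
    Fintype.card_fin, nsmul_eq_mul] at hsum
  rw [varD, varD]
  refine hsum.trans (add_le_add_right ?_ _)
  calc _ = 2 * (d : ℝ) ^ 2 * ∫ a, (Δ a).trace ^ 2 ∂P := by ring
    _ ≤ _ := mul_le_mul_of_nonneg_left (by linarith) (by positivity)

end

/-! ### The recursion for the response -/

theorem response_subadditive (a : CoeffField d) (m k : ℕ) (p q : Vec d) :
    (3 ^ (m + k)) ^ d * response (bddOpen_cell (m + k) 0) a p q ≤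
      (3 ^ m) ^ d * sumResponse a m k p q := by
  have h := sum_energy_responseField_sub_le (isSubdivision_cell m k 0) a p q
  have h2 : (0 : ℝ) ≤ _ := (Finset.sum_nonneg fun j _ => energy_self_nonneg a _).trans h
  simp only [volume_cell, ← Finset.mul_sum] at h2
  rw [sumResponse]
  linarith

/-- The response for the mean matrices of `□_n`. -/
noncomputable def meanResponse (P : Measure (CoeffField d)) (n : ℕ) (p q : Vec d) : ℝ :=
  (1 / 2 : ℝ) * (p ⬝ᵥ (meanMatrix P (cubeD n) *ᵥ p)) +
    (1 / 2 : ℝ) * (q ⬝ᵥ (meanMatrix P (cubeN n) *ᵥ q)) - p ⬝ᵥ q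

theorem measurable_response (m : ℕ) (z : Fin d → ℤ) (p q : Vec d) :
    Measurable fun a => response (bddOpen_cell m z) a p q :=
  (((measurable_quad (measurable_dirichletMatrix' _) p p).const_mul _).add
    ((measurable_quad (measurable_neumannMatrix' _) q q).const_mul _)).sub_const _

theorem response_le_ellCube (hd : 0 < d) {m n : ℕ} {z : Fin d → ℤ} (h : cell m z ⊆ cell n 0)
    (a : CoeffField d) (p q : Vec d) :
    response (bddOpen_cell m z) a p q ≤ 2 * (p ⬝ᵥ p + q ⬝ᵥ q) * ellCube n a := by
  have h1 := dirichletMatrix_le_upperEll hd (bddOpen_cell m z) h a p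
  have h2 := neumannMatrix_le_lowerEll hd (bddOpen_cell m z) h a q
  have h3 := mul_le_mul_of_nonneg_right (upperEll_le hd n a) (dot_self_nonneg p)
  have h4 := mul_le_mul_of_nonneg_right (inv_lowerEll_le hd n a) (dot_self_nonneg q)
  have h5 := mul_le_mul_of_nonneg_right (one_le_ellCube hd n a) (dot_self_nonneg p)
  have h6 := mul_le_mul_of_nonneg_right (one_le_ellCube hd n a) (dot_self_nonneg q)
  have h7 := dot_self_nonneg (p + q)
  simp only [add_dotProduct, dotProduct_add, dotProduct_comm q p] at h7
  rw [response]
  linarith [dot_self_nonneg p, dot_self_nonneg q]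

section
variable {P : Measure (CoeffField d)} [IsProbabilityMeasure P] {L r : ℝ} {δ M : ℕ → ℝ}
  (hd : 0 < d) (hL : 0 ≤ L) (hS : IsSuppressive P L δ M) (hst : IsStationary P)
include hd hL hS hst

theorem integral_response (m : ℕ) (z : Fin d → ℤ) (p q : Vec d) :
    Integrable (fun a => response (bddOpen_cell m z) a p q) P ∧
      ∫ a, response (bddOpen_cell m z) a p q ∂P = meanResponse P m p q := by
  obtain ⟨h1, h2⟩ := integral_cell_quad_dirichlet hst m z p p (integrable_cubeD hd hL hS m)
  obtain ⟨h3, h4⟩ := integral_cell_quad_neumann hst m z q q (integrable_cubeN hd hL hS m)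
  have h5 := (h1.const_mul (1 / 2)).add (h3.const_mul (1 / 2))
  refine ⟨h5.sub (integrable_const _), ?_⟩
  simp only [response]
  rw [integral_sub (by exact h5) (integrable_const _),
    integral_add (h1.const_mul _) (h3.const_mul _), integral_const_mul, integral_const_mul, h2, h4,
    integral_const, probReal_univ, one_smul, meanResponse]

theorem integral_sumResponse (m k : ℕ) (p q : Vec d) :
    Integrable (fun a => sumResponse a m k p q) P ∧
      ∫ a, sumResponse a m k p q ∂P = (3 ^ k) ^ d * meanResponse P m p q := by
  refine ⟨integrable_finsetSum _ fun j _ => (integral_response hd hL hS hst m _ p q).1, ?_⟩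
  simp only [sumResponse]
  rw [integral_finsetSum _ fun j _ => (integral_response hd hL hS hst m _ p q).1]
  simp [(integral_response hd hL hS hst m _ p q).2, Finset.card_univ]

theorem meanResponse_nonneg (n : ℕ) (p q : Vec d) : 0 ≤ meanResponse P n p q := by
  rw [← (integral_response hd hL hS hst n 0 p q).2]
  exact integral_nonneg fun a => response_nonneg _ a p q

theorem meanResponse_antitone (p q : Vec d) : Antitone fun n => meanResponse P n p q := by
  intro m n hmn
  have h1 := meanD_quad_antitone hst (integrable_cubeD hd hL hS) p hmn
  have h2 := meanN_quad_antitone hst (integrable_cubeN hd hL hS) q hmn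
  simp only [meanResponse] at h1 h2 ⊢
  linarith

/-- Cauchy–Schwarz in each row bounds `|(E[D] - D)p|²` by the sum of the squared entries of `E[D] -
D` times `|p|²`. -/
theorem integral_flux_deviation (m : ℕ) (z : Fin d → ℤ) (p : Vec d) :
    Integrable (fun a => (meanMatrix P (cubeD m) *ᵥ p -
      dirichletMatrix (bddOpen_cell m z) a *ᵥ p) ⬝ᵥ (meanMatrix P (cubeD m) *ᵥ p -
      dirichletMatrix (bddOpen_cell m z) a *ᵥ p)) P ∧
    ∫ a, (meanMatrix P (cubeD m) *ᵥ p - dirichletMatrix (bddOpen_cell m z) a *ᵥ p) ⬝ᵥ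
      (meanMatrix P (cubeD m) *ᵥ p - dirichletMatrix (bddOpen_cell m z) a *ᵥ p) ∂P ≤
      varD P m * (p ⬝ᵥ p) := by
  let g : CoeffField d → ℝ := fun a => (meanMatrix P (cubeD m) *ᵥ p - cubeD m a *ᵥ p) ⬝ᵥ
    (meanMatrix P (cubeD m) *ᵥ p - cubeD m a *ᵥ p)
  have hgm : Measurable g := by
    simp only [g, dotProduct, Pi.sub_apply, Matrix.mulVec]
    have h1 : ∀ i, Measurable fun a => ∑ j, meanMatrix P (cubeD m) i j * p j -
        ∑ j, cubeD m a i j * p j := fun i => measurable_const.sub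
      (Finset.measurable_sum _ fun j _ => (measurable_cubeD m i j).mul_const _)
    exact Finset.measurable_sum _ fun i _ => (h1 i).mul (h1 i)
  let b : CoeffField d → ℝ := fun a =>
    (∑ i, ∑ j, (cubeD m a i j - ∫ a', cubeD m a' i j ∂P) ^ 2) * (p ⬝ᵥ p)
  have hbi : ∀ i j, Integrable (fun a => (cubeD m a i j - ∫ a', cubeD m a' i j ∂P) ^ 2) P :=
    fun i j => ((memLp_cubeD hd hL hS m i j).sub (memLp_const _)).integrable_sq
  have hb : Integrable b P := (integrable_finsetSum _ fun i _ =>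
    integrable_finsetSum _ fun j _ => hbi i j).mul_const _
  have hgb : ∀ a, g a ≤ b a := by
    intro a
    simp only [g, b, Finset.sum_mul, ← Matrix.sub_mulVec]
    rw [dotProduct]
    refine Finset.sum_le_sum fun i _ => ?_
    have h1 := dot_sq_le ((meanMatrix P (cubeD m) - cubeD m a) i) p
    rw [← sq]
    refine h1.trans (le_of_eq ?_)
    rw [dotProduct, Finset.sum_mul]
    refine Finset.sum_congr rfl fun j _ => ?_
    simp only [Matrix.sub_apply, meanMatrix, Matrix.of_apply]
    ring
  have hg0 : ∀ a, 0 ≤ g a := fun a => dot_self_nonneg _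
  have hgi : Integrable g P := hb.mono' hgm.aestronglyMeasurable (ae_of_all _ fun a => by
    rw [Real.norm_eq_abs, abs_of_nonneg (hg0 a)]
    exact hgb a)
  have hint : ∫ a, g a ∂P ≤ varD P m * (p ⬝ᵥ p) := by
    refine (integral_mono hgi hb hgb).trans (le_of_eq ?_)
    simp only [b]
    rw [integral_mul_const, integral_finsetSum _ fun i _ =>
      integrable_finsetSum _ fun j _ => hbi i j, varD]
    simp_rw [integral_finsetSum _ fun j _ => hbi _ j]
    congr 1
    refine Finset.sum_congr rfl fun i _ => Finset.sum_congr rfl fun j _ => ?_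
    rw [variance_eq_integral (measurable_cubeD m i j).aemeasurable]
  have e : ∀ a, (meanMatrix P (cubeD m) *ᵥ p - dirichletMatrix (bddOpen_cell m z) a *ᵥ p) ⬝ᵥ
      (meanMatrix P (cubeD m) *ᵥ p - dirichletMatrix (bddOpen_cell m z) a *ᵥ p) =
      g (shift (fun i => (z i : ℝ)) a) := fun a => by rw [dirichletMatrix_cell]
  simp_rw [e]
  refine ⟨(hst.measurePreserving z).integrable_comp_of_integrable hgi, ?_⟩
  rw [integral_shift hst z hgm]
  exact hint

end

theorem response_recursion_arith {j' j₀ j T Θ D δ' M' C E V : ℝ} (hD : 1 ≤ D) (hδ : 0 < δ')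
    (hC : 0 < C) (hj1 : j ≤ j') (hj2 : j' ≤ j₀) (hV : 0 ≤ V) (hVT : T ≤ V) (hΘ : Θ = M' / δ')
    (hinv : δ'⁻¹ ≤ Θ) (hΘ1 : 1 ≤ Θ)
    (h : j' ≤ (4 * D * (j' - j) + 1 / (2 * D) * (D * j) +
      C / (1 / (2 * D) * δ') * (M' * (D * (j₀ - j)) + D * T)) + E) :
    j ≤ (8 * D + 4 * C * D ^ 2) * Θ * (j₀ - j) + (8 * D + 4 * C * D ^ 2) * Θ * V + 2 * E := by
  have hD0 : 0 < D := by linarith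
  have e1 : 1 / (2 * D) * (D * j) = j / 2 := by field_simp
  have e2 : C / (1 / (2 * D) * δ') * (M' * (D * (j₀ - j)) + D * T) =
      2 * C * D ^ 2 * (Θ * (j₀ - j) + δ'⁻¹ * T) := by
    rw [hΘ]
    field_simp
  rw [e1, e2] at h
  have hx : 0 ≤ j₀ - j := by linarith
  have h1 : δ'⁻¹ * T ≤ Θ * V :=
    (mul_le_mul_of_nonneg_left hVT (inv_pos.mpr hδ).le).trans (mul_le_mul_of_nonneg_right hinv hV)
  have h2 : D * (j' - j) ≤ D * Θ * (j₀ - j) := by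
    have h3 : D * (j' - j) ≤ D * (j₀ - j) := mul_le_mul_of_nonneg_left (by linarith) hD0.le
    have h4 : D * (j₀ - j) ≤ D * Θ * (j₀ - j) := by
      nlinarith [mul_nonneg (mul_nonneg hD0.le hx) (sub_nonneg.mpr hΘ1)]
    linarith
  have h5 : 0 ≤ D * Θ * V := by positivity
  have h6 : 2 * C * D ^ 2 * (Θ * (j₀ - j) + δ'⁻¹ * T) ≤
      2 * C * D ^ 2 * (Θ * (j₀ - j) + Θ * V) :=
    mul_le_mul_of_nonneg_left (by linarith) (by positivity)
  nlinarith

/-- The expectation of `exists_response_le` with `q = E[D_m]p` and the deterministic ellipticity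
bounds `δ_n` and `M_n`, for `n = m + k + 1`. Since the mean response is nonincreasing in the scale,
the one-scale drop is dominated by the drop from `m` to `n`. -/
theorem exists_meanResponse_le (d : ℕ) : ∃ C > 0, ∀ (P : Measure (CoeffField d))
    [IsProbabilityMeasure P] (L : ℝ) (δ M : ℕ → ℝ), 0 < d → 0 ≤ L → IsSuppressive P L δ M →
    IsStationary P → ∀ (m k : ℕ) (p : Vec d), C * (M (m + (k + 1)) / δ (m + (k + 1))) ≤ 9 ^ (k + 1) →
    meanResponse P (m + (k + 1)) p (meanMatrix P (cubeD m) *ᵥ p) ≤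
      C * (M (m + (k + 1)) / δ (m + (k + 1))) *
        (meanResponse P m p (meanMatrix P (cubeD m) *ᵥ p) -
          meanResponse P (m + (k + 1)) p (meanMatrix P (cubeD m) *ᵥ p)) +
      C * (M (m + (k + 1)) / δ (m + (k + 1))) * (varD P m * (p ⬝ᵥ p)) +
      4 * (p ⬝ᵥ p + (meanMatrix P (cubeD m) *ᵥ p) ⬝ᵥ (meanMatrix P (cubeD m) *ᵥ p)) * L *
        Real.exp (-((m + (k + 1) : ℕ) : ℝ)) := by
  obtain ⟨C, hC, hmain⟩ := exists_response_le d
  refine ⟨(8 * 3 ^ d + 4 * C * (3 ^ d) ^ 2), by positivity, ?_⟩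
  intro P _ L δ M hd hL hS hst m k p hsmall
  set n := m + (k + 1) with hn
  set q := meanMatrix P (cubeD m) *ᵥ p with hq
  set D : ℝ := 3 ^ d with hD
  have hD1 : 1 ≤ D := one_le_pow₀ (by norm_num)
  have hD0 : 0 < D := by linarith
  have hδ := hS.δ_pos n
  have hM := hS.M_pos n
  -- The leftover term of `exists_response_le` is weighted by the volume of `□_n`, which is `D =
  -- 3^d` times that of `□_{m+k}`. With `ε = 1/(2D)` it becomes half the response on `□_n` and can
  -- be absorbed.
  have hε1 : 1 / (2 * D) ≤ 1 := by
    rw [div_le_one (by positivity)]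
    linarith
  have hΘ1 : 1 ≤ M n / δ n := (hS.one_le_M n).trans (hS.M_le_ratio n)
  have hcond : C * (M n / δ n) ≤ (1 / (2 * D)) ^ 2 * 9 ^ (k + 1) := by
    have h1 : 4 * C * D ^ 2 * (M n / δ n) ≤ 9 ^ (k + 1) := by
      have : 0 ≤ 8 * D * (M n / δ n) := by positivity
      nlinarith
    have e : (1 / (2 * D)) ^ 2 * 9 ^ (k + 1) = (9 ^ (k + 1)) / (4 * D ^ 2) := by field_simp; ring
    rw [e, le_div_iff₀ (by positivity)]
    linarith
  set W : ℝ := (3 ^ (m + k)) ^ d with hW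
  have hW0 : 0 < W := by positivity
  have hWn : ((3 : ℝ) ^ n) ^ d = W * D := by
    rw [hW, hD, hn, ← mul_pow]
    ring
  have hWm : ((3 : ℝ) ^ m) ^ d * (3 ^ (k + 1)) ^ d = W * D := by
    rw [← hWn, hn, ← mul_pow, ← pow_add]
  let S : CoeffField d → ℝ := fun a => ∑ j : Fin d → Fin (3 ^ (k + 1)),
    (q - dirichletMatrix (bddOpen_cell m (subcenter m (k + 1) 0 j)) a *ᵥ p) ⬝ᵥ
      (q - dirichletMatrix (bddOpen_cell m (subcenter m (k + 1) 0 j)) a *ᵥ p)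
  let Jn : CoeffField d → ℝ := fun a => response (bddOpen_cell n 0) a p q
  let Y : CoeffField d → ℝ := fun a =>
    4 * (W * sumResponse a (m + k) 1 p q - W * D * Jn a) + 1 / (2 * D) * (W * D * Jn a) +
      C / (1 / (2 * D) * δ n) * (M n * ((3 ^ m) ^ d * sumResponse a m (k + 1) p q - W * D * Jn a) +
        (3 ^ m) ^ d * S a)
  obtain ⟨iJ, eJ⟩ := integral_response hd hL hS hst n 0 p q
  obtain ⟨i1, e1⟩ := integral_sumResponse hd hL hS hst (m + k) 1 p q
  obtain ⟨i2, e2⟩ := integral_sumResponse hd hL hS hst m (k + 1) p q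
  have iS' := fun j : Fin d → Fin (3 ^ (k + 1)) =>
    integral_flux_deviation hd hL hS hst m (subcenter m (k + 1) 0 j) p
  have iS : Integrable S P := integrable_finsetSum _ fun j _ => (iS' j).1
  set T := (((3 : ℝ) ^ (k + 1)) ^ d)⁻¹ * ∫ a, S a ∂P with hT
  have eS : ∫ a, S a ∂P = (3 ^ (k + 1)) ^ d * T := by
    rw [hT, ← mul_assoc, mul_inv_cancel₀ (by positivity), one_mul]
  have hTV : T ≤ varD P m * (p ⬝ᵥ p) := by
    rw [hT, ← div_eq_inv_mul, div_le_iff₀ (by positivity)]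
    have : ∫ a, S a ∂P = ∑ j, _ := integral_finsetSum _ fun j _ => (iS' j).1
    rw [this]
    refine (Finset.sum_le_sum fun j _ => (iS' j).2).trans (le_of_eq ?_)
    simp [Finset.card_univ]
    ring
  have iY1 : Integrable (fun a => W * sumResponse a (m + k) 1 p q - W * D * Jn a) P :=
    (i1.const_mul _).sub (iJ.const_mul _)
  have iY2 : Integrable (fun a => (3 ^ m) ^ d * sumResponse a m (k + 1) p q - W * D * Jn a) P :=
    (i2.const_mul _).sub (iJ.const_mul _)
  have iY3 : Integrable (fun a => 1 / (2 * D) * (W * D * Jn a)) P :=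
    (iJ.const_mul (W * D)).const_mul _
  have iY4 : Integrable (fun a => M n * ((3 ^ m) ^ d * sumResponse a m (k + 1) p q -
      W * D * Jn a) + (3 ^ m) ^ d * S a) P := (iY2.const_mul _).add (iS.const_mul _)
  have iY5 : Integrable (fun a => 4 * (W * sumResponse a (m + k) 1 p q - W * D * Jn a) +
      1 / (2 * D) * (W * D * Jn a)) P := (iY1.const_mul _).add iY3
  have iY : Integrable Y P := iY5.add (iY4.const_mul _)
  have eY : ∫ a, Y a ∂P = W * (4 * D * (meanResponse P (m + k) p q - meanResponse P n p q) +
      1 / (2 * D) * (D * meanResponse P n p q) + C / (1 / (2 * D) * δ n) *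
        (M n * (D * (meanResponse P m p q - meanResponse P n p q)) + D * T)) := by
    simp only [Y]
    rw [integral_add iY5 (iY4.const_mul _), integral_add (iY1.const_mul _) iY3,
      integral_const_mul, integral_const_mul, integral_const_mul, integral_const_mul,
      integral_add (iY2.const_mul _) (iS.const_mul _), integral_const_mul, integral_const_mul,
      integral_sub (i1.const_mul _) (iJ.const_mul _), integral_sub (i2.const_mul _) (iJ.const_mul _)]
    simp only [integral_const_mul]
    rw [e1, e2, eS, ← mul_assoc ((3 ^ m) ^ d : ℝ), ← mul_assoc ((3 ^ m) ^ d : ℝ), hWm]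
    simp only [Jn, eJ, pow_one, ← hD]
    ring
  have hJ0 : ∀ a, 0 ≤ Jn a := fun a => response_nonneg _ a p q
  have hY0 : ∀ a, 0 ≤ Y a := by
    intro a
    have h1 := response_subadditive a (m + k) 1 p q
    have h2 := response_subadditive a m (k + 1) p q
    rw [show m + k + 1 = n from by omega, hWn, ← hW] at h1
    rw [← hn, hWn] at h2
    have h3 : 0 ≤ S a := Finset.sum_nonneg fun j _ => dot_self_nonneg _
    have h4 := hJ0 a
    have h5 : 0 ≤ W * sumResponse a (m + k) 1 p q - W * D * Jn a := sub_nonneg.mpr h1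
    have h6 : 0 ≤ (3 ^ m) ^ d * sumResponse a m (k + 1) p q - W * D * Jn a := sub_nonneg.mpr h2
    simp only [Y]
    positivity
  have mR : ∀ m k, Measurable fun a : CoeffField d => sumResponse a m k p q := fun m k =>
    Finset.measurable_sum _ fun j _ => measurable_response m _ p q
  have mS : Measurable S := by
    refine Finset.measurable_sum _ fun j _ => ?_
    have h1 : ∀ i, Measurable fun a : CoeffField d => (q - dirichletMatrix
        (bddOpen_cell m (subcenter m (k + 1) 0 j)) a *ᵥ p) i := by
      intro i
      simp only [Pi.sub_apply, Matrix.mulVec, dotProduct]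
      exact measurable_const.sub
        (Finset.measurable_sum _ fun l _ => (measurable_dirichletMatrix' _ i l).mul_const _)
    simp only [dotProduct]
    exact Finset.measurable_sum _ fun i _ => (h1 i).mul (h1 i)
  have mJ : Measurable Jn := measurable_response n 0 p q
  have mY : Measurable Y :=
    (((((mR _ _).const_mul _).sub (mJ.const_mul _)).const_mul _).add
      ((mJ.const_mul _).const_mul _)).add (((((mR _ _).const_mul _).sub
        (mJ.const_mul _)).const_mul _).add (mS.const_mul _) |>.const_mul _)
  have hsubset : cell (m + k) (0 : Fin d → ℤ) ⊆ cell n 0 := by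
    have := subcell_subset (m + k) 1 (0 : Fin d → ℤ) (fun _ => 1)
    rwa [subcenter_central] at this
  have hpq : 0 ≤ p ⬝ᵥ p + q ⬝ᵥ q := add_nonneg (dot_self_nonneg p) (dot_self_nonneg q)
  -- The estimated variable is the response on the smaller cube `□_{m+k}`, whereas the good event
  -- concerns the ellipticity in `□_n`, where the deterministic estimate takes place.
  obtain ⟨-, hX⟩ := hS.integral_le hL (n := n) (Y := fun a => W⁻¹ * Y a)
    (measurable_response (m + k) 0 p q) (fun a => response_nonneg _ a p q) (mY.const_mul _)
    (fun a => mul_nonneg (inv_pos.mpr hW0).le (hY0 a)) (iY.const_mul _)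
    (K := 2 * (p ⬝ᵥ p + q ⬝ᵥ q)) (by positivity)
    (fun a => response_le_ellCube hd hsubset a p q) (fun a h1 h2 => by
      rw [← div_eq_inv_mul, le_div_iff₀ hW0, mul_comm]
      have h3 := hmain a m k (δ n) (M n) (1 / (2 * D)) hδ
        ((hS.δ_le_one n).trans (hS.one_le_M n)) (by positivity) hε1 ?_ hcond p q
      · rw [← hn, hWn, ← hW] at h3
        exact h3
      · refine (ell_spec_cell hd n a).2.2.mono fun x hx ξ => ⟨?_, ?_⟩
        · exact (mul_le_mul_of_nonneg_right h1.le (dot_self_nonneg ξ)).trans (hx ξ).1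
        · exact (hx ξ).2.trans (mul_le_mul_of_nonneg_right h2.le (dot_self_nonneg ξ)))
  rw [(integral_response hd hL hS hst (m + k) 0 p q).2, integral_const_mul, eY, ← mul_assoc,
    inv_mul_cancel₀ hW0.ne', one_mul] at hX
  have ha := meanResponse_antitone hd hL hS hst p q
  have hfin := response_recursion_arith hD1 hδ hC (ha (show m + k ≤ n by omega))
    (ha (show m ≤ m + k by omega)) (mul_nonneg (varD_nonneg P m) (dot_self_nonneg p)) hTV rfl
    (hS.inv_le_ratio n) hΘ1 hX
  refine hfin.trans (le_of_eq ?_)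
  ring

/-! ### The recursion for the traces -/

/-- The operator norm is at most the Frobenius norm, which for a nonnegative matrix is at most the
trace since `A_ij² ≤ A_ii A_jj`. -/
theorem quad_le_trace {A : Mat d} (hs : A.IsSymm) (hA : ∀ x, 0 ≤ x ⬝ᵥ (A *ᵥ x)) (p : Vec d) :
    p ⬝ᵥ (A *ᵥ p) ≤ A.trace * (p ⬝ᵥ p) := by
  have h2 : ∀ i, 0 ≤ A i i := fun i => by
    have := hA (Pi.single i 1)
    simpa using this
  have h0 : 0 ≤ A.trace := Finset.sum_nonneg fun i _ => h2 i
  have h1 : opNorm A ^ 2 ≤ A.trace ^ 2 := by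
    refine (opNorm_sq_le A).trans ?_
    rw [sq A.trace, Matrix.trace, Finset.sum_mul_sum]
    refine Finset.sum_le_sum fun i _ => Finset.sum_le_sum fun j _ => ?_
    have h1 := quad_cauchy_schwarz hs hA (Pi.single i 1) (Pi.single j 1)
    simpa only [Matrix.mulVec_single_one, single_one_dotProduct, Matrix.col_apply, Matrix.diag_apply] using h1
  refine (le_abs_self _).trans ((quad_le_opNorm A p).trans ?_)
  exact mul_le_mul_of_nonneg_right (le_of_sq_le_sq h1 h0) (dot_self_nonneg p)

/-- The sum of the traces of the mean Dirichlet and Neumann matrices of `□_n`. -/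
noncomputable def traceSum (P : Measure (CoeffField d)) (n : ℕ) : ℝ :=
  (meanMatrix P (cubeD n)).trace + (meanMatrix P (cubeN n)).trace

theorem meanD_isSymm (P : Measure (CoeffField d)) (n : ℕ) : (meanMatrix P (cubeD n)).IsSymm :=
  meanMatrix_isSymm fun a => dirichletMatrix_isSymm _ a

theorem meanN_isSymm (P : Measure (CoeffField d)) (n : ℕ) : (meanMatrix P (cubeN n)).IsSymm :=
  meanMatrix_isSymm fun a => neumannMatrix_isSymm _ a

theorem diag_eq_quad (A : Mat d) (i : Fin d) :
    A i i = Pi.single i 1 ⬝ᵥ (A *ᵥ Pi.single i 1) := by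
  simp

section
variable {P : Measure (CoeffField d)} [IsProbabilityMeasure P] {L r : ℝ} {δ M : ℕ → ℝ}
  (hd : 0 < d) (hL : 0 ≤ L) (hS : IsSuppressive P L δ M) (hst : IsStationary P)
include hd hL hS

theorem meanD_nonneg (n : ℕ) (p : Vec d) : 0 ≤ p ⬝ᵥ (meanMatrix P (cubeD n) *ᵥ p) := by
  rw [← integral_quad (integrable_cubeD hd hL hS n)]
  exact integral_nonneg fun a => dirichletMatrix_nonneg _ a p

theorem meanN_nonneg (n : ℕ) (p : Vec d) : 0 ≤ p ⬝ᵥ (meanMatrix P (cubeN n) *ᵥ p) := by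
  rw [← integral_quad (integrable_cubeN hd hL hS n)]
  exact integral_nonneg fun a => neumannMatrix_nonneg _ a p

theorem traceSum_nonneg (n : ℕ) : 0 ≤ traceSum P n := by
  refine add_nonneg (Finset.sum_nonneg fun i _ => ?_) (Finset.sum_nonneg fun i _ => ?_)
  · exact (meanD_nonneg hd hL hS n _).trans (diag_eq_quad (meanMatrix P (cubeD n)) i).ge
  · exact (meanN_nonneg hd hL hS n _).trans (diag_eq_quad (meanMatrix P (cubeN n)) i).ge

/-- The normalization `δ_0 = M_0 = 1` gives bounds at scale zero that depend on `d` and `L` only;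
monotonicity in `n` then makes them uniform. -/
theorem trace_zero_le : (meanMatrix P (cubeD 0)).trace ≤ d * (4 + 2 * L) ∧
    (meanMatrix P (cubeN 0)).trace ≤ d * (4 + 2 * L) := by
  have h1 := meanD_le hd hL hS 0
  have h2 := meanN_le hd hL hS 0
  rw [hS.δ_zero, hS.M_zero] at h1 h2
  constructor
  · refine (Finset.sum_le_sum fun i _ => (le_abs_self _).trans (h1 i i)).trans (le_of_eq ?_)
    simp
    ring
  · refine (Finset.sum_le_sum fun i _ => (le_abs_self _).trans (h2 i i)).trans (le_of_eq ?_)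
    simp
    ring

include hst

theorem meanD_sub_quad {m n : ℕ} (hmn : m ≤ n) (p : Vec d) :
    0 ≤ p ⬝ᵥ ((meanMatrix P (cubeD m) - meanMatrix P (cubeD n)) *ᵥ p) := by
  have h := meanD_quad_antitone hst (integrable_cubeD hd hL hS) p hmn
  rw [Matrix.sub_mulVec, dotProduct_sub]
  exact sub_nonneg.mpr h

theorem meanN_sub_quad {m n : ℕ} (hmn : m ≤ n) (p : Vec d) :
    0 ≤ p ⬝ᵥ ((meanMatrix P (cubeN m) - meanMatrix P (cubeN n)) *ᵥ p) := by
  have h := meanN_quad_antitone hst (integrable_cubeN hd hL hS) p hmn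
  rw [Matrix.sub_mulVec, dotProduct_sub]
  exact sub_nonneg.mpr h

theorem traceD_antitone : Antitone fun n => (meanMatrix P (cubeD n)).trace := fun m n hmn =>
  Finset.sum_le_sum fun i _ => by
    simp only [Matrix.diag_apply, diag_eq_quad]
    exact meanD_quad_antitone hst (integrable_cubeD hd hL hS) _ hmn

theorem traceN_antitone : Antitone fun n => (meanMatrix P (cubeN n)).trace := fun m n hmn =>
  Finset.sum_le_sum fun i _ => by
    simp only [Matrix.diag_apply, diag_eq_quad]
    exact meanN_quad_antitone hst (integrable_cubeN hd hL hS) _ hmn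

theorem traceSum_antitone : Antitone (traceSum P) := fun _ _ hmn =>
  add_le_add (traceD_antitone hd hL hS hst hmn) (traceN_antitone hd hL hS hst hmn)

theorem meanD_quad_le (n : ℕ) (p : Vec d) :
    p ⬝ᵥ (meanMatrix P (cubeD n) *ᵥ p) ≤ (d * (4 + 2 * L) + 1) * (p ⬝ᵥ p) := by
  refine (quad_le_trace (meanD_isSymm P n) (meanD_nonneg hd hL hS n) p).trans ?_
  have h1 := traceD_antitone hd hL hS hst (Nat.zero_le n)
  have h2 := (trace_zero_le hd hL hS).1
  exact mul_le_mul_of_nonneg_right (by linarith) (dot_self_nonneg p)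

theorem meanN_quad_le (n : ℕ) (p : Vec d) :
    p ⬝ᵥ (meanMatrix P (cubeN n) *ᵥ p) ≤ (d * (4 + 2 * L) + 1) * (p ⬝ᵥ p) := by
  refine (quad_le_trace (meanN_isSymm P n) (meanN_nonneg hd hL hS n) p).trans ?_
  have h1 := traceN_antitone hd hL hS hst (Nat.zero_le n)
  have h2 := (trace_zero_le hd hL hS).2
  exact mul_le_mul_of_nonneg_right (by linarith) (dot_self_nonneg p)

/-- Nonnegativity of the mean response at `(p, K⁻¹p)` turns the upper bound `K` on the mean Neumann
matrix into the lower bound `K⁻¹` on the mean Dirichlet matrix. -/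
theorem le_meanD_quad (n : ℕ) (p : Vec d) :
    p ⬝ᵥ p ≤ (d * (4 + 2 * L) + 1) * (p ⬝ᵥ (meanMatrix P (cubeD n) *ᵥ p)) := by
  set K : ℝ := d * (4 + 2 * L) + 1 with hK
  have hK0 : 0 < K := by positivity
  have h1 := meanResponse_nonneg hd hL hS hst n p (K⁻¹ • p)
  have h2 := meanN_quad_le hd hL hS hst n p
  rw [← hK] at h2
  rw [meanResponse, Matrix.mulVec_smul, smul_dotProduct, dotProduct_smul, dotProduct_smul] at h1
  simp only [smul_eq_mul] at h1
  have h3 : K⁻¹ * (K⁻¹ * (p ⬝ᵥ (meanMatrix P (cubeN n) *ᵥ p))) ≤ K⁻¹ * (p ⬝ᵥ p) := by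
    refine mul_le_mul_of_nonneg_left ?_ (by positivity)
    rwa [inv_mul_le_iff₀ hK0]
  have h4 : K⁻¹ * (p ⬝ᵥ p) ≤ p ⬝ᵥ (meanMatrix P (cubeD n) *ᵥ p) := by linarith
  rwa [inv_mul_le_iff₀ hK0] at h4

theorem exists_meanD_mulVec_eq (n : ℕ) (e : Vec d) (he : e ⬝ᵥ e = 1) :
    ∃ p : Vec d, meanMatrix P (cubeD n) *ᵥ p = e ∧ p ⬝ᵥ p ≤ (d * (4 + 2 * L) + 1) ^ 2 := by
  set K : ℝ := d * (4 + 2 * L) + 1 with hK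
  have hK0 : 0 < K := by positivity
  have hinj : Function.Injective (Matrix.mulVecLin (meanMatrix P (cubeD n))) := by
    rw [injective_iff_map_eq_zero]
    intro p hp
    have h1 := le_meanD_quad hd hL hS hst n p
    rw [Matrix.mulVecLin_apply] at hp
    rw [hp, dotProduct_zero, mul_zero] at h1
    exact dotProduct_self_eq_zero.mp (le_antisymm h1 (dot_self_nonneg p))
  obtain ⟨p, hp⟩ := LinearMap.injective_iff_surjective.mp hinj e
  rw [Matrix.mulVecLin_apply] at hp
  refine ⟨p, hp, ?_⟩
  have h1 := le_meanD_quad hd hL hS hst n p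
  rw [hp, ← hK] at h1
  have h2 := dot_sq_le p e
  rw [he, mul_one] at h2
  have h3 := dot_self_nonneg p
  rcases h3.eq_or_lt with h0 | h0
  · rw [← h0]
    positivity
  · have h4 : (p ⬝ᵥ p) ^ 2 ≤ K ^ 2 * (p ⬝ᵥ p) := by
      refine (pow_le_pow_left₀ h3 h1 2).trans ?_
      rw [mul_pow]
      exact mul_le_mul_of_nonneg_left h2 (by positivity)
    rw [sq] at h4
    exact le_of_mul_le_mul_right h4 h0

theorem meanResponse_sub_le {m n : ℕ} (hmn : m ≤ n) {p q : Vec d} {K : ℝ} (hp : p ⬝ᵥ p ≤ K)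
    (hq : q ⬝ᵥ q ≤ K) : meanResponse P m p q - meanResponse P n p q ≤
      K * (traceSum P m - traceSum P n) := by
  have h1 := quad_le_trace ((meanD_isSymm P m).sub (meanD_isSymm P n))
    (meanD_sub_quad hd hL hS hst hmn) p
  have h2 := quad_le_trace ((meanN_isSymm P m).sub (meanN_isSymm P n))
    (meanN_sub_quad hd hL hS hst hmn) q
  have h3 := sub_nonneg.mpr (traceD_antitone hd hL hS hst hmn)
  have h4 := sub_nonneg.mpr (traceN_antitone hd hL hS hst hmn)
  rw [Matrix.trace_sub, Matrix.sub_mulVec, dotProduct_sub] at h1 h2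
  simp only at h3 h4
  have h5 := mul_le_mul_of_nonneg_left hp h3
  have h6 := mul_le_mul_of_nonneg_left hq h4
  have hK : 0 ≤ K := (dot_self_nonneg p).trans hp
  have h7 := mul_nonneg hK h3
  have h8 := mul_nonneg hK h4
  rw [meanResponse, meanResponse, traceSum, traceSum]
  nlinarith

/-- For any `q`, positivity of the mean response at scale `N` and monotonicity of `E[N]` give
`e·E[D_N]e ≥ 2 e·q - q·E[N_n]q`. Hence `e·(E[D_n] - E[D_N])e` is at most twice the mean response at
`(e, q)` and scale `n`. The Neumann matrices are treated in the same way, and there are `2d`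
diagonal entries in all. -/
theorem traceSum_sub_le {n N : ℕ} (hnN : n ≤ N) {f : Fin d → Vec d × Vec d} {B : ℝ}
    (hf : ∀ i, meanResponse P n (Pi.single i 1) (f i).1 ≤ B)
    (hg : ∀ i, meanResponse P n (f i).2 (Pi.single i 1) ≤ B) :
    traceSum P n - traceSum P N ≤ 4 * d * B := by
  have h1 : ∀ i, (meanMatrix P (cubeD n) - meanMatrix P (cubeD N)) i i ≤ 2 * B := by
    intro i
    have h2 := meanResponse_nonneg hd hL hS hst N (Pi.single i 1) (f i).1
    have h3 := meanN_quad_antitone hst (integrable_cubeN hd hL hS) (f i).1 hnN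
    have h4 := hf i
    simp only [meanResponse, ← diag_eq_quad] at h2 h3 h4
    rw [Matrix.sub_apply]
    linarith
  have h2 : ∀ i, (meanMatrix P (cubeN n) - meanMatrix P (cubeN N)) i i ≤ 2 * B := by
    intro i
    have h2 := meanResponse_nonneg hd hL hS hst N (f i).2 (Pi.single i 1)
    have h3 := meanD_quad_antitone hst (integrable_cubeD hd hL hS) (f i).2 hnN
    have h4 := hg i
    simp only [meanResponse, ← diag_eq_quad] at h2 h3 h4
    rw [Matrix.sub_apply]
    linarith
  have e : traceSum P n - traceSum P N = (meanMatrix P (cubeD n) - meanMatrix P (cubeD N)).trace +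
      (meanMatrix P (cubeN n) - meanMatrix P (cubeN N)).trace := by
    rw [Matrix.trace_sub, Matrix.trace_sub, traceSum, traceSum]
    ring
  rw [e]
  refine (add_le_add (Finset.sum_le_sum fun i _ => h1 i)
    (Finset.sum_le_sum fun i _ => h2 i)).trans (le_of_eq ?_)
  simp
  ring

end

/-- The bound on the mean response holds only for pairs `(p, E[D_m]p)`. For Dirichlet entries take
`p = e_i`; for Neumann entries solve `E[D_m]p = e_i`, which the uniform bounds on `E[D_m]` allow
with controlled `|p|`. -/
theorem exists_traceSum_sub_le (d : ℕ) (L : ℝ) (hL : 0 ≤ L) : ∃ C > 0,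
    ∀ (P : Measure (CoeffField d)) [IsProbabilityMeasure P] (δ M : ℕ → ℝ), 0 < d →
    IsSuppressive P L δ M → IsStationary P → ∀ m k N : ℕ, m + (k + 1) ≤ N →
    C * (M (m + (k + 1)) / δ (m + (k + 1))) ≤ 9 ^ (k + 1) →
    traceSum P (m + (k + 1)) - traceSum P N ≤
      C * (M (m + (k + 1)) / δ (m + (k + 1))) * (traceSum P m - traceSum P (m + (k + 1))) +
      C * (M (m + (k + 1)) / δ (m + (k + 1))) * varD P m +
      C * Real.exp (-((m + (k + 1) : ℕ) : ℝ)) := by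
  obtain ⟨C, hC, hmain⟩ := exists_meanResponse_le d
  set K : ℝ := d * (4 + 2 * L) + 1 with hK
  have hK0 : 0 < K := by positivity
  have hK1 : 1 ≤ K := le_add_of_nonneg_left (by positivity)
  have hK2 : 1 ≤ K ^ 2 := one_le_pow₀ hK1
  -- The summand `C` makes the smallness hypothesis imply the one of `exists_meanResponse_le`; the
  -- rest comes from the factor `4d` of `traceSum_sub_le`.
  refine ⟨C + 4 * d * (C * K ^ 2 + 8 * K ^ 2 * L), by positivity, ?_⟩
  intro P _ δ M hd hS hst m k N hN hsmall
  set n := m + (k + 1) with hn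
  set Θ := M n / δ n with hΘ
  have hΘ0 : 0 < Θ := div_pos (hS.M_pos n) (hS.δ_pos n)
  have hCΘ : C * Θ ≤ 9 ^ (k + 1) := by
    have : 0 ≤ 4 * d * (C * K ^ 2 + 8 * K ^ 2 * L) * Θ := by positivity
    linarith
  have hmn : m ≤ n := by omega
  have hV := varD_nonneg P m
  have hT : 0 ≤ traceSum P m - traceSum P n :=
    sub_nonneg.mpr (traceSum_antitone hd hL hS hst hmn)
  have hB : ∀ p : Vec d, p ⬝ᵥ p ≤ K ^ 2 →
      (meanMatrix P (cubeD m) *ᵥ p) ⬝ᵥ (meanMatrix P (cubeD m) *ᵥ p) ≤ K ^ 2 →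
      meanResponse P n p (meanMatrix P (cubeD m) *ᵥ p) ≤
        C * Θ * (K ^ 2 * (traceSum P m - traceSum P n)) + C * Θ * (varD P m * K ^ 2) +
          4 * (K ^ 2 + K ^ 2) * L * Real.exp (-(n : ℝ)) := by
    intro p hp hq
    refine (hmain P L δ M hd hL hS hst m k p hCΘ).trans ?_
    have h1 := meanResponse_sub_le hd hL hS hst hmn hp hq
    gcongr
  have hs1 : ∀ i : Fin d, (Pi.single i 1 : Vec d) ⬝ᵥ Pi.single i 1 = 1 := fun i => by simp
  choose g hg1 hg2 using fun i : Fin d =>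
    exists_meanD_mulVec_eq hd hL hS hst m (Pi.single i 1) (hs1 i)
  have h := traceSum_sub_le hd hL hS hst hN
    (f := fun i => (meanMatrix P (cubeD m) *ᵥ Pi.single i 1, g i))
    (fun i => hB _ ((hs1 i).trans_le hK2) ?_) (fun i => by
      have := hB (g i) (hg2 i) (by rw [hg1, hs1]; exact hK2)
      rwa [hg1] at this)
  · refine h.trans ?_
    have e1 : 0 ≤ C * Θ * (traceSum P m - traceSum P n) := by positivity
    have e2 : 0 ≤ C * Θ * varD P m := by positivity
    have e3 : 0 ≤ 4 * d * (8 * K ^ 2 * L) * Θ * (traceSum P m - traceSum P n) := by positivity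
    have e4 : 0 ≤ 4 * d * (8 * K ^ 2 * L) * Θ * varD P m := by positivity
    have e5 : 0 ≤ (C + 4 * d * (C * K ^ 2)) * Real.exp (-(n : ℝ)) := by positivity
    linarith
  · have h1 := mulVec_dot_self_le (meanD_isSymm P m) (meanD_nonneg hd hL hS m)
      (meanD_quad_le hd hL hS hst m) (Pi.single i 1)
    have h2 := meanD_quad_le hd hL hS hst m (Pi.single i 1)
    rw [hs1, mul_one, ← hK] at h2
    rw [← hK] at h1
    refine h1.trans ?_
    rw [sq]
    exact mul_le_mul_of_nonneg_left h2 hK0.le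

/-! ### Iteration of the recursion -/

theorem exists_natCast_add_one_mul_exp_le {c γ : ℝ} (hc : 0 < c) (hγ : 0 < γ) : ∃ K > 0, ∀ n : ℕ,
    ((n : ℝ) + 1) * Real.exp (-(c * (n : ℝ) ^ γ)) ≤ K * Real.exp (-(c / 2 * (n : ℝ) ^ γ)) := by
  obtain ⟨k, hk⟩ := exists_nat_ge (1 / γ)
  have hK : (0 : ℝ) < (2 / c) ^ k * (k.factorial : ℝ) + 1 := by positivity
  refine ⟨(2 / c) ^ k * (k.factorial : ℝ) + 1, hK, fun n => ?_⟩
  set y : ℝ := c / 2 * (n : ℝ) ^ γ with hy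
  have hy0 : 0 ≤ y := by positivity
  have h1 : (n : ℝ) ≤ (2 / c) ^ k * (k.factorial : ℝ) * Real.exp y := by
    rcases Nat.eq_zero_or_pos n with rfl | hn
    · simp only [Nat.cast_zero]
      positivity
    have hn1 : (1 : ℝ) ≤ n := by exact_mod_cast hn
    have h2 : (n : ℝ) ≤ ((n : ℝ) ^ γ) ^ k := by
      rw [← Real.rpow_natCast, ← Real.rpow_mul (by positivity)]
      refine (Real.rpow_one (n : ℝ)).symm.le.trans (Real.rpow_le_rpow_of_exponent_le hn1 ?_)
      rwa [div_le_iff₀' hγ] at hk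
    have h3 : ((n : ℝ) ^ γ) ^ k = (2 / c) ^ k * y ^ k := by
      rw [← mul_pow, hy]
      congr 1
      field_simp
    have h4 := Real.pow_div_factorial_le_exp y hy0 k
    rw [div_le_iff₀ (by positivity)] at h4
    rw [h3] at h2
    refine h2.trans ?_
    rw [mul_assoc]
    exact mul_le_mul_of_nonneg_left (by linarith) (by positivity)
  have h2 : 1 ≤ Real.exp y := Real.one_le_exp hy0
  have e : Real.exp (-(c * (n : ℝ) ^ γ)) = Real.exp (-y) * Real.exp (-y) := by
    rw [← Real.exp_add, hy]
    congr 1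
    ring
  rw [e, ← mul_assoc]
  refine mul_le_mul_of_nonneg_right ?_ (Real.exp_pos _).le
  rw [Real.exp_neg, ← div_eq_mul_inv, div_le_iff₀ (Real.exp_pos _)]
  linarith

/-- Add `1/Θ` times the bound on `R`, `4C` times the bound on `V`, and `(C + 4C²Θ)R`. The weights
are such that all multiples of `-R` on the right cancel. The coefficient of `R'` is then smaller by
`1/Θ`, a proportion of at least `1/(6C²Θ²)`, and that of `V'` is halved. -/
theorem recursion_step {R R' V V' Θ C θ E : ℝ} (hC : 1 ≤ C) (hΘ : 1 ≤ Θ) (hθ : θ ≤ Θ)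
    (hR : 0 ≤ R) (hRR : R ≤ R') (hV' : 0 ≤ V') (hE : 0 ≤ E)
    (h1 : R ≤ C * θ * (R' - R) + C * θ * V' + C * E)
    (h2 : V ≤ 1 / 4 * V' + C * θ * (R' - R) + C * E) :
    (C + 4 * C ^ 2 * Θ + 1 / Θ) * R + 4 * C * V ≤
      (1 - 1 / (6 * C ^ 2 * Θ ^ 2)) * ((C + 4 * C ^ 2 * Θ + 1 / Θ) * R' + 4 * C * V') +
        5 * C ^ 2 * E := by
  have hΘ0 : 0 < Θ := by linarith
  have hC0 : 0 < C := by linarith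
  have hx : 0 ≤ R' - R := by linarith
  have h3 : C * θ * (R' - R) ≤ C * Θ * (R' - R) := by gcongr
  have h4 : C * θ * V' ≤ C * Θ * V' := by gcongr
  have h5 : 1 / Θ * R ≤ C * (R' - R) + C * V' + C * E := by
    rw [div_mul_eq_mul_div, one_mul, div_le_iff₀ hΘ0]
    have : C * E ≤ C * E * Θ := le_mul_of_one_le_right (by positivity) hΘ
    linarith
  have h6 : 4 * C * V ≤ C * V' + 4 * C ^ 2 * Θ * (R' - R) + 4 * C ^ 2 * E := by
    have : V ≤ 1 / 4 * V' + C * Θ * (R' - R) + C * E := by linarith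
    nlinarith
  have h7 : (C + 4 * C ^ 2 * Θ + 1 / Θ) * R + 4 * C * V ≤
      (C + 4 * C ^ 2 * Θ) * R' + 2 * C * V' + (C + 4 * C ^ 2) * E := by linarith
  have h8 : (C + 4 * C ^ 2) * E ≤ 5 * C ^ 2 * E := by
    refine mul_le_mul_of_nonneg_right ?_ hE
    nlinarith
  have hΘC : 1 ≤ C ^ 2 * Θ ^ 2 := one_le_mul_of_one_le_of_one_le (one_le_pow₀ hC) (one_le_pow₀ hΘ)
  have h9 : 1 / (6 * C ^ 2 * Θ ^ 2) * (C + 4 * C ^ 2 * Θ + 1 / Θ) ≤ 1 / Θ := by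
    rw [div_mul_eq_mul_div, one_mul, div_le_div_iff₀ (by positivity) hΘ0, one_mul, add_mul,
      one_div_mul_cancel hΘ0.ne']
    have h10 : C * Θ ≤ C ^ 2 * Θ ^ 2 := by
      rw [← mul_pow]
      exact le_self_pow₀ (one_le_mul_of_one_le_of_one_le hC hΘ) two_ne_zero
    nlinarith
  have h11 : 1 / (6 * C ^ 2 * Θ ^ 2) ≤ 1 / 2 := by
    refine one_div_le_one_div_of_le two_pos ?_
    linarith
  have hR' : 0 ≤ R' := by linarith
  have h12 := mul_le_mul_of_nonneg_right h9 hR'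
  have h13 := mul_le_mul_of_nonneg_right h11 (show 0 ≤ 4 * C * V' by positivity)
  linarith

/-- The iteration descends from `n` in steps of `l` and stays at levels whose upper end is at least
`n/2`. The tail terms on this range are controlled by `e^{-n/2}`. -/
theorem recursion_iterate {Y : ℕ → ℝ} {ρ E : ℝ} {n l : ℕ} (hρ0 : 0 ≤ ρ) (hρ1 : ρ ≤ 1)
    (hE : 0 ≤ E) (h : ∀ m, m + l ≤ n → n ≤ 2 * (m + l) → Y (m + l) ≤ ρ * Y m + E) (j : ℕ)
    (hj : 2 * (j * l) ≤ n) : Y n ≤ ρ ^ j * Y (n - j * l) + j * E := by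
  induction j with
  | zero => simp
  | succ j ih =>
    rw [add_mul, one_mul] at hj
    have h1 := ih (by omega)
    have h2 := h (n - (j + 1) * l) (by rw [add_mul]; omega) (by rw [add_mul]; omega)
    have e : n - (j + 1) * l + l = n - j * l := by rw [add_mul]; omega
    rw [e] at h2
    have h3 := mul_le_mul_of_nonneg_left h2 (pow_nonneg hρ0 j)
    have h4 : ρ ^ j * E ≤ E := mul_le_of_le_one_left hE (pow_le_one₀ hρ0 hρ1)
    rw [pow_succ]
    push_cast
    linarith

/-- About `n/(2DΘ)` steps fit into the upper half of the scales and each contracts by `1 -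
1/(6C²Θ²)`. The exponent is of order `n/Θ³`, that is, `n^{1-3α}`. -/
theorem exists_recursion_decay {α C : ℝ} (hα : α ∈ Set.Ioo (0 : ℝ) (1 / 3)) (hC : 1 ≤ C) (k₀ : ℕ) :
    ∃ c K : ℝ, 0 < c ∧ 0 < K ∧ ∀ T V : ℕ → ℝ, Antitone T → (∀ n, 0 ≤ T n) → T 0 ≤ C →
      (∀ n, 0 ≤ V n) → (∀ n : ℕ, V n ≤ C * ((n : ℝ) + 1)) →
      (∀ m k N : ℕ, m + (k + 1) ≤ N → C * (((m + (k + 1) : ℕ) : ℝ) + 1) ^ α ≤ 9 ^ (k + 1) →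
        T (m + (k + 1)) - T N ≤
          C * (((m + (k + 1) : ℕ) : ℝ) + 1) ^ α * (T m - T (m + (k + 1))) +
          C * (((m + (k + 1) : ℕ) : ℝ) + 1) ^ α * V m +
          C * Real.exp (-((m + (k + 1) : ℕ) : ℝ))) →
      (∀ m k : ℕ, k₀ ≤ k → V (m + k) ≤ 1 / 4 * V m +
          C * (((m + k : ℕ) : ℝ) + 1) ^ α * (T m - T (m + k)) +
          C * Real.exp (-((m + k : ℕ) : ℝ))) →
      ∀ n N : ℕ, n ≤ N → T n - T N + V n ≤ K * Real.exp (-(c * (n : ℝ) ^ (1 - 3 * α))) := by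
  obtain ⟨hα0, hα1⟩ := hα
  have hγ : 0 < 1 - 3 * α := by linarith
  have hC0 : 0 < C := by linarith
  set D : ℝ := C + k₀ + 2 with hD
  have hD0 : 2 ≤ D := by
    have : (0 : ℝ) ≤ k₀ := by positivity
    linarith
  -- Product of `1/(6C²Θ²)` per step and `n/(2DΘ)` steps, with a further 2 from `Θ³ ≤ 2 n^{3α}`.
  set c : ℝ := 1 / (24 * D * C ^ 2) with hc
  have hc0 : 0 < c := by positivity
  have hC2 : 1 ≤ C ^ 2 := one_le_pow₀ hC
  have hc1 : c ≤ 1 / 2 := by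
    refine one_div_le_one_div_of_le two_pos ?_
    nlinarith
  obtain ⟨K, hK, hKn⟩ := exists_natCast_add_one_mul_exp_le hc0 hγ
  refine ⟨c / 2, 2 * C + 40 * C ^ 3 * K, by positivity, by positivity, ?_⟩
  intro T V hT hT0 hTC hV hVC h1 h2 n N hnN
  -- At `n = 0` the exponential is one and the initial bounds suffice; the bound `n + 1 ≤ 2n` used
  -- below needs `n ≥ 1`.
  rcases Nat.eq_zero_or_pos n with rfl | hn
  · have e1 := hVC 0
    have e2 := hT0 N
    rw [Nat.cast_zero, Real.zero_rpow hγ.ne', mul_zero, neg_zero, Real.exp_zero]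
    rw [Nat.cast_zero] at e1
    have : 0 ≤ 40 * C ^ 3 * K := by positivity
    linarith
  have hn1 : (1 : ℝ) ≤ n := by exact_mod_cast hn
  set Θ : ℝ := ((n : ℝ) + 1) ^ α with hΘ
  have hΘ1 : 1 ≤ Θ := Real.one_le_rpow (by linarith) hα0.le
  have hΘ0 : 0 < Θ := by linarith
  have hΘn : Θ ≤ (n : ℝ) + 1 := by
    refine (Real.rpow_le_rpow_of_exponent_le (by linarith) (by linarith : α ≤ 1)).trans ?_
    rw [Real.rpow_one]
  -- The condition `CΘ ≤ 9^l` would only need `l` of order `log Θ`. The linear choice costs one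
  -- factor `Θ` and avoids logarithms.
  set l : ℕ := ⌈C * Θ⌉₊ + k₀ + 1 with hl
  have hlC : C * Θ ≤ l := by
    have := Nat.le_ceil (C * Θ)
    rw [hl]
    push_cast
    have : (0 : ℝ) ≤ k₀ := by positivity
    linarith
  have hlD : (l : ℝ) ≤ D * Θ := by
    have h3 := (Nat.ceil_lt_add_one (by positivity : 0 ≤ C * Θ)).le
    have h4 : (k₀ : ℝ) + 2 ≤ (k₀ + 2) * Θ := le_mul_of_one_le_right (by positivity) hΘ1
    rw [hl, hD]
    push_cast
    linarith
  have hl9 : C * Θ ≤ 9 ^ l := by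
    refine hlC.trans ?_
    exact_mod_cast (Nat.lt_pow_self (by norm_num : 1 < 9)).le
  let R : ℕ → ℝ := fun i => T i - T N
  let Y : ℕ → ℝ := fun i => (C + 4 * C ^ 2 * Θ + 1 / Θ) * R i + 4 * C * V i
  set x : ℝ := 1 / (6 * C ^ 2 * Θ ^ 2) with hx
  have hx0 : 0 < x := by positivity
  have hx1 : x ≤ 1 := by
    rw [hx, div_le_one (by positivity)]
    have := one_le_mul_of_one_le_of_one_le hC2 (one_le_pow₀ hΘ1 (n := 2))
    linarith
  set E : ℝ := Real.exp (-((n : ℝ) / 2)) with hE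
  have hstep : ∀ m, m + l ≤ n → n ≤ 2 * (m + l) → Y (m + l) ≤ (1 - x) * Y m + 5 * C ^ 2 * E := by
    intro m hm1 hm2
    have hθ : (((m + l : ℕ) : ℝ) + 1) ^ α ≤ Θ := by
      refine Real.rpow_le_rpow (by positivity) ?_ hα0.le
      have : ((m + l : ℕ) : ℝ) ≤ n := by exact_mod_cast hm1
      linarith
    have hexp : Real.exp (-((m + l : ℕ) : ℝ)) ≤ E := by
      refine Real.exp_le_exp.mpr ?_
      have : (n : ℝ) ≤ 2 * ((m + l : ℕ) : ℝ) := by exact_mod_cast hm2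
      linarith
    have e1 := h1 m (⌈C * Θ⌉₊ + k₀) N (by omega)
      ((mul_le_mul_of_nonneg_left hθ hC0.le).trans hl9)
    have e2 := h2 m l (by omega)
    rw [← hl] at e1
    have e3 : T (m + l) ≤ T m := hT (by omega)
    have e4 : T N ≤ T (m + l) := hT (by omega)
    have hCE := mul_le_mul_of_nonneg_left hexp hC0.le
    refine recursion_step (R := R (m + l)) (R' := R m) (V' := V m) hC hΘ1 hθ
      (sub_nonneg.mpr e4) (by simp only [R]; linarith) (hV m) (Real.exp_pos _).le ?_ ?_
    · simp only [R, sub_sub_sub_cancel_right]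
      linarith
    · simp only [R, sub_sub_sub_cancel_right]
      linarith
  set J : ℕ := n / (2 * l) with hJ
  have hlpos : 0 < l := by omega
  have hJl : 2 * (J * l) ≤ n := by
    have := Nat.div_mul_le_self n (2 * l)
    rw [← hJ] at this
    linarith
  have hiter := recursion_iterate (by linarith) (by linarith) (by positivity) hstep J hJl
  have hJn : (J : ℝ) ≤ n := by exact_mod_cast Nat.div_le_self n (2 * l)
  have hlr : (0 : ℝ) < l := by exact_mod_cast hlpos
  have hJ1 : (n : ℝ) / (2 * (D * Θ)) ≤ J + 1 := by
    have h3 : n < (J + 1) * (2 * l) := by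
      have := Nat.lt_div_mul_add (a := n) (b := 2 * l) (by omega)
      rw [← hJ] at this
      linarith
    have h4 : (n : ℝ) ≤ (J + 1) * (2 * l) := by exact_mod_cast h3.le
    rw [div_le_iff₀ (by positivity)]
    refine h4.trans (mul_le_mul_of_nonneg_left (by linarith) (by positivity))
  have hΘ3 : Θ ^ 3 ≤ 2 * (n : ℝ) ^ (3 * α) := by
    have e1 : Θ ^ 3 = ((n : ℝ) + 1) ^ (3 * α) := by
      rw [hΘ, ← Real.rpow_natCast, ← Real.rpow_mul (by positivity)]
      congr 1
      push_cast
      ring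
    rw [e1]
    refine (Real.rpow_le_rpow (by positivity) (by linarith : (n : ℝ) + 1 ≤ 2 * n)
      (by linarith)).trans ?_
    rw [Real.mul_rpow (by norm_num) (by positivity)]
    refine mul_le_mul_of_nonneg_right ?_ (by positivity)
    refine (Real.rpow_le_rpow_of_exponent_le one_le_two (by linarith : 3 * α ≤ 1)).trans ?_
    rw [Real.rpow_one]
  have hrate : c * (n : ℝ) ^ (1 - 3 * α) ≤ x * J + 1 := by
    have h3 : (n : ℝ) ^ (1 - 3 * α) * Θ ^ 3 ≤ 2 * n := by
      refine (mul_le_mul_of_nonneg_left hΘ3 (by positivity)).trans (le_of_eq ?_)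
      rw [mul_left_comm, ← Real.rpow_add (by positivity)]
      norm_num
    have h4 : c * (n : ℝ) ^ (1 - 3 * α) ≤ x * ((n : ℝ) / (2 * (D * Θ))) := by
      rw [hc, hx, div_mul_div_comm, div_mul_eq_mul_div, div_le_div_iff₀ (by positivity)
        (by positivity)]
      have h5 := mul_le_mul_of_nonneg_left h3 (show 0 ≤ 12 * D * C ^ 2 by positivity)
      nlinarith
    have h5 := mul_le_mul_of_nonneg_left hJ1 hx0.le
    linarith
  have hpow : (1 - x) ^ J ≤ 3 * Real.exp (-(c * (n : ℝ) ^ (1 - 3 * α))) := by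
    have h3 : (1 - x) ^ J ≤ Real.exp (-x) ^ J := by
      refine pow_le_pow_left₀ (by linarith) ?_ J
      have := Real.add_one_le_exp (-x)
      linarith
    rw [← Real.exp_nat_mul] at h3
    have h4 : Real.exp (J * -x) ≤ Real.exp (1 + -(c * (n : ℝ) ^ (1 - 3 * α))) :=
      Real.exp_le_exp.mpr (by linarith)
    rw [Real.exp_add] at h4
    have h5 : Real.exp 1 ≤ 3 := by linarith [Real.exp_one_lt_d9]
    exact h3.trans (h4.trans (mul_le_mul_of_nonneg_right h5 (Real.exp_pos _).le))
  have hEn : E ≤ Real.exp (-(c * (n : ℝ) ^ (1 - 3 * α))) := by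
    refine Real.exp_le_exp.mpr ?_
    have h3 : (n : ℝ) ^ (1 - 3 * α) ≤ n := by
      refine (Real.rpow_le_rpow_of_exponent_le hn1 (by linarith : 1 - 3 * α ≤ 1)).trans ?_
      rw [Real.rpow_one]
    have h4 : c * (n : ℝ) ^ (1 - 3 * α) ≤ 1 / 2 * n := mul_le_mul hc1 h3 (by positivity) (by norm_num)
    linarith
  have hstart : Y (n - J * l) ≤ 10 * C ^ 3 * ((n : ℝ) + 1) := by
    have h3 : R (n - J * l) ≤ C := by
      have := hT (Nat.zero_le (n - J * l))
      have := hT0 N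
      simp only [R]
      linarith
    have h4 : V (n - J * l) ≤ C * ((n : ℝ) + 1) := by
      refine (hVC _).trans (mul_le_mul_of_nonneg_left ?_ hC0.le)
      have : ((n - J * l : ℕ) : ℝ) ≤ n := by exact_mod_cast Nat.sub_le _ _
      linarith
    have h5 : 1 / Θ ≤ 1 := by rw [div_le_one hΘ0]; exact hΘ1
    have h6 : C + 4 * C ^ 2 * Θ + 1 / Θ ≤ 6 * C ^ 2 * ((n : ℝ) + 1) := by
      have e1 : 4 * C ^ 2 * Θ ≤ 4 * C ^ 2 * ((n : ℝ) + 1) := by gcongr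
      have e0 : C ^ 2 ≤ C ^ 2 * ((n : ℝ) + 1) :=
        le_mul_of_one_le_right (by positivity) (by linarith)
      have e2 : C ≤ C ^ 2 * ((n : ℝ) + 1) := (le_self_pow₀ hC two_ne_zero).trans e0
      have e3 : 1 ≤ C ^ 2 * ((n : ℝ) + 1) := hC2.trans e0
      linarith
    have h7 : (C + 4 * C ^ 2 * Θ + 1 / Θ) * R (n - J * l) ≤ 6 * C ^ 2 * ((n : ℝ) + 1) * C :=
      (mul_le_mul_of_nonneg_left h3 (by positivity)).trans
        (mul_le_mul_of_nonneg_right h6 hC0.le)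
    have h8 : 4 * C * V (n - J * l) ≤ 4 * C * (C * ((n : ℝ) + 1)) := by gcongr
    have h9 : C ^ 2 * ((n : ℝ) + 1) ≤ C ^ 3 * ((n : ℝ) + 1) := by
      gcongr
      norm_num
    simp only [Y]
    linarith
  have hY : T n - T N + V n ≤ Y n := by
    have h3 : 0 ≤ R n := sub_nonneg.mpr (hT hnN)
    have h4 : 0 ≤ (C - 1 + 4 * C ^ 2 * Θ + 1 / Θ) * R n := by
      have : 0 ≤ C - 1 := by linarith
      positivity
    have h5 : 0 ≤ (4 * C - 1) * V n := mul_nonneg (by linarith) (hV n)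
    simp only [Y, R] at h4 ⊢
    linarith
  set Z := Real.exp (-(c * (n : ℝ) ^ (1 - 3 * α))) with hZ
  have hZ0 : 0 < Z := Real.exp_pos _
  have h3 : (1 - x) ^ J * Y (n - J * l) ≤ 3 * Z * (10 * C ^ 3 * ((n : ℝ) + 1)) :=
    (mul_le_mul_of_nonneg_left hstart (pow_nonneg (by linarith) J)).trans
      (mul_le_mul_of_nonneg_right hpow (by positivity))
  have h4 : (J : ℝ) * (5 * C ^ 2 * E) ≤ ((n : ℝ) + 1) * (5 * C ^ 3 * Z) := by
    have e1 : C ^ 2 ≤ C ^ 3 := pow_le_pow_right₀ hC (by norm_num)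
    have e2 : (J : ℝ) ≤ (n : ℝ) + 1 := by linarith
    gcongr
  have h5 : T n - T N + V n ≤ 40 * C ^ 3 * (((n : ℝ) + 1) * Z) := by
    have : 0 ≤ C ^ 3 * (((n : ℝ) + 1) * Z) := by positivity
    linarith
  have h6 := mul_le_mul_of_nonneg_left (hKn n) (show 0 ≤ 40 * C ^ 3 by positivity)
  have h7 : 0 ≤ 2 * C * Real.exp (-(c / 2 * (n : ℝ) ^ (1 - 3 * α))) := by positivity
  linarith

/-! ### The homogenized matrix and the rate of convergence -/

theorem mu_cube (a : CoeffField d) (n : ℕ) (p : Vec d) :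
    mu a (cube d n) p = (1 / 2 : ℝ) * (p ⬝ᵥ (cubeD n a *ᵥ p)) := by
  rw [← cell_zero]
  exact mu_eq _ a p

theorem represents_mu_cube (a : CoeffField d) (n : ℕ) :
    Represents (coarseMatrix a (cube d n)) (mu a (cube d n)) := by
  rw [← cell_zero, coarseMatrix_eq (bddOpen_cell n 0)]
  exact represents_mu _ a

theorem coarseMatrix_cube (a : CoeffField d) (n : ℕ) : coarseMatrix a (cube d n) = cubeD n a := by
  rw [← cell_zero, coarseMatrix_eq (bddOpen_cell n 0), cubeD]

/-- The matrix-to-operator map is linear on a finite-dimensional space. Continuity makes the error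
in the theorem a measurable random variable. -/
theorem continuous_opNorm_of : Continuous fun B : Fin d → Fin d → ℝ => opNorm (Matrix.of B) := by
  let ℓ : (Fin d → Fin d → ℝ) →ₗ[ℝ] (EuclideanSpace ℝ (Fin d) →L[ℝ] EuclideanSpace ℝ (Fin d)) :=
    { toFun := fun B => Matrix.toEuclideanCLM (𝕜 := ℝ) (n := Fin d) (Matrix.of B)
      map_add' := fun A B => map_add _ (Matrix.of A) (Matrix.of B)
      map_smul' := fun c B => map_smul _ c (Matrix.of B) }
  exact (LinearMap.continuous_of_finiteDimensional ℓ).norm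

section
variable {P : Measure (CoeffField d)} [IsProbabilityMeasure P] {L : ℝ} {δ M : ℕ → ℝ}
  (hd : 0 < d) (hL : 0 ≤ L) (hS : IsSuppressive P L δ M)
include hd hL hS

theorem integral_mu_cube (n : ℕ) (p : Vec d) : Integrable (fun a => mu a (cube d n) p) P ∧
    ∫ a, mu a (cube d n) p ∂P = (1 / 2 : ℝ) * (p ⬝ᵥ (meanMatrix P (cubeD n) *ᵥ p)) := by
  simp_rw [mu_cube]
  rw [integral_const_mul, integral_quad (integrable_cubeD hd hL hS n)]
  exact ⟨(integrable_quad (integrable_cubeD hd hL hS n) p p).const_mul _, rfl⟩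

theorem integral_sq_sub_cubeD (n : ℕ) (i j : Fin d) (b : ℝ) :
    Integrable (fun a => (b - cubeD n a i j) ^ 2) P ∧ ∫ a, (b - cubeD n a i j) ^ 2 ∂P =
      Var[fun a => cubeD n a i j; P] + (b - meanMatrix P (cubeD n) i j) ^ 2 := by
  have hX := memLp_cubeD hd hL hS n i j
  have h1 := hX.integrable one_le_two
  have h2 := hX.integrable_sq
  refine ⟨((memLp_const b).sub hX).integrable_sq, ?_⟩
  rw [variance_eq_sub hX]
  have e : ∀ a, (b - cubeD n a i j) ^ 2 =
      b ^ 2 - 2 * b * cubeD n a i j + cubeD n a i j ^ 2 := fun a => by ring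
  simp_rw [e]
  have h3 : Integrable (fun a => b ^ 2 - 2 * b * cubeD n a i j) P :=
    (integrable_const _).sub (h1.const_mul _)
  rw [integral_add h3 h2,
    integral_sub (integrable_const _) (h1.const_mul _), integral_const, integral_const_mul,
    probReal_univ, one_smul, meanMatrix, Matrix.of_apply]
  simp only [Pi.pow_apply]
  ring

theorem integral_opNorm_sq_le (n : ℕ) (A : Mat d) :
    Integrable (fun a => opNorm (A - cubeD n a) ^ 2) P ∧
    ∫ a, opNorm (A - cubeD n a) ^ 2 ∂P ≤
      varD P n + ∑ i, ∑ j, (A i j - meanMatrix P (cubeD n) i j) ^ 2 := by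
  have h1 := integral_sq_sub_cubeD hd hL hS n
  have hb : Integrable (fun a => ∑ i, ∑ j, (A i j - cubeD n a i j) ^ 2) P :=
    integrable_finsetSum _ fun i _ => integrable_finsetSum _ fun j _ => (h1 i j _).1
  have hm : Measurable fun a => opNorm (A - cubeD n a) ^ 2 := by
    have h2 : Measurable fun (a : CoeffField d) (i j : Fin d) => A i j - cubeD n a i j :=
      measurable_pi_lambda _ fun i => measurable_pi_lambda _ fun j =>
        measurable_const.sub (measurable_cubeD n i j)
    exact (continuous_opNorm_of.measurable.comp h2).pow_const 2
  have hle : ∀ a, opNorm (A - cubeD n a) ^ 2 ≤ ∑ i, ∑ j, (A i j - cubeD n a i j) ^ 2 :=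
    fun a => opNorm_sq_le _
  have hi : Integrable (fun a => opNorm (A - cubeD n a) ^ 2) P :=
    hb.mono' hm.aestronglyMeasurable (ae_of_all _ fun a => by
      rw [Real.norm_eq_abs, abs_of_nonneg (sq_nonneg _)]
      exact hle a)
  refine ⟨hi, (integral_mono hi hb hle).trans (le_of_eq ?_)⟩
  rw [integral_finsetSum _ fun i _ => integrable_finsetSum _ fun j _ => (h1 i j (A i j)).1, varD,
    ← Finset.sum_add_distrib]
  refine Finset.sum_congr rfl fun i _ => ?_
  rw [integral_finsetSum _ fun j _ => (h1 i j (A i j)).1, ← Finset.sum_add_distrib]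
  exact Finset.sum_congr rfl fun j _ => (h1 i j (A i j)).2

/-- A crude starting value for the iteration: second moments are bounded through `δ_n⁻³ + M_n³`, and
`(n+1)^{3α} ≤ n+1` since `α < 1/3`. -/
theorem varD_le_linear {α : ℝ} (hα : α ∈ Set.Ioo (0 : ℝ) (1 / 3))
    (hratio : ∀ n : ℕ, M n / δ n ≤ ((n : ℝ) + 1) ^ α) (n : ℕ) :
    varD P n ≤ d ^ 2 * (4 + 2 * L) * ((n : ℝ) + 1) := by
  have hn : (1 : ℝ) ≤ (n : ℝ) + 1 := by simp
  have hcube : ∀ x : ℝ, 0 ≤ x → x ≤ M n / δ n → x ^ 3 ≤ (n : ℝ) + 1 := by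
    intro x hx hx'
    refine (pow_le_pow_left₀ hx (hx'.trans (hratio n)) 3).trans ?_
    rw [← Real.rpow_natCast, ← Real.rpow_mul (by positivity)]
    refine (Real.rpow_le_rpow_of_exponent_le hn (y := α * (3 : ℕ)) (z := 1) ?_).trans
      (Real.rpow_one _).le
    push_cast
    linarith [hα.2]
  have h1 := hcube _ (inv_pos.mpr (hS.δ_pos n)).le (hS.inv_le_ratio n)
  have h2 := hcube _ (hS.M_pos n).le (hS.M_le_ratio n)
  have hent : ∀ i j, Var[fun a => cubeD n a i j; P] ≤ (4 + 2 * L) * ((n : ℝ) + 1) := by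
    intro i j
    refine (variance_le_expectation_sq (measurable_cubeD n i j).aestronglyMeasurable).trans ?_
    refine (integral_cubeD_sq hd hL hS n i j).2.trans ?_
    have : 2 * L ≤ 2 * L * ((n : ℝ) + 1) := le_mul_of_one_le_right (by positivity) hn
    linarith
  refine (Finset.sum_le_sum fun i _ => Finset.sum_le_sum fun j _ => hent i j).trans (le_of_eq ?_)
  simp
  ring

variable (hst : IsStationary P)
include hst

/-- The mean Dirichlet matrices converge to the homogenized matrix. -/
theorem homogenizedMatrix_spec : Represents (homogenizedMatrix P) (homogenizedMu P) ∧
    (∀ p : Vec d, Tendsto (fun n => ∫ a, mu a (cube d n) p ∂P) atTop (𝓝 (homogenizedMu P p))) ∧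
    ∀ i j, Tendsto (fun n => meanMatrix P (cubeD n) i j) atTop (𝓝 (homogenizedMatrix P i j)) := by
  have hI := integral_mu_cube hd hL hS
  have hlim : ∀ p : Vec d,
      Tendsto (fun n => ∫ a, mu a (cube d n) p ∂P) atTop (𝓝 (homogenizedMu P p)) := by
    intro p
    refine tendsto_atTop_ciInf (fun m n hmn => ?_) ⟨0, ?_⟩
    · simp only [(hI _ p).2]
      exact mul_le_mul_of_nonneg_left
        (meanD_quad_antitone hst (integrable_cubeD hd hL hS) p hmn) (by norm_num)
    · rintro _ ⟨n, rfl⟩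
      simp only [(hI _ p).2]
      exact mul_nonneg (by norm_num) (meanD_nonneg hd hL hS n p)
  have hent : ∀ i j, Tendsto (fun n => meanMatrix P (cubeD n) i j) atTop
      (𝓝 (homogenizedMatrix P i j)) := by
    intro i j
    have h1 := ((hlim (Pi.single i 1 + Pi.single j 1)).sub (hlim (Pi.single i 1))).sub
      (hlim (Pi.single j 1))
    refine h1.congr fun n => ?_
    rw [(hI n _).2, (hI n _).2, (hI n _).2, entry_eq_polarization (meanD_isSymm P n) i j]
    ring
  refine ⟨⟨?_, fun p => ?_⟩, hlim, hent⟩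
  · ext i j
    refine tendsto_nhds_unique (hent j i) ((hent i j).congr fun n => ?_)
    exact (meanD_isSymm P n).apply j i
  · refine tendsto_nhds_unique (hlim p) ?_
    simp only [(hI _ p).2]
    refine Tendsto.const_mul _ ?_
    simp only [dotProduct, Matrix.mulVec]
    exact tendsto_finsetSum _ fun i _ =>
      (tendsto_finsetSum _ fun j _ => (hent i j).mul_const _).const_mul _

/-- For `N ≥ n` the matrix `E[D_n] - E[D_N]` is nonnegative, so its entries are at most its trace,
hence at most `T_n - T_N ≤ B`. Then let `N → ∞`. -/
theorem homogenizedMatrix_sub_le {n : ℕ} {B : ℝ}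
    (hB : ∀ N, n ≤ N → traceSum P n - traceSum P N ≤ B) (i j : Fin d) :
    (homogenizedMatrix P i j - meanMatrix P (cubeD n) i j) ^ 2 ≤ B ^ 2 := by
  have h1 : ∀ᶠ N in atTop,
      (meanMatrix P (cubeD N) i j - meanMatrix P (cubeD n) i j) ^ 2 ≤ B ^ 2 := by
    filter_upwards [eventually_ge_atTop n] with N hN
    have h2 := entry_sq_le_trace_sq ((meanD_isSymm P n).sub (meanD_isSymm P N))
      (meanD_sub_quad hd hL hS hst hN) i j
    rw [Matrix.sub_apply, Matrix.trace_sub] at h2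
    have h3 := sub_nonneg.mpr (traceD_antitone hd hL hS hst hN)
    have h4 := traceN_antitone hd hL hS hst hN
    have h5 := hB N hN
    simp only [traceSum] at h3 h4 h5
    rw [← neg_sub, neg_sq]
    exact h2.trans (pow_le_pow_left₀ h3 (by linarith) 2)
  exact le_of_tendsto
    ((((homogenizedMatrix_spec hd hL hS hst).2.2 i j).sub_const _).pow 2) h1

end

/-- The variance and the trace differences decay. -/
theorem exists_decay (hd : 0 < d) {r : ℝ} (hr : r ∈ Set.Ioo (0 : ℝ) 1) {α : ℝ}
    (hα : α ∈ Set.Ioo (0 : ℝ) (1 / 3)) {L : ℝ} (hL : 0 ≤ L) : ∃ c K : ℝ, 0 < c ∧ 0 < K ∧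
      ∀ (P : Measure (CoeffField d)) [IsProbabilityMeasure P] (δ M : ℕ → ℝ),
        IsStationary P → IsMixing P r → IsSuppressive P L δ M →
        (∀ n : ℕ, M n / δ n ≤ ((n : ℝ) + 1) ^ α) → ∀ n N : ℕ, n ≤ N →
        traceSum P n - traceSum P N + varD P n ≤
          K * Real.exp (-(c * (n : ℝ) ^ (1 - 3 * α))) := by
  obtain ⟨C₁, hC₁, hrec⟩ := exists_traceSum_sub_le d L hL
  have hr1 : 0 < 1 - r := by linarith [hr.2]
  have hr0 := hr.1
  set κ : ℝ := 2 ^ d * ((1 + r) / (1 - r)) with hκ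
  have hκ0 : 0 < κ := by positivity
  -- For `k ≥ k₀` one has `8κ ≤ k ≤ 3^{kd}`, so the averaging factor `2κ 3^{-kd}` in the variance
  -- recursion is at most `1/4`.
  obtain ⟨k₀, hk₀⟩ := exists_nat_ge (8 * κ)
  -- The summands bound, in turn, the constant of the trace recursion, the initial value `T_0`, the
  -- linear growth of the variance, and the two constants `2d³` and `4d⁴L` of `varD_le`.
  set C : ℝ := 1 + C₁ + 2 * d * (4 + 2 * L) + d ^ 2 * (4 + 2 * L) + 2 * d ^ 3 + 4 * d ^ 4 * L
    with hC
  have e1 : 0 ≤ 2 * (d : ℝ) * (4 + 2 * L) := by positivity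
  have e2 : 0 ≤ (d : ℝ) ^ 2 * (4 + 2 * L) := by positivity
  have e3 : 0 ≤ 2 * (d : ℝ) ^ 3 := by positivity
  have e4 : 0 ≤ 4 * (d : ℝ) ^ 4 * L := by positivity
  have hC1 : 1 ≤ C := by linarith
  have hCC₁ : C₁ ≤ C := by linarith
  have hC0 : 0 < C := by linarith
  obtain ⟨c, K, hc, hK, hdecay⟩ := exists_recursion_decay hα hC1 k₀
  refine ⟨c, K, hc, hK, fun P _ δ M hst hmix hS hratio => ?_⟩
  have hT := traceSum_antitone hd hL hS hst
  refine hdecay (traceSum P) (varD P) hT (traceSum_nonneg hd hL hS) ?_ (varD_nonneg P)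
    (fun n => (varD_le_linear hd hL hS hα hratio n).trans ?_) ?_ ?_
  · have h1 := trace_zero_le hd hL hS
    rw [traceSum]
    linarith [h1.1, h1.2]
  · exact mul_le_mul_of_nonneg_right (by linarith) (by positivity)
  · intro m k N hN hsmall
    have hΘ0 : 0 < M (m + (k + 1)) / δ (m + (k + 1)) := div_pos (hS.M_pos _) (hS.δ_pos _)
    have hCΘ : C₁ * (M (m + (k + 1)) / δ (m + (k + 1))) ≤
        C * (((m + (k + 1) : ℕ) : ℝ) + 1) ^ α := by
      gcongr
      exact hratio _
    refine (hrec P δ M hd hS hst m k N hN (hCΘ.trans hsmall)).trans ?_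
    have h1 : 0 ≤ traceSum P m - traceSum P (m + (k + 1)) := sub_nonneg.mpr (hT (by omega))
    have h2 := varD_nonneg P m
    gcongr
  · intro m k hk
    refine (varD_le hd hL hS hst hmix hr m k).trans ?_
    have h1 : 0 ≤ traceSum P m - traceSum P (m + k) := sub_nonneg.mpr (hT (by omega))
    have h2 : (meanMatrix P (cubeD m)).trace - (meanMatrix P (cubeD (m + k))).trace ≤
        traceSum P m - traceSum P (m + k) := by
      have := traceN_antitone hd hL hS hst (Nat.le_add_right m k)
      simp only [traceSum] at this ⊢
      linarith
    have h3 : 2 * (κ * (((3 : ℝ) ^ k) ^ d)⁻¹) ≤ 1 / 4 := by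
      have h4 : 8 * κ ≤ ((3 : ℝ) ^ k) ^ d := by
        refine hk₀.trans ?_
        have h5 : k₀ ≤ (3 ^ k) ^ d :=
          hk.trans ((Nat.lt_pow_self (by norm_num)).le.trans (Nat.le_self_pow hd.ne' _))
        exact_mod_cast h5
      have h6 : κ * (((3 : ℝ) ^ k) ^ d)⁻¹ ≤ 1 / 8 := by
        rw [← div_eq_mul_inv, div_le_iff₀ (by positivity)]
        linarith
      linarith
    have h4 := mul_le_mul_of_nonneg_right h3 (varD_nonneg P m)
    have hM : M (m + k) ≤ (((m + k : ℕ) : ℝ) + 1) ^ α := (hS.M_le_ratio _).trans (hratio _)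
    have h5 : 2 * (d : ℝ) ^ 2 * (d * M (m + k) * ((meanMatrix P (cubeD m)).trace -
        (meanMatrix P (cubeD (m + k))).trace)) ≤
        C * (((m + k : ℕ) : ℝ) + 1) ^ α * (traceSum P m - traceSum P (m + k)) := by
      have h6 : 2 * (d : ℝ) ^ 3 * M (m + k) ≤ C * (((m + k : ℕ) : ℝ) + 1) ^ α :=
        mul_le_mul (by linarith) hM (hS.M_pos _).le hC0.le
      have h7 : 0 ≤ 2 * (d : ℝ) ^ 3 * M (m + k) := by
        have := hS.M_pos (m + k)
        positivity
      have h8 := mul_le_mul_of_nonneg_left h2 h7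
      have h9 := mul_le_mul_of_nonneg_right h6 h1
      linarith
    have h6 : 4 * (d : ℝ) ^ 4 * L * Real.exp (-((m + k : ℕ) : ℝ)) ≤
        C * Real.exp (-((m + k : ℕ) : ℝ)) :=
      mul_le_mul_of_nonneg_right (by linarith) (Real.exp_pos _).le
    linarith

end UnboundedHomogenization

theorem theorem2p6 (d : ℕ) (hd : 0 < d) (r : ℝ) (hr : r ∈ Set.Ioo (0 : ℝ) 1)
    (α : ℝ) (hα : α ∈ Set.Ioo (0 : ℝ) (1 / 3)) (L : ℝ) :
    ∃ c C : ℝ, 0 < c ∧ 0 < C ∧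
      ∀ P : Measure (CoeffField d), IsProbabilityMeasure P →
        IsStationary P → IsMixing P r →
        ∀ δ M : ℕ → ℝ, IsSuppressive P L δ M →
          (∀ n : ℕ, M n / δ n ≤ ((n : ℝ) + 1) ^ α) →
          -- the matrices `a(□_n)` and `ā` represent the quadratic forms that define them
          (∀ (a : CoeffField d) (n : ℕ), Represents (coarseMatrix a (cube d n)) (mu a (cube d n))) ∧
          Represents (homogenizedMatrix P) (homogenizedMu P) ∧
          (∀ p : Vec d, (∀ m : ℕ, Integrable (fun a => mu a (cube d m) p) P) ∧
            Tendsto (fun m : ℕ => ∫ a, mu a (cube d m) p ∂P) atTop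
              (𝓝 (homogenizedMu P p))) ∧
          -- the rate of convergence
          ∀ n : ℕ,
            Integrable
              (fun a => opNorm (homogenizedMatrix P - coarseMatrix a (cube d n)) ^ 2) P ∧
            ∫ a, opNorm (homogenizedMatrix P - coarseMatrix a (cube d n)) ^ 2 ∂P
              ≤ C * Real.exp (-(c * (n : ℝ) ^ (1 - 3 * α))) := by
  -- No sign is assumed for `L`; the tail condition persists with `max L 0`.
  obtain ⟨c, K, hc, hK, hdecay⟩ := exists_decay hd hr hα (le_max_right L 0)
  -- `K` bounds the variance. The `d²` entries of `ā - E[D_n]` contribute at most `d²(KZ)²` with `Z`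
  -- the exponential, and `Z² ≤ Z`.
  refine ⟨c, K + d ^ 2 * K ^ 2, hc, by positivity, ?_⟩
  intro P _ hst hmix δ M hS hratio
  have hL := le_max_right L 0
  have hS' := hS.mono (le_max_left L 0)
  obtain ⟨h1, h2, -⟩ := homogenizedMatrix_spec hd hL hS' hst
  refine ⟨represents_mu_cube, h1,
    fun p => ⟨fun m => (integral_mu_cube hd hL hS' m p).1, h2 p⟩, fun n => ?_⟩
  simp_rw [coarseMatrix_cube]
  obtain ⟨h3, h4⟩ := integral_opNorm_sq_le hd hL hS' n (homogenizedMatrix P)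
  refine ⟨h3, h4.trans ?_⟩
  set Z := Real.exp (-(c * (n : ℝ) ^ (1 - 3 * α))) with hZ
  have hZ0 : 0 < Z := Real.exp_pos _
  have hZ1 : Z ≤ 1 := Real.exp_le_one_iff.mpr (neg_nonpos.mpr (by positivity))
  have h5 := hdecay P δ M hst hmix hS' hratio n
  have hV : varD P n ≤ K * Z := by
    have := h5 n le_rfl
    linarith
  have h6 : ∀ N, n ≤ N → traceSum P n - traceSum P N ≤ K * Z := fun N hN => by
    have := varD_nonneg P n
    linarith [h5 N hN]
  have h7 : ∑ i, ∑ j, (homogenizedMatrix P i j - meanMatrix P (cubeD n) i j) ^ 2 ≤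
      (d : ℝ) ^ 2 * (K * Z) ^ 2 := by
    refine (Finset.sum_le_sum fun i _ => Finset.sum_le_sum fun j _ =>
      homogenizedMatrix_sub_le hd hL hS' hst h6 i j).trans (le_of_eq ?_)
    simp
    ring
  have h8 : (d : ℝ) ^ 2 * (K * Z) ^ 2 ≤ d ^ 2 * K ^ 2 * Z := by
    rw [mul_pow, ← mul_assoc]
    refine mul_le_mul_of_nonneg_left ?_ (by positivity)
    rw [sq]
    exact mul_le_of_le_one_left hZ0.le hZ1
  linarith
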